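/- Let $\Omega\subset\mathbb{R}^3$ be a bounded open set with Lipschitz boundary and let $c:\Omega\to\mathbb{R}$ be measurable with $c_0\le c\le c_1$ for some constants $0<c_0\le c_1$. Put $a(u,w)=\int_\Omega c\,\nabla u\cdot\nabla w\,dx$ and $(v,w)=\int_\Omega vw\,dx$; let $\|u\|_k=\big(\sum_{|\alpha|\le k}\|D^\alpha u\|_{L^2(\Omega)}^2\big)^{1/2}$ be the norm of $H^k(\Omega)$. *Reference element.* Let $\tilde e$ be the closed tetrahedron with vertices $(0,0,0),(1,0,0),(0,1,0),(0,0,1)$, let $\mathcal P_q$ be the space of polynomials of degree at most $q$, let $p\ge 2$, and let $\tilde U=\mathcal P_p+\tilde U^+$ with $\tilde U^+\subset\mathcal P_{p'}$ a linear subspace for some $p'$. Let $\tilde{\mathcal Q}\subset\tilde e$ be a finite set of nodes and let $\{\tilde w_{x}\}_{x\in\tilde{\mathcal Q}}$ span $\tilde U$ with $\tilde w_x(y)=\delta_{xy}$ for $x,y\in\tilde{\mathcal Q}$. Assume that $\tilde w_x|_{\tilde f}=0$ for every closed face $\tilde f$ of $\tilde e$ and every $x\in\tilde{\mathcal Q}\setminus\tilde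 f$, and that $s(\tilde{\mathcal Q})=\tilde{\mathcal Q}$ and $\tilde w_x=\tilde w_{s(x)}\circ s$ on $\tilde e$ for every affine map $s$ of $\tilde e$ onto itself and every $x\in\tilde{\mathcal Q}$. Let $\tilde\omega_x$, $x\in\tilde{\mathcal Q}$, be weights with $\tilde\omega_x>0$ such that $$\int_{\tilde e} q\,\tilde u\,dx=\sum_{x\in\tilde{\mathcal Q}}\tilde\omega_x\,q(x)\,\tilde u(x)\qquad\text{for all } q\in\mathcal P_{p-2},\ \tilde u\in\tilde U.$$ *Discretization.* Let $\mathcal T_h$ be a finite face-to-face tessellation of $\overline\Omega$ by closed tetrahedra $e=\phi_e(\tilde e)$, with $\phi_e$ invertible affine maps, and let $h$ be the smallest number such that every element is contained in a ball of diameter $h$. For $\sigma>0$ call $\mathcal T_h$ $\sigma$-shape-regular if every element $e$ contains a ball of diameter $d_e>0$ with $\operatorname{diam}(e)\le\sigma d_e$. Let $U_h$ be the set of all $w\in H^1_0(\Omega)$ with $w\circ\phi_e\in\tilde U$ for all $e\in\mathcal T_h$, and let $$(v,w)_{\mathcal Q_h}=\sum_{e\in\mathcal T_h}\frac{|e|}{|\tilde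 e|}\sum_{x\in\tilde{\mathcal Q}}\tilde\omega_x\,v(\phi_e(x))\,w(\phi_e(x)),$$ where $v$ and $w$ are represented by functions that are continuous on $\overline\Omega$. **Theorem.** For every $\sigma>0$ there is a constant $C>0$, depending only on $\sigma$, $\Omega$, $c$ and the reference element with its nodes, basis functions and weights, such that the following holds for every $\sigma$-shape-regular $\mathcal T_h$. Let $k_u,k_v\ge 2$ be integers, $u\in H^{k_u}(\Omega)$ and $v\in H^{k_v}(\Omega)$. If $u\in H^1_0(\Omega)$ satisfies $a(u,w)=(v,w)$ for all $w\in H^1_0(\Omega)$, and $u_h\in U_h$ satisfies $a(u_h,w)=(v,w)_{\mathcal Q_h}$ for all $w\in U_h$, then $$\|u-u_h\|_1\le C\,h^{\min(p,\,k_u-1,\,k_v)}\big(\|u\|_{\min(p+1,\,k_u)}+\|v\|_{\min(p,\,k_v)}\big).$$ -/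

import Mathlib

open MeasureTheory Set
open scoped ContDiff

noncomputable section

namespace MassLump

/-- Physical and reference space: `ℝ³` with the Euclidean norm. -/
abbrev E3 : Type := EuclideanSpace ℝ (Fin 3)

/-! ### Sobolev spaces on an open set -/

/-- The classical partial derivative `∂ᵢ f`. -/
def partialDeriv (i : Fin 3) (f : E3 → ℝ) : E3 → ℝ :=
  fun x => fderiv ℝ f x (EuclideanSpace.single i 1)

/-- The classical derivative `D^α f = ∂₁^α₁ ∂₂^α₂ ∂₃^α₃ f`. -/
def multiDeriv (α : Fin 3 → ℕ) (f : E3 → ℝ) : E3 → ℝ :=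
  (partialDeriv 0)^[α 0] ((partialDeriv 1)^[α 1] ((partialDeriv 2)^[α 2] f))

/-- `φ ∈ C_c^∞(Ω)`. -/
def IsTestFun (Ω : Set E3) (φ : E3 → ℝ) : Prop :=
  ContDiff ℝ ∞ φ ∧ HasCompactSupport φ ∧ tsupport φ ⊆ Ω

/-- `g ∈ L²(Ω)` is the weak derivative `D^α u` of `u` in `Ω`. -/
def IsWeakDeriv (Ω : Set E3) (α : Fin 3 → ℕ) (u g : E3 → ℝ) : Prop :=
  MemLp g 2 (volume.restrict Ω) ∧
    ∀ φ : E3 → ℝ, IsTestFun Ω φ →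
      ∫ x in Ω, u x * multiDeriv α φ x = (-1) ^ (∑ i, α i) * ∫ x in Ω, g x * φ x

open Classical in
/-- A representative of the weak derivative `D^α u` (zero if there is none in `L²(Ω)`). -/
def weakDeriv (Ω : Set E3) (α : Fin 3 → ℕ) (u : E3 → ℝ) : E3 → ℝ :=
  if h : ∃ g, IsWeakDeriv Ω α u g then h.choose else 0

/-- The finite set of multi-indices `α` with `|α| ≤ k`. -/
def multiIndices (k : ℕ) : Finset (Fin 3 → ℕ) :=
  (Fintype.piFinset fun _ : Fin 3 => Finset.range (k + 1)).filter fun α => ∑ i, α i ≤ k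

/-- `u ∈ H^k(Ω)`. -/
def MemH (Ω : Set E3) (k : ℕ) (u : E3 → ℝ) : Prop :=
  MemLp u 2 (volume.restrict Ω) ∧ ∀ α : Fin 3 → ℕ, ∑ i, α i ≤ k → ∃ g, IsWeakDeriv Ω α u g

/-- The `L²(Ω)`-norm. -/
def l2Norm (Ω : Set E3) (u : E3 → ℝ) : ℝ := (eLpNorm u 2 (volume.restrict Ω)).toReal

/-- The norm `‖u‖_k` of `H^k(Ω)`. -/
def sobolevNorm (Ω : Set E3) (k : ℕ) (u : E3 → ℝ) : ℝ :=
  Real.sqrt (∑ α ∈ multiIndices k, l2Norm Ω (weakDeriv Ω α u) ^ 2)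

/-- `u ∈ H₀¹(Ω)`: the closure of `C_c^∞(Ω)` in `H¹(Ω)`. -/
def MemH10 (Ω : Set E3) (u : E3 → ℝ) : Prop :=
  MemH Ω 1 u ∧ ∀ ε > 0, ∃ φ, IsTestFun Ω φ ∧ sobolevNorm Ω 1 (u - φ) < ε

/-- `Ω` has a Lipschitz boundary: near each boundary point and in suitable Cartesian coordinates,
`Ω` is the set of points above the graph of a Lipschitz function. -/
def HasLipschitzBoundary (Ω : Set E3) : Prop :=
  ∀ x ∈ frontier Ω, ∃ (A : E3 ≃ₗᵢ[ℝ] E3) (r : ℝ) (K : NNReal)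
      (γ : EuclideanSpace ℝ (Fin 2) → ℝ), 0 < r ∧ LipschitzWith K γ ∧
    ∀ y ∈ Metric.ball x r, y ∈ Ω ↔ γ !₂[A y 0, A y 1] < A y 2

/-! ### The elliptic problem -/

/-- `a(u,w) = ∫_Ω c ∇u · ∇w dx`. -/
def ellForm (Ω : Set E3) (c : E3 → ℝ) (u w : E3 → ℝ) : ℝ :=
  ∫ x in Ω, c x * ∑ i : Fin 3, weakDeriv Ω (Pi.single i 1) u x * weakDeriv Ω (Pi.single i 1) w x

/-- `u ∈ H₀¹(Ω)` and `a(u,w) = (v,w)` for all `w ∈ H₀¹(Ω)`. -/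
def IsWeakSolution (Ω : Set E3) (c v u : E3 → ℝ) : Prop :=
  MemH10 Ω u ∧ ∀ w, MemH10 Ω w → ellForm Ω c u w = ∫ x in Ω, v x * w x

/-! ### Reference element -/

/-- The vertices `(0,0,0)`, `(1,0,0)`, `(0,1,0)`, `(0,0,1)` of the reference tetrahedron. -/
def refVertex : Fin 4 → E3 :=
  Fin.cons 0 fun i : Fin 3 => EuclideanSpace.single i 1

/-- The (closed) reference tetrahedron. -/
def refTet : Set E3 := convexHull ℝ (range refVertex)

/-- The (closed) face of the reference tetrahedron opposite to vertex `i`. -/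
def refFace (i : Fin 4) : Set E3 := convexHull ℝ (refVertex '' {j | j ≠ i})

/-- The value of a polynomial in three variables at a point of `ℝ³`. -/
def polyEval (q : MvPolynomial (Fin 3) ℝ) (x : E3) : ℝ := MvPolynomial.eval (fun i => x i) q

/-- `𝒫_q`: polynomials of total degree at most `q`. -/
abbrev Poly (q : ℕ) : Submodule ℝ (MvPolynomial (Fin 3) ℝ) :=
  MvPolynomial.restrictTotalDegree (Fin 3) ℝ q

/-- A reference element of degree `p`: an enriched polynomial space `𝒫_p ⊕ U⁺` together with a nodal
basis whose nodes lie on the reference tetrahedron, satisfying the conformity condition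
(a basis function vanishes on every face not containing its node) and the symmetry condition
(invariance under all affine maps of the tetrahedron onto itself), and a set of weights. -/
structure RefElement (p : ℕ) where
  /-- The enrichment space `U⁺`; it consists of polynomials of degree at most `p'`. -/
  Uplus : Submodule ℝ (MvPolynomial (Fin 3) ℝ)
  p' : ℕ
  Uplus_le : Uplus ≤ Poly p'
  /-- The reference nodes. -/
  nodes : Finset E3
  nodes_subset : (nodes : Set E3) ⊆ refTet
  /-- The nodal basis function attached to a node (its values off `nodes` are irrelevant). -/
  basis : E3 → MvPolynomial (Fin 3) ℝ
  span_basis : Submodule.span ℝ (basis '' (nodes : Set E3)) = Poly p ⊔ Uplus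
  nodal : ∀ x ∈ nodes, ∀ y ∈ nodes, polyEval (basis x) y = if x = y then 1 else 0
  conforming : ∀ i : Fin 4, ∀ x ∈ nodes, x ∉ refFace i → ∀ y ∈ refFace i, polyEval (basis x) y = 0
  nodes_symm : ∀ s : E3 →ᵃ[ℝ] E3, s '' refTet = refTet → s '' (nodes : Set E3) = nodes
  basis_symm : ∀ s : E3 →ᵃ[ℝ] E3, s '' refTet = refTet → ∀ x ∈ nodes, ∀ y ∈ refTet,
    polyEval (basis x) y = polyEval (basis (s x)) (s y)
  /-- The weight attached to a node (its values off `nodes` are irrelevant). -/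
  weight : E3 → ℝ

namespace RefElement

variable {p : ℕ} (R : RefElement p)

/-- The reference space `Ũ = 𝒫_p ⊕ U⁺`. -/
def space : Submodule ℝ (MvPolynomial (Fin 3) ℝ) := Poly p ⊔ R.Uplus

/-- All weights of the reference quadrature rule are strictly positive. -/
def PositiveWeights : Prop := ∀ x ∈ R.nodes, 0 < R.weight x

/-- The reference quadrature rule is exact on `𝒫_{p-2} ⊗ Ũ`. -/
def ExactQuadrature : Prop :=
  ∀ q ∈ Poly (p - 2), ∀ u ∈ R.space,
    ∫ x in refTet, polyEval (q * u) x = ∑ x ∈ R.nodes, R.weight x * polyEval (q * u) x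

end RefElement

/-! ### Tetrahedral meshes -/

/-- A (finite, face-to-face) tetrahedral tessellation of `Ω`; the elements are the images of the
reference tetrahedron under the invertible affine maps `φ i`. -/
structure TetMesh (Ω : Set E3) where
  n : ℕ
  φ : Fin n → (E3 ≃ᵃ[ℝ] E3)
  covers : ⋃ i, φ i '' refTet = closure Ω
  disjoint : ∀ i j, i ≠ j → Disjoint (interior (φ i '' refTet)) (interior (φ j '' refTet))
  face_to_face : ∀ i j, φ i '' refTet ∩ φ j '' refTet =
    convexHull ℝ (φ i '' range refVertex ∩ φ j '' range refVertex)

namespace TetMesh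

variable {Ω : Set E3} (T : TetMesh Ω)

/-- The (closed) `i`-th element. -/
def elt (i : Fin T.n) : Set E3 := T.φ i '' refTet

/-- The mesh size: the smallest `d` such that each element is contained in some ball of
diameter `d`. -/
def size : ℝ := sInf {d | 0 ≤ d ∧ ∀ i, ∃ z, T.elt i ⊆ Metric.closedBall z (d / 2)}

/-- Shape regularity: each element contains a ball whose diameter `2r` is at least `1/σ` times the
diameter of the element. -/
def ShapeRegular (σ : ℝ) : Prop :=
  ∀ i, ∃ (z : E3) (r : ℝ), 0 < r ∧ Metric.closedBall z r ⊆ T.elt i ∧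
    Metric.diam (T.elt i) ≤ σ * (2 * r)

variable {p : ℕ} (R : RefElement p)

/-- The discrete space `U_h` of all `w ∈ H₀¹(Ω)` with `w ∘ φ_e ∈ Ũ` for each element `e`. Since the
last condition is imposed at every point of the closed elements, the functions are represented by
their continuous versions on `closure Ω`. -/
def MemUh (w : E3 → ℝ) : Prop :=
  MemH10 Ω w ∧ ∀ i, ∃ q ∈ R.space, ∀ x ∈ refTet, w (T.φ i x) = polyEval q x

/-- The quadrature `(v,w)_{Q_h} = ∑_e (|e| / |ẽ|) ∑_x̃ ω_x̃ v(φ_e x̃) w(φ_e x̃)`. -/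
def quad (v w : E3 → ℝ) : ℝ :=
  ∑ i, (volume.real (T.elt i) / volume.real refTet) *
    ∑ x ∈ R.nodes, R.weight x * (v (T.φ i x) * w (T.φ i x))

/-- `u_h ∈ U_h` and `a(u_h,w) = (v,w)_{Q_h}` for all `w ∈ U_h`. -/
def IsDiscreteSolution (c v uh : E3 → ℝ) : Prop :=
  T.MemUh R uh ∧ ∀ w, T.MemUh R w → ellForm Ω c uh w = T.quad R v w

end TetMesh

end MassLump

end

namespace MassLump

open scoped ENNReal

/-! ### Integral inequalities for smooth functions on convex sets -/

/-! The estimate is an instance of Strang's lemma. Let `χ ∈ U_h` be the nodal interpolant of `u`.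
Coercivity and the two variational equations bound `∇(χ - u_h)` by the interpolation error `∇(u -
χ)` and by the quadrature error for the product of `v` and `χ - u_h` (`strang`); the Poincaré
inequality in `H₀¹(Ω)` turns gradients into the full `H¹` norm. Both errors split over the elements,
so local bounds with constants independent of the element suffice.

Quadrature (`exists_quad_bound`). On an element of diameter `d` let `c` be the mean of `w ∈ U_h`,
and approximate `v ∈ H^m`, `m ≤ p`, by `q` of degree `m - 1` and by `q'` of degree `m - 2`. The rule
is exact for `q c`, because a constant lies in `P_{p-2}` and `q` in `Ũ`, and for `q' (w - c)`,
because `q'` lies in `P_{p-2}` and `w - c` in `Ũ`. Hence the error for `v w` is the error for `(v -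
q) c` plus that for `(v - q') (w - c)`. The first has order `d^m`; the second loses one power of `d`
in `v - q'` and regains it from the Poincaré inequality for `w - c`.

Interpolation (`exists_interp_bound`). The interpolant reproduces `P_p`, so only `u - q` with `q` of
degree at most `p` has to be interpolated. Its supremum is controlled by polynomial approximation,
and the gradients of the basis functions by the inverse radius of an inscribed ball; shape
regularity enters only here.

Polynomial approximation holds on every bounded convex open set with constants that involve only
diameter and volume. Everything rests on `lintegral_sub_sq_le_of_contDiff`, a bound for the double
integral of `|f(z) - f(y)|²` over `y ∈ A`, `z ∈ K` that gains the power `2/3` of `|A| / |K|`. For `A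
= K` it is the Poincaré inequality, whose iteration gives approximation in `L²`
(`exists_poly_approx`). For small `A` it shows that the gradient of an `H²` function satisfies
Morrey's growth condition, whence Hölder continuity (`abs_sub_sq_le_of_hessian`) and approximation
in the supremum norm (`exists_poly_approx_sup`).

Finally `χ` has to exist and to lie in `H₀¹(Ω)`. The extension of `u` by zero satisfies the growth
condition on all of `ℝ³`, so `u` has a continuous representative that vanishes on the boundary
(`exists_continuous_rep`). The face-to-face condition and the symmetry of the reference element make
the local interpolants agree on common faces (`interpPoly_eq_of_mem`). The boundary is a union of
faces (`mem_frontier_of_support`), so conformity makes `χ` vanish outside `Ω`, and a Lipschitz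
function with this property lies in `H₀¹(Ω)` (`memH10_of_lipschitzWith`). -/

theorem lintegral_mul_sq_le {α : Type*} [MeasurableSpace α] (μ : Measure α) {f g : α → ℝ≥0∞}
    (hf : AEMeasurable f μ) (hg : AEMeasurable g μ) :
    (∫⁻ a, f a * g a ∂μ) ^ 2 ≤ (∫⁻ a, f a ^ 2 ∂μ) * ∫⁻ a, g a ^ 2 ∂μ := by
  have h := ENNReal.lintegral_mul_le_Lp_mul_Lq μ Real.HolderConjugate.two_two hf hg
  have h2 := pow_le_pow_left₀ (zero_le) h 2
  refine h2.trans (le_of_eq ?_)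
  rw [mul_pow, ← ENNReal.rpow_natCast, ← ENNReal.rpow_natCast, ← ENNReal.rpow_mul,
    ← ENNReal.rpow_mul]
  norm_num

theorem lintegral_sq_le {α : Type*} [MeasurableSpace α] (μ : Measure α) {f : α → ℝ≥0∞}
    (hf : AEMeasurable f μ) :
    (∫⁻ a, f a ∂μ) ^ 2 ≤ μ univ * ∫⁻ a, f a ^ 2 ∂μ := by
  have h := lintegral_mul_sq_le μ hf (aemeasurable_const (b := (1 : ℝ≥0∞)))
  simpa [mul_comm] using h

theorem lintegral_comp_add_smul (G : E3 → ℝ≥0∞) (a : E3) {t : ℝ} (ht : 0 < t) :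
    ∫⁻ z, G (a + t • z) = ENNReal.ofReal (t ^ 3)⁻¹ * ∫⁻ z, G z := by
  have h1 : ∫⁻ z, G (a + t • z) =
      ∫⁻ z, G (a + z) ∂(Measure.map (t • ·) (volume : Measure E3)) := by
    have := (lintegral_map_equiv (μ := (volume : Measure E3)) (fun z => G (a + z))
      (Homeomorph.smulOfNeZero t ht.ne').toMeasurableEquiv)
    simpa using this.symm
  rw [h1, Measure.map_addHaar_smul _ ht.ne', lintegral_smul_measure,
    lintegral_add_left_eq_self (fun z => G z) a]
  simp [abs_of_pos ht]

theorem setLIntegral_homothety_le (G : E3 → ℝ≥0∞) {K B : Set E3} (hK : MeasurableSet K)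
    (hB : MeasurableSet B) (y : E3) {t : ℝ} (ht : 0 < t)
    (h : ∀ z ∈ K, y + t • (z - y) ∈ B) :
    ∫⁻ z in K, G (y + t • (z - y)) ≤ ENNReal.ofReal (t ^ 3)⁻¹ * ∫⁻ z in B, G z := by
  rw [← lintegral_indicator hK, ← lintegral_indicator hB]
  rw [← lintegral_comp_add_smul (B.indicator G) (y - t • y) ht]
  refine lintegral_mono fun z => ?_
  by_cases hz : z ∈ K
  · have e : y - t • y + t • z = y + t • (z - y) := by rw [smul_sub]; abel
    rw [indicator_of_mem hz, e, indicator_of_mem (h z hz)]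
  · rw [indicator_of_notMem hz]; exact zero_le

/-- The fundamental theorem of calculus along the segment, with `s ^ 2` in place of the usual
parameter. A homothety of ratio `s ^ 2` changes volumes by `s ^ 6`; if volumes are written as sixth
powers, all weights below are rational in `s`. -/
theorem enorm_sub_le_lintegral_fderiv {f : E3 → ℝ} (hf : ContDiff ℝ 1 f) (y z : E3) :
    ‖f z - f y‖ₑ ≤ ‖z - y‖ₑ *
      ∫⁻ s in Ioc (0 : ℝ) 1, ENNReal.ofReal (2 * s) * ‖fderiv ℝ f (y + s ^ 2 • (z - y))‖ₑ := by
  have hd : ∀ s : ℝ, HasDerivAt (fun s : ℝ => f (y + s ^ 2 • (z - y)))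
      (fderiv ℝ f (y + s ^ 2 • (z - y)) ((2 * s) • (z - y))) s := by
    intro s
    have h1 : HasDerivAt (fun s : ℝ => y + s ^ 2 • (z - y)) ((2 * s) • (z - y)) s := by
      have := ((hasDerivAt_pow 2 s).smul_const (z - y)).const_add y
      simpa using this
    exact ((hf.differentiable one_ne_zero _).hasFDerivAt).comp_hasDerivAt s h1
  have hc : Continuous fun s : ℝ => fderiv ℝ f (y + s ^ 2 • (z - y)) ((2 * s) • (z - y)) := by
    have := hf.continuous_fderiv one_ne_zero
    fun_prop
  have hF := intervalIntegral.integral_eq_sub_of_hasDerivAt (a := 0) (b := 1)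
    (fun s _ => hd s) (hc.intervalIntegrable 0 1)
  have e1 : y + (1 : ℝ) ^ 2 • (z - y) = z := by simp
  have e0 : y + (0 : ℝ) ^ 2 • (z - y) = y := by simp
  rw [e1, e0] at hF
  rw [← hF, intervalIntegral.integral_of_le zero_le_one]
  refine (enorm_integral_le_lintegral_enorm _).trans ?_
  rw [← lintegral_const_mul' _ _ (by simp)]
  refine setLIntegral_mono' measurableSet_Ioc fun s hs => ?_
  refine (ContinuousLinearMap.le_opENorm _ _).trans (le_of_eq ?_)
  rw [enorm_smul, Real.enorm_of_nonneg (by linarith [hs.1])]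
  ring

theorem lintegral_weight_le {b : ℝ} (hb : 0 < b) :
    ∫⁻ s in Ioc (0 : ℝ) 1, ENNReal.ofReal ((b + s) ^ 2)⁻¹ ≤ ENNReal.ofReal b⁻¹ := by
  have hd : ∀ s ∈ uIcc (0 : ℝ) 1, HasDerivAt (fun s : ℝ => -(b + s)⁻¹) ((b + s) ^ 2)⁻¹ s := by
    intro s hs
    rw [uIcc_of_le zero_le_one] at hs
    have h1 : HasDerivAt (fun s : ℝ => b + s) 1 s := (hasDerivAt_id s).const_add b
    have := (h1.inv (by linarith [hs.1])).neg
    have e : -(-1 / (b + s) ^ 2) = ((b + s) ^ 2)⁻¹ := by rw [neg_div, neg_neg, one_div]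
    rw [e] at this
    exact this
  have hc : ContinuousOn (fun s : ℝ => ((b + s) ^ 2)⁻¹) (uIcc 0 1) := by
    rw [uIcc_of_le zero_le_one]
    refine ContinuousOn.inv₀ (by fun_prop) fun s hs => ?_
    have : 0 < b + s := by linarith [hs.1]
    positivity
  have hi := hc.intervalIntegrable (μ := volume)
  have hF := intervalIntegral.integral_eq_sub_of_hasDerivAt hd hi
  rw [intervalIntegral.integral_of_le zero_le_one] at hF
  rw [← ofReal_integral_eq_lintegral_ofReal]
  · rw [hF]
    refine ENNReal.ofReal_le_ofReal ?_
    have : 0 < (b + 1)⁻¹ := by positivity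
    simp only [add_zero]
    linarith
  · exact (intervalIntegrable_iff_integrableOn_Ioc_of_le zero_le_one).1 hi
  · exact Filter.Eventually.of_forall fun s => by positivity

/-- The double integral of a function along segments at parameter `s ^ 2`. -/
theorem setLIntegral_segment_le (G : E3 → ℝ≥0∞) (hG : Measurable G) {K A : Set E3}
    (hK : MeasurableSet K) (hKc : Convex ℝ K) (hA : MeasurableSet A) (hAK : A ⊆ K)
    {b s : ℝ} (hb : 0 < b) (hs : s ∈ Ioc (0 : ℝ) 1)
    (hvol : volume A ≤ ENNReal.ofReal (b ^ 6) * volume K) :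
    ∫⁻ y in A, ∫⁻ z in K, G (y + s ^ 2 • (z - y)) ≤
      ENNReal.ofReal (4096 * b ^ 6 * ((b + s) ^ 6)⁻¹) * (volume K * ∫⁻ z in K, G z) := by
  obtain ⟨hs0, hs1⟩ := hs
  have hs2 : 0 < s ^ 2 := by positivity
  have hs21 : s ^ 2 ≤ 1 := pow_le_one₀ hs0.le hs1
  have hmem : ∀ y ∈ K, ∀ z ∈ K, ∀ t : ℝ, 0 ≤ t → t ≤ 1 → y + t • (z - y) ∈ K :=
    fun y hy z hz t h0 h1 => hKc.add_smul_sub_mem hy hz ⟨h0, h1⟩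
  -- The homothety with centre `y` maps `K` into itself. This bound sees the size of `A` but
  -- degenerates as `s → 0`.
  have hone : ∫⁻ y in A, ∫⁻ z in K, G (y + s ^ 2 • (z - y)) ≤
      volume A * (ENNReal.ofReal (s ^ 6)⁻¹ * ∫⁻ z in K, G z) := by
    calc _ ≤ ∫⁻ y in A, (ENNReal.ofReal (s ^ 6)⁻¹ * ∫⁻ z in K, G z) := by
          refine setLIntegral_mono' hA fun y hy => ?_
          have := setLIntegral_homothety_le G hK hK y hs2
            (fun z hz => hmem y (hAK hy) z hz _ hs2.le hs21)
          rwa [← pow_mul] at this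
      _ = _ := by rw [setLIntegral_const, mul_comm]
  have key : ∀ N : ℝ, 0 ≤ N → N ≤ 4096 * b ^ 6 * ((b + s) ^ 6)⁻¹ →
      ∫⁻ y in A, ∫⁻ z in K, G (y + s ^ 2 • (z - y)) ≤
        ENNReal.ofReal N * (volume K * ∫⁻ z in K, G z) →
      ∫⁻ y in A, ∫⁻ z in K, G (y + s ^ 2 • (z - y)) ≤
      ENNReal.ofReal (4096 * b ^ 6 * ((b + s) ^ 6)⁻¹) * (volume K * ∫⁻ z in K, G z) := by
    intro N _ hN h
    exact h.trans (by gcongr)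
  have hbs : 0 < b + s := by positivity
  -- For `b ≤ s` one has `(b + s) ^ 6 ≤ 64 * s ^ 6`. Otherwise `b ^ 6 / (b + s) ^ 6 ≥ 1 / 64`, so
  -- the target factor is at least `64` and a bound without `b` suffices.
  rcases le_or_gt b s with h | h
  · refine key (b ^ 6 * (s ^ 6)⁻¹) (by positivity) ?_ (hone.trans ?_)
    · rw [← div_eq_mul_inv, ← div_eq_mul_inv, div_le_div_iff₀ (by positivity) (by positivity)]
      have h1 : (b + s) ^ 6 ≤ (2 * s) ^ 6 := pow_le_pow_left₀ hbs.le (by linarith) 6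
      have h2 : (2 * s) ^ 6 = 64 * s ^ 6 := by ring
      have h3 : 0 ≤ b ^ 6 * s ^ 6 := by positivity
      nlinarith [mul_le_mul_of_nonneg_left h1 (by positivity : 0 ≤ b ^ 6)]
    · calc _ ≤ (ENNReal.ofReal (b ^ 6) * volume K) *
            (ENNReal.ofReal (s ^ 6)⁻¹ * ∫⁻ z in K, G z) := by gcongr
        _ = _ := by rw [ENNReal.ofReal_mul (by positivity)]; ring
  · have hratio : (64 : ℝ)⁻¹ ≤ b ^ 6 * ((b + s) ^ 6)⁻¹ := by
      rw [← div_eq_mul_inv, le_div_iff₀ (by positivity)]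
      have h1 : (b + s) ^ 6 ≤ (2 * b) ^ 6 := pow_le_pow_left₀ hbs.le (by linarith) 6
      nlinarith
    rcases le_or_gt s (1 / 2) with h' | h'
    -- For small `s`, enlarge `A` to `K` and integrate in `y` first: the homothety with centre `z`
    -- has ratio `1 - s ^ 2 ≥ 3 / 4`.
    · have hone' : ∫⁻ y in A, ∫⁻ z in K, G (y + s ^ 2 • (z - y)) ≤
          volume K * (ENNReal.ofReal ((1 - s ^ 2) ^ 3)⁻¹ * ∫⁻ z in K, G z) := by
        have hpos : 0 < 1 - s ^ 2 := by nlinarith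
        calc _ ≤ ∫⁻ y in K, ∫⁻ z in K, G (y + s ^ 2 • (z - y)) := lintegral_mono_set hAK
          _ = ∫⁻ z in K, ∫⁻ y in K, G (y + s ^ 2 • (z - y)) := by
            refine lintegral_lintegral_swap (Measurable.aemeasurable ?_)
            refine hG.comp (by fun_prop)
          _ ≤ ∫⁻ z in K, (ENNReal.ofReal ((1 - s ^ 2) ^ 3)⁻¹ * ∫⁻ z in K, G z) := by
            refine setLIntegral_mono' hK fun z hz => ?_
            have := setLIntegral_homothety_le G hK hK z hpos
              (fun y hy => hmem z hz y hy _ hpos.le (by linarith))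
            refine le_of_eq_of_le (lintegral_congr fun y => ?_) this
            congr 1
            module
          _ = _ := by rw [setLIntegral_const, mul_comm]
      refine key 3 (by norm_num) (by nlinarith) (hone'.trans ?_)
      rw [mul_left_comm]
      gcongr
      rw [inv_le_comm₀ (by nlinarith [pow_pos (show 0 < 1 - s ^ 2 by nlinarith) 3]) (by norm_num)]
      have : (3 / 4 : ℝ) ^ 3 ≤ (1 - s ^ 2) ^ 3 := pow_le_pow_left₀ (by norm_num) (by nlinarith) 3
      linarith
    · refine key 64 (by norm_num) (by nlinarith) (hone.trans ?_)
      calc _ ≤ volume K * (ENNReal.ofReal (s ^ 6)⁻¹ * ∫⁻ z in K, G z) := by gcongr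
        _ ≤ volume K * (ENNReal.ofReal 64 * ∫⁻ z in K, G z) := by
          gcongr
          rw [inv_le_comm₀ (by positivity) (by norm_num)]
          have : (1 / 2 : ℝ) ^ 6 ≤ s ^ 6 := pow_le_pow_left₀ (by norm_num) h'.le 6
          linarith
        _ = _ := by ring

/-- The gain `b ^ 4` is the power `2 / 3` of the volume ratio `b ^ 6`, as the embedding of `H¹` in
`L⁶` would give. Cauchy–Schwarz along the segment with weight `(b + s) ^ (-2)` costs `b⁻¹`; the
factor `b ^ 6 / (b + s) ^ 6` of `setLIntegral_segment_le` then leaves `b ^ 6` times the integral of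
`(b + s) ^ (-2)`, which is at most `b⁻¹` again. -/
theorem lintegral_sub_sq_le_of_contDiff {f : E3 → ℝ} (hf : ContDiff ℝ 1 f) {K A : Set E3}
    (hK : MeasurableSet K) (hKc : Convex ℝ K) (hA : MeasurableSet A) (hAK : A ⊆ K)
    {b d : ℝ} (hb : 0 < b) (hd : ∀ y ∈ K, ∀ z ∈ K, ‖z - y‖ ≤ d)
    (hvol : volume A ≤ ENNReal.ofReal (b ^ 6) * volume K) :
    ∫⁻ y in A, ∫⁻ z in K, ‖f z - f y‖ₑ ^ 2 ≤
      ENNReal.ofReal (2 ^ 14 * d ^ 2 * b ^ 4) * (volume K * ∫⁻ z in K, ‖fderiv ℝ f z‖ₑ ^ 2) := by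
  have hf' := hf.continuous_fderiv one_ne_zero
  set g : E3 → ℝ≥0∞ := fun w => ‖fderiv ℝ f w‖ₑ with hg
  have hgm : Measurable g := hf'.measurable.enorm
  set I : ℝ≥0∞ := volume K * ∫⁻ z in K, g z ^ 2 with hI
  have hpt : ∀ y ∈ K, ∀ z ∈ K, ‖f z - f y‖ₑ ^ 2 ≤ ENNReal.ofReal (d ^ 2 * b⁻¹) *
      ∫⁻ s in Ioc (0 : ℝ) 1, ENNReal.ofReal ((2 * s) ^ 2 * (b + s) ^ 2) *
        g (y + s ^ 2 • (z - y)) ^ 2 := by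
    intro y hy z hz
    have h1 := enorm_sub_le_lintegral_fderiv hf y z
    have hd0 : 0 ≤ d := (norm_nonneg _).trans (hd y hy z hz)
    have h2 : (∫⁻ s in Ioc (0 : ℝ) 1, ENNReal.ofReal (2 * s) * g (y + s ^ 2 • (z - y))) ^ 2 ≤
        ENNReal.ofReal b⁻¹ * ∫⁻ s in Ioc (0 : ℝ) 1, ENNReal.ofReal ((2 * s) ^ 2 * (b + s) ^ 2) *
        g (y + s ^ 2 • (z - y)) ^ 2 := by
      have h3 := lintegral_mul_sq_le (volume.restrict (Ioc (0 : ℝ) 1))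
        (f := fun s => ENNReal.ofReal (b + s)⁻¹)
        (g := fun s => ENNReal.ofReal (2 * s * (b + s)) * g (y + s ^ 2 • (z - y)))
        (by fun_prop) (by fun_prop)
      have e1 : ∫⁻ s in Ioc (0 : ℝ) 1, ENNReal.ofReal (2 * s) * g (y + s ^ 2 • (z - y)) =
          ∫⁻ s in Ioc (0 : ℝ) 1, ENNReal.ofReal (b + s)⁻¹ *
            (ENNReal.ofReal (2 * s * (b + s)) * g (y + s ^ 2 • (z - y))) := by
        refine setLIntegral_congr_fun measurableSet_Ioc fun s hs => ?_
        have : 0 < b + s := by linarith [hs.1]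
        rw [← mul_assoc, ← ENNReal.ofReal_mul (by positivity)]
        congr 2
        field_simp
      rw [e1]
      refine h3.trans (mul_le_mul' ?_ (le_of_eq ?_))
      · refine le_trans (le_of_eq ?_) (lintegral_weight_le hb)
        refine setLIntegral_congr_fun measurableSet_Ioc fun s hs => ?_
        have : 0 < b + s := by linarith [hs.1]
        rw [← ENNReal.ofReal_pow (by positivity), inv_pow]
      · refine setLIntegral_congr_fun measurableSet_Ioc fun s hs => ?_
        have : 0 < b + s := by linarith [hs.1]
        have := hs.1
        rw [mul_pow, ← ENNReal.ofReal_pow (by positivity), mul_pow]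
    calc ‖f z - f y‖ₑ ^ 2 ≤ (ENNReal.ofReal d * ∫⁻ s in Ioc (0 : ℝ) 1,
          ENNReal.ofReal (2 * s) * g (y + s ^ 2 • (z - y))) ^ 2 := by
          refine pow_le_pow_left₀ zero_le (h1.trans ?_) 2
          gcongr
          rw [← ofReal_norm]
          exact ENNReal.ofReal_le_ofReal (hd y hy z hz)
      _ ≤ _ := by
          rw [mul_pow, ENNReal.ofReal_mul (by positivity), ENNReal.ofReal_pow hd0, mul_assoc]
          gcongr
  calc ∫⁻ y in A, ∫⁻ z in K, ‖f z - f y‖ₑ ^ 2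
      ≤ ∫⁻ y in A, ∫⁻ z in K, ENNReal.ofReal (d ^ 2 * b⁻¹) *
        ∫⁻ s in Ioc (0 : ℝ) 1, ENNReal.ofReal ((2 * s) ^ 2 * (b + s) ^ 2) *
          g (y + s ^ 2 • (z - y)) ^ 2 := by
        refine setLIntegral_mono' hA fun y hy => setLIntegral_mono' hK fun z hz => ?_
        exact hpt y (hAK hy) z hz
    _ = ENNReal.ofReal (d ^ 2 * b⁻¹) * ∫⁻ s in Ioc (0 : ℝ) 1,
        ENNReal.ofReal ((2 * s) ^ 2 * (b + s) ^ 2) *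
          ∫⁻ y in A, ∫⁻ z in K, g (y + s ^ 2 • (z - y)) ^ 2 := by
        have e1 : ∀ y, ∫⁻ z in K, ENNReal.ofReal (d ^ 2 * b⁻¹) *
            ∫⁻ s in Ioc (0 : ℝ) 1, ENNReal.ofReal ((2 * s) ^ 2 * (b + s) ^ 2) *
              g (y + s ^ 2 • (z - y)) ^ 2 = ENNReal.ofReal (d ^ 2 * b⁻¹) *
            ∫⁻ s in Ioc (0 : ℝ) 1, ENNReal.ofReal ((2 * s) ^ 2 * (b + s) ^ 2) *
              ∫⁻ z in K, g (y + s ^ 2 • (z - y)) ^ 2 := by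
          intro y
          rw [lintegral_const_mul' _ _ (by simp), lintegral_lintegral_swap]
          · congr 1
            refine lintegral_congr fun s => ?_
            rw [lintegral_const_mul' _ _ (by simp)]
          · exact Measurable.aemeasurable (by fun_prop)
        simp_rw [e1]
        rw [lintegral_const_mul' _ _ (by simp), lintegral_lintegral_swap]
        · congr 1
          refine lintegral_congr fun s => ?_
          rw [lintegral_const_mul' _ _ (by simp)]
        · refine Measurable.aemeasurable ?_
          refine Measurable.mul (by fun_prop) ?_
          refine Measurable.lintegral_prod_right' (ν := volume.restrict K)
            (f := fun q : (E3 × ℝ) × E3 => g (q.1.1 + q.1.2 ^ 2 • (q.2 - q.1.1)) ^ 2) ?_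
          fun_prop
    _ ≤ ENNReal.ofReal (d ^ 2 * b⁻¹) * ∫⁻ s in Ioc (0 : ℝ) 1,
        ENNReal.ofReal (2 ^ 14 * b ^ 6) * I * ENNReal.ofReal ((b + s) ^ 2)⁻¹ := by
        refine mul_le_mul_right ?_ _
        refine setLIntegral_mono' measurableSet_Ioc fun s hs => ?_
        have h0 := hs.1
        have hbs : 0 < b + s := by linarith
        calc _ ≤ ENNReal.ofReal ((2 * s) ^ 2 * (b + s) ^ 2) *
              (ENNReal.ofReal (4096 * b ^ 6 * ((b + s) ^ 6)⁻¹) * I) := by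
              gcongr
              exact setLIntegral_segment_le (fun w => g w ^ 2) (by fun_prop) hK hKc hA hAK hb hs hvol
          _ = ENNReal.ofReal ((2 * s) ^ 2 * (b + s) ^ 2 * (4096 * b ^ 6 * ((b + s) ^ 6)⁻¹)) * I := by
              rw [← mul_assoc, ← ENNReal.ofReal_mul (by positivity)]
          _ ≤ ENNReal.ofReal (2 ^ 14 * b ^ 6 * ((b + s) ^ 2)⁻¹) * I := by
              refine mul_le_mul_left (ENNReal.ofReal_le_ofReal ?_) _
              -- Here `4 * 4096 = 2 ^ 14`, and the leftover factor `s ^ 2 / (b + s) ^ 2` is at most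
              -- `1`.
              have e : (2 * s) ^ 2 * (b + s) ^ 2 * (4096 * b ^ 6 * ((b + s) ^ 6)⁻¹) =
                2 ^ 14 * b ^ 6 * ((b + s) ^ 2)⁻¹ * (s ^ 2 / (b + s) ^ 2) := by
                field_simp
                ring
              rw [e]
              refine mul_le_of_le_one_right (by positivity) ?_
              rw [div_le_one (by positivity)]
              exact pow_le_pow_left₀ h0.le (by linarith) 2
          _ = _ := by
              rw [ENNReal.ofReal_mul (by positivity) (p := 2 ^ 14 * b ^ 6)]
              ring
    _ ≤ ENNReal.ofReal (d ^ 2 * b⁻¹) * (ENNReal.ofReal (2 ^ 14 * b ^ 6) * I *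
        ENNReal.ofReal b⁻¹) := by
        gcongr
        rw [lintegral_const_mul _ (by fun_prop)]
        gcongr
        exact lintegral_weight_le hb
    _ = _ := by
        have e : 2 ^ 14 * d ^ 2 * b ^ 4 = (d ^ 2 * b⁻¹) * ((2 ^ 14 * b ^ 6) * b⁻¹) := by
          field_simp
        rw [e, ENNReal.ofReal_mul (by positivity) (p := d ^ 2 * b⁻¹),
          ENNReal.ofReal_mul (by positivity) (p := 2 ^ 14 * b ^ 6)]
        ring

theorem volume_homothety_image {K : Set E3} (x : E3) {t : ℝ} (ht : 0 < t) :
    volume ((fun z => x + t • (z - x)) '' K) = ENNReal.ofReal (t ^ 3) * volume K := by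
  have h := Measure.addHaar_image_homothety (volume : Measure E3) x t K
  have e : (fun z => x + t • (z - x)) = AffineMap.homothety x t := by
    funext z; simp [AffineMap.homothety_apply, add_comm]
  rw [e, h]
  simp [abs_of_pos ht]

theorem measurableSet_homothety_image {K : Set E3} (hK : MeasurableSet K) (x : E3) {t : ℝ}
    (ht : 0 < t) : MeasurableSet ((fun z => x + t • (z - x)) '' K) := by
  have e : (fun z => x + t • (z - x)) '' K = (fun w => x + t⁻¹ • (w - x)) ⁻¹' K := by
    ext w
    constructor
    · rintro ⟨z, hz, rfl⟩
      simpa [smul_smul, inv_mul_cancel₀ ht.ne'] using hz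
    · intro hw
      refine ⟨_, hw, ?_⟩
      simp [smul_smul, mul_inv_cancel₀ ht.ne']
  rw [e]
  exact (by fun_prop : Measurable fun w : E3 => x + t⁻¹ • (w - x)) hK

/-- Morrey's argument. The integral at parameter `σ ^ 2` lives on the copy `B` of `K` of volume `(σ
^ 2 * s ^ 2) ^ 3`, where Cauchy–Schwarz and the growth condition give `M * σ ^ 5 * s ^ 5`. Rescaling
costs `σ ^ (-6)`, and the factor `2 * σ` of the substitution cancels the remaining `σ⁻¹`. -/
theorem lintegral_sub_le_of_growth {f : E3 → ℝ} (hf : ContDiff ℝ 1 f) {K : Set E3}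
    (hK : MeasurableSet K) (hKc : Convex ℝ K) {s d M : ℝ} (hs : 0 < s) (hM : 0 ≤ M)
    (hd : ∀ y ∈ K, ∀ z ∈ K, ‖z - y‖ ≤ d) (hvol : volume K = ENNReal.ofReal (s ^ 6))
    (hgr : ∀ θ > 0, ∀ B ⊆ K, MeasurableSet B → volume B ≤ ENNReal.ofReal (θ ^ 3) →
      ∫⁻ z in B, ‖fderiv ℝ f z‖ₑ ^ 2 ≤ ENNReal.ofReal (M ^ 2 * θ ^ 2)) {x : E3} (hx : x ∈ K) :
    ∫⁻ z in K, ‖f z - f x‖ₑ ≤ ENNReal.ofReal (2 * d * M * s ^ 5) := by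
  have hf' := hf.continuous_fderiv one_ne_zero
  have hd0 : 0 ≤ d := (norm_nonneg _).trans (hd x hx x hx)
  set g : E3 → ℝ≥0∞ := fun w => ‖fderiv ℝ f w‖ₑ with hg
  have hgm : Measurable g := hf'.measurable.enorm
  have hin : ∀ σ ∈ Ioc (0 : ℝ) 1, ∫⁻ z in K, g (x + σ ^ 2 • (z - x)) ≤
      ENNReal.ofReal (M * s ^ 5 * σ⁻¹) := by
    intro σ hσ
    have hσ0 := hσ.1
    have hσ2 : 0 < σ ^ 2 := by positivity
    set B := (fun z => x + σ ^ 2 • (z - x)) '' K with hB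
    have hBm : MeasurableSet B := measurableSet_homothety_image hK x hσ2
    have hBK : B ⊆ K := by
      rintro _ ⟨z, hz, rfl⟩
      exact hKc.add_smul_sub_mem hx hz ⟨hσ2.le, pow_le_one₀ hσ0.le hσ.2⟩
    have hBv : volume B = ENNReal.ofReal ((σ ^ 2 * s ^ 2) ^ 3) := by
      rw [hB, volume_homothety_image x hσ2, hvol, ← ENNReal.ofReal_mul (by positivity)]
      congr 1; ring
    have h1 := hgr (σ ^ 2 * s ^ 2) (by positivity) B hBK hBm hBv.le
    have h2 := lintegral_sq_le (volume.restrict B) (f := g) hgm.aemeasurable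
    have h3 : ∫⁻ z in B, g z ≤ ENNReal.ofReal (M * σ ^ 5 * s ^ 5) := by
      rw [← ENNReal.pow_le_pow_left_iff two_ne_zero]
      refine h2.trans ?_
      rw [Measure.restrict_apply_univ, hBv, ← ENNReal.ofReal_pow (by positivity)]
      calc _ ≤ ENNReal.ofReal ((σ ^ 2 * s ^ 2) ^ 3) *
            ENNReal.ofReal (M ^ 2 * (σ ^ 2 * s ^ 2) ^ 2) := by gcongr
        _ = _ := by
          rw [← ENNReal.ofReal_mul (by positivity)]
          congr 1; ring
    calc _ ≤ ENNReal.ofReal ((σ ^ 2) ^ 3)⁻¹ * ∫⁻ z in B, g z :=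
          setLIntegral_homothety_le g hK hBm x hσ2 fun z hz => ⟨z, hz, rfl⟩
      _ ≤ ENNReal.ofReal ((σ ^ 2) ^ 3)⁻¹ * ENNReal.ofReal (M * σ ^ 5 * s ^ 5) := by gcongr
      _ = _ := by
        rw [← ENNReal.ofReal_mul (by positivity)]
        congr 1; field_simp
  calc ∫⁻ z in K, ‖f z - f x‖ₑ ≤ ∫⁻ z in K, ENNReal.ofReal d *
        ∫⁻ σ in Ioc (0 : ℝ) 1, ENNReal.ofReal (2 * σ) * g (x + σ ^ 2 • (z - x)) := by
        refine setLIntegral_mono' hK fun z hz => ?_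
        refine (enorm_sub_le_lintegral_fderiv hf x z).trans ?_
        gcongr
        rw [← ofReal_norm]
        exact ENNReal.ofReal_le_ofReal (hd x hx z hz)
    _ = ENNReal.ofReal d * ∫⁻ σ in Ioc (0 : ℝ) 1, ENNReal.ofReal (2 * σ) *
        ∫⁻ z in K, g (x + σ ^ 2 • (z - x)) := by
        rw [lintegral_const_mul' _ _ (by simp), lintegral_lintegral_swap]
        · congr 1
          refine lintegral_congr fun s => ?_
          rw [lintegral_const_mul' _ _ ENNReal.ofReal_ne_top]
        · exact Measurable.aemeasurable (by fun_prop)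
    _ ≤ ENNReal.ofReal d * ∫⁻ σ in Ioc (0 : ℝ) 1, ENNReal.ofReal (2 * M * s ^ 5) := by
        refine mul_le_mul_right ?_ _
        refine setLIntegral_mono' measurableSet_Ioc fun σ hσ => ?_
        have hσ0 := hσ.1
        calc _ ≤ ENNReal.ofReal (2 * σ) * ENNReal.ofReal (M * s ^ 5 * σ⁻¹) := by
              gcongr
              exact hin σ hσ
          _ = _ := by
            rw [← ENNReal.ofReal_mul (by positivity)]
            congr 1; field_simp
    _ = _ := by
        rw [setLIntegral_const, Real.volume_Ioc, sub_zero, ENNReal.ofReal_one, mul_one,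
          ← ENNReal.ofReal_mul hd0]
        congr 1; ring

/-- Both values are compared with `f z` and the result is averaged over `z ∈ K`. On a ball of radius
`r` the quantities `d` and `s` are of order `r` and `√r`, so this is Hölder continuity with exponent
`1 / 2`. -/
theorem abs_sub_le_of_growth {f : E3 → ℝ} (hf : ContDiff ℝ 1 f) {K : Set E3}
    (hK : MeasurableSet K) (hKc : Convex ℝ K) {s d M : ℝ} (hs : 0 < s) (hM : 0 ≤ M)
    (hd : ∀ y ∈ K, ∀ z ∈ K, ‖z - y‖ ≤ d) (hvol : volume K = ENNReal.ofReal (s ^ 6))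
    (hgr : ∀ θ > 0, ∀ B ⊆ K, MeasurableSet B → volume B ≤ ENNReal.ofReal (θ ^ 3) →
      ∫⁻ z in B, ‖fderiv ℝ f z‖ₑ ^ 2 ≤ ENNReal.ofReal (M ^ 2 * θ ^ 2)) {x y : E3} (hx : x ∈ K)
    (hy : y ∈ K) : |f x - f y| ≤ 4 * d * M / s := by
  have hd0 : 0 ≤ d := (norm_nonneg _).trans (hd x hx x hx)
  have h1 := lintegral_sub_le_of_growth hf hK hKc hs hM hd hvol hgr hx
  have h2 := lintegral_sub_le_of_growth hf hK hKc hs hM hd hvol hgr hy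
  have h3 : ∫⁻ _ in K, ‖f x - f y‖ₑ ≤ ENNReal.ofReal (4 * d * M * s ^ 5) := by
    calc _ ≤ ∫⁻ z in K, (‖f z - f x‖ₑ + ‖f z - f y‖ₑ) := by
          refine lintegral_mono fun z => ?_
          have : f x - f y = -(f z - f x) + (f z - f y) := by ring
          rw [this]
          exact (enorm_add_le _ _).trans (by rw [enorm_neg])
      _ = (∫⁻ z in K, ‖f z - f x‖ₑ) + ∫⁻ z in K, ‖f z - f y‖ₑ := by
          refine lintegral_add_left ?_ _
          have := hf.continuous
          fun_prop
      _ ≤ ENNReal.ofReal (2 * d * M * s ^ 5) + ENNReal.ofReal (2 * d * M * s ^ 5) := by gcongr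
      _ = _ := by
          rw [← ENNReal.ofReal_add (by positivity) (by positivity)]
          congr 1; ring
  rw [setLIntegral_const, hvol, Real.enorm_eq_ofReal_abs,
    ← ENNReal.ofReal_mul (abs_nonneg _), ENNReal.ofReal_le_ofReal_iff (by positivity)] at h3
  rw [le_div_iff₀ hs]
  have h5 : 0 < s ^ 5 := by positivity
  refine le_of_mul_le_mul_right ?_ h5
  calc _ = |f x - f y| * s ^ 6 := by ring
    _ ≤ _ := h3

end MassLump

namespace MassLump

open scoped ENNReal

/-! ### Classical and weak derivatives -/

theorem contDiff_partialDeriv {f : E3 → ℝ} (hf : ContDiff ℝ ∞ f) (i : Fin 3) :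
    ContDiff ℝ ∞ (partialDeriv i f) :=
  (hf.fderiv_right (m := ∞) (by simp)).clm_apply contDiff_const

theorem contDiff_iterate_partialDeriv {f : E3 → ℝ} (hf : ContDiff ℝ ∞ f) (i : Fin 3) (n : ℕ) :
    ContDiff ℝ ∞ ((partialDeriv i)^[n] f) := by
  induction n with
  | zero => exact hf
  | succ n ih =>
    rw [Function.iterate_succ_apply']
    exact contDiff_partialDeriv ih i

theorem partialDeriv_comm {f : E3 → ℝ} (hf : ContDiff ℝ ∞ f) (i j : Fin 3) :
    partialDeriv i (partialDeriv j f) = partialDeriv j (partialDeriv i f) := by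
  funext x
  have hd : DifferentiableAt ℝ (fderiv ℝ f) x :=
    (hf.fderiv_right (m := 1) (by norm_cast)).differentiable one_ne_zero x
  have key : ∀ i j : Fin 3, partialDeriv i (partialDeriv j f) x =
      fderiv ℝ (fderiv ℝ f) x (EuclideanSpace.single i 1) (EuclideanSpace.single j 1) := by
    intro i j
    unfold partialDeriv
    rw [fderiv_clm_apply hd (differentiableAt_const _)]
    simp
  rw [key, key]
  have hs : IsSymmSndFDerivAt ℝ f x :=
    (hf.contDiffAt).isSymmSndFDerivAt (by simp; exact WithTop.coe_le_coe.2 (le_top : (2 : ℕ∞) ≤ ⊤))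
  exact hs _ _

theorem partialDeriv_iterate_comm {f : E3 → ℝ} (hf : ContDiff ℝ ∞ f) (i j : Fin 3) (n : ℕ) :
    partialDeriv i ((partialDeriv j)^[n] f) = (partialDeriv j)^[n] (partialDeriv i f) := by
  induction n with
  | zero => rfl
  | succ n ih =>
    rw [Function.iterate_succ_apply', Function.iterate_succ_apply',
      partialDeriv_comm (contDiff_iterate_partialDeriv hf j n), ih]

theorem multiDeriv_zero (f : E3 → ℝ) : multiDeriv 0 f = f := rfl

theorem multiDeriv_add_single {f : E3 → ℝ} (hf : ContDiff ℝ ∞ f) (α : Fin 3 → ℕ) (i : Fin 3) :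
    multiDeriv (α + Pi.single i 1) f = multiDeriv α (partialDeriv i f) := by
  have h2 := contDiff_iterate_partialDeriv hf 2 (α 2)
  have h1 := contDiff_iterate_partialDeriv h2 1 (α 1)
  unfold multiDeriv
  fin_cases i
  · simp [-Function.iterate_succ, Function.iterate_succ_apply]
    rw [partialDeriv_iterate_comm h2, partialDeriv_iterate_comm hf]
  · simp [-Function.iterate_succ, Function.iterate_succ_apply]
    rw [partialDeriv_iterate_comm hf]
  · simp [-Function.iterate_succ, Function.iterate_succ_apply]

theorem multiDeriv_single {f : E3 → ℝ} (hf : ContDiff ℝ ∞ f) (i : Fin 3) :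
    multiDeriv (Pi.single i 1) f = partialDeriv i f := by
  have := multiDeriv_add_single hf 0 i
  rwa [zero_add, multiDeriv_zero] at this

theorem IsTestFun.partialDeriv {Ω : Set E3} {φ : E3 → ℝ} (h : IsTestFun Ω φ) (i : Fin 3) :
    IsTestFun Ω (partialDeriv i φ) := by
  refine ⟨contDiff_partialDeriv h.1 i, ?_, ?_⟩
  · exact h.2.1.fderiv_apply (𝕜 := ℝ) _
  · exact (tsupport_fderiv_apply_subset ℝ _).trans h.2.2

theorem IsTestFun.iterate_partialDeriv {Ω : Set E3} {φ : E3 → ℝ} (h : IsTestFun Ω φ) (i : Fin 3)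
    (n : ℕ) : IsTestFun Ω ((MassLump.partialDeriv i)^[n] φ) := by
  induction n with
  | zero => exact h
  | succ n ih =>
    rw [Function.iterate_succ_apply']
    exact ih.partialDeriv i

theorem IsTestFun.multiDeriv {Ω : Set E3} {φ : E3 → ℝ} (h : IsTestFun Ω φ) (α : Fin 3 → ℕ) :
    IsTestFun Ω (multiDeriv α φ) :=
  ((h.iterate_partialDeriv 2 _).iterate_partialDeriv 1 _).iterate_partialDeriv 0 _

theorem IsTestFun.mono {U Ω : Set E3} (hU : U ⊆ Ω) {φ : E3 → ℝ} (h : IsTestFun U φ) :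
    IsTestFun Ω φ := ⟨h.1, h.2.1, h.2.2.trans hU⟩

theorem IsTestFun.memLp {Ω : Set E3} {φ : E3 → ℝ} (h : IsTestFun Ω φ) (μ : Measure E3)
    [IsFiniteMeasureOnCompacts μ] : MemLp φ 2 μ :=
  h.1.continuous.memLp_of_hasCompactSupport h.2.1

theorem IsTestFun.eq_zero {Ω : Set E3} {φ : E3 → ℝ} (h : IsTestFun Ω φ) {x : E3} (hx : x ∉ Ω) :
    φ x = 0 := image_eq_zero_of_notMem_tsupport fun h' => hx (h.2.2 h')

theorem integrable_mul_of_memLp {μ : Measure E3} {f g : E3 → ℝ} (hf : MemLp f 2 μ)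
    (hg : MemLp g 2 μ) : Integrable (fun x => f x * g x) μ := hf.integrable_mul hg

theorem IsTestFun.integrable_mul {Ω : Set E3} {φ : E3 → ℝ} (h : IsTestFun Ω φ) {U : Set E3}
    {u : E3 → ℝ} (hu : MemLp u 2 (volume.restrict U)) :
    Integrable (fun x => u x * φ x) (volume.restrict U) :=
  integrable_mul_of_memLp hu (h.memLp _)

theorem setIntegral_testFun_eq {U Ω : Set E3} (hΩ : MeasurableSet Ω)
    (hUΩ : U ⊆ Ω) {φ : E3 → ℝ} (h : IsTestFun U φ) (u : E3 → ℝ) :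
    ∫ x in Ω, u x * φ x = ∫ x in U, u x * φ x := by
  refine (setIntegral_eq_of_subset_of_forall_sdiff_eq_zero hΩ hUΩ fun x hx => ?_)
  rw [h.eq_zero hx.2, mul_zero]

theorem IsWeakDeriv.mono {U Ω : Set E3} (hΩ : MeasurableSet Ω)
    (hUΩ : U ⊆ Ω) {α : Fin 3 → ℕ} {u g : E3 → ℝ} (h : IsWeakDeriv Ω α u g) :
    IsWeakDeriv U α u g := by
  refine ⟨h.1.mono_measure (Measure.restrict_mono hUΩ le_rfl), fun φ hφ => ?_⟩
  have := h.2 φ (hφ.mono hUΩ)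
  rwa [setIntegral_testFun_eq hΩ hUΩ (hφ.multiDeriv α),
    setIntegral_testFun_eq hΩ hUΩ hφ] at this

theorem IsWeakDeriv.congr {U : Set E3} {α : Fin 3 → ℕ} {u u' g g' : E3 → ℝ}
    (h : IsWeakDeriv U α u g) (hu : u =ᵐ[volume.restrict U] u')
    (hg : g =ᵐ[volume.restrict U] g') : IsWeakDeriv U α u' g' := by
  refine ⟨(memLp_congr_ae hg).1 h.1, fun φ hφ => ?_⟩
  have h1 : ∫ x in U, u' x * multiDeriv α φ x = ∫ x in U, u x * multiDeriv α φ x :=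
    integral_congr_ae (hu.mono fun x hx => by simp only [hx])
  have h2 : ∫ x in U, g' x * φ x = ∫ x in U, g x * φ x :=
    integral_congr_ae (hg.mono fun x hx => by simp only [hx])
  rw [h1, h2, h.2 φ hφ]

theorem IsWeakDeriv.unique {U : Set E3} (hU : IsOpen U) {α : Fin 3 → ℕ} {u g g' : E3 → ℝ}
    (h : IsWeakDeriv U α u g) (h' : IsWeakDeriv U α u g') : g =ᵐ[volume.restrict U] g' := by
  have hm : MemLp (g - g') 2 (volume.restrict U) := h.1.sub h'.1
  have hl : LocallyIntegrableOn (g - g') U volume := by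
    rw [locallyIntegrableOn_iff hU.isLocallyClosed]
    intro k hk hkc
    have : MemLp (g - g') 2 (volume.restrict k) := hm.mono_measure (Measure.restrict_mono hk le_rfl)
    have hfin : IsFiniteMeasure (volume.restrict k) := ⟨by simpa using hkc.measure_lt_top⟩
    exact this.integrable one_le_two
  have key := hU.ae_eq_zero_of_integral_contDiff_smul_eq_zero hl (fun φ h1 h2 h3 => by
    have hφ : IsTestFun U φ := ⟨h1, h2, h3⟩
    have e1 := h.2 φ hφ
    have e2 := h'.2 φ hφ
    rw [e1] at e2
    have e3 : ∫ x in U, g x * φ x = ∫ x in U, g' x * φ x :=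
      mul_left_cancel₀ (pow_ne_zero _ (by norm_num)) e2
    have e4 : ∫ x, φ x • (g - g') x = ∫ x in U, (g x * φ x - g' x * φ x) := by
      rw [← setIntegral_eq_integral_of_forall_compl_eq_zero (s := U)]
      · refine integral_congr_ae (Filter.Eventually.of_forall fun x => ?_)
        simp only [Pi.sub_apply, smul_eq_mul]; ring
      · intro x hx
        rw [hφ.eq_zero hx, zero_smul]
    rw [e4, integral_sub (hφ.integrable_mul h.1) (hφ.integrable_mul h'.1), e3, sub_self])
  filter_upwards [ae_restrict_of_ae key, ae_restrict_mem hU.measurableSet] with x hx hxU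
  exact sub_eq_zero.1 (hx hxU)

theorem IsWeakDeriv.add {U : Set E3} {α : Fin 3 → ℕ} {u v g k : E3 → ℝ}
    (hu : MemLp u 2 (volume.restrict U)) (hv : MemLp v 2 (volume.restrict U))
    (h : IsWeakDeriv U α u g) (h' : IsWeakDeriv U α v k) : IsWeakDeriv U α (u + v) (g + k) := by
  refine ⟨h.1.add h'.1, fun φ hφ => ?_⟩
  simp only [Pi.add_apply, add_mul]
  rw [integral_add ((hφ.multiDeriv α).integrable_mul hu) ((hφ.multiDeriv α).integrable_mul hv),
    integral_add (hφ.integrable_mul h.1) (hφ.integrable_mul h'.1), h.2 φ hφ, h'.2 φ hφ, mul_add]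

theorem IsWeakDeriv.neg {U : Set E3} {α : Fin 3 → ℕ} {u g : E3 → ℝ}
    (h : IsWeakDeriv U α u g) : IsWeakDeriv U α (-u) (-g) := by
  refine ⟨h.1.neg, fun φ hφ => ?_⟩
  simp only [Pi.neg_apply, neg_mul]
  rw [integral_neg, integral_neg, h.2 φ hφ, mul_neg]

theorem IsWeakDeriv.sub {U : Set E3} {α : Fin 3 → ℕ} {u v g k : E3 → ℝ}
    (hu : MemLp u 2 (volume.restrict U)) (hv : MemLp v 2 (volume.restrict U))
    (h : IsWeakDeriv U α u g) (h' : IsWeakDeriv U α v k) : IsWeakDeriv U α (u - v) (g - k) := by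
  rw [sub_eq_add_neg, sub_eq_add_neg]
  exact IsWeakDeriv.add hu hv.neg h h'.neg

/-- The derivative `∂ᵢφ` is again a test function, so it may be inserted in the identity that
defines `g`. Thus weak derivatives of higher order form a chain of first-order ones. -/
theorem IsWeakDeriv.of_add_single {U : Set E3} {α : Fin 3 → ℕ} {i : Fin 3} {u g k : E3 → ℝ}
    (h : IsWeakDeriv U α u g) (h' : IsWeakDeriv U (α + Pi.single i 1) u k) :
    IsWeakDeriv U (Pi.single i 1) g k := by
  refine ⟨h'.1, fun φ hφ => ?_⟩
  have h1 := h.2 _ (hφ.partialDeriv i)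
  have h2 := h'.2 φ hφ
  rw [multiDeriv_add_single hφ.1] at h2
  rw [multiDeriv_single hφ.1]
  have e : ∑ j, (α + Pi.single i 1 : Fin 3 → ℕ) j = ∑ j, α j + 1 := by
    simp [Finset.sum_add_distrib]
  have e1 : ∑ j, (Pi.single i 1 : Fin 3 → ℕ) j = 1 := by simp
  rw [h1, e, pow_succ, mul_assoc] at h2
  rw [e1, pow_one]
  exact mul_left_cancel₀ (pow_ne_zero _ (by norm_num)) h2

theorem isWeakDeriv_single_iff {U : Set E3} {i : Fin 3} {u g : E3 → ℝ} :
    IsWeakDeriv U (Pi.single i 1) u g ↔ MemLp g 2 (volume.restrict U) ∧ ∀ φ, IsTestFun U φ →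
      ∫ x in U, u x * partialDeriv i φ x = - ∫ x in U, g x * φ x := by
  unfold IsWeakDeriv
  have e1 : ∑ j, (Pi.single i 1 : Fin 3 → ℕ) j = 1 := by simp
  refine and_congr_right fun _ => forall₂_congr fun φ hφ => ?_
  rw [multiDeriv_single hφ.1, e1]
  simp

theorem isWeakDeriv_zero {U : Set E3} {u : E3 → ℝ} (hu : MemLp u 2 (volume.restrict U)) :
    IsWeakDeriv U 0 u u := ⟨hu, fun φ _ => by simp [multiDeriv_zero]⟩

theorem _root_.Continuous.memLp_restrict_of_isBounded {U : Set E3} (hU : Bornology.IsBounded U)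
    {f : E3 → ℝ} (hf : Continuous f) : MemLp f 2 (volume.restrict U) := by
  have hc := hU.isCompact_closure
  have hfin : IsFiniteMeasure (volume.restrict (closure U)) := ⟨by simpa using hc.measure_lt_top⟩
  obtain ⟨C, hC⟩ := hc.exists_bound_of_continuousOn hf.continuousOn
  have h1 : MemLp f 2 (volume.restrict (closure U)) :=
    MemLp.of_bound hf.aestronglyMeasurable C
      ((ae_restrict_iff' isClosed_closure.measurableSet).2 (Filter.Eventually.of_forall hC))
  exact h1.mono_measure (Measure.restrict_mono subset_closure le_rfl)

theorem isWeakDeriv_of_contDiff {U : Set E3} (hU : Bornology.IsBounded U)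
    {f : E3 → ℝ} (hf : ContDiff ℝ ∞ f) (i : Fin 3) :
    IsWeakDeriv U (Pi.single i 1) f (partialDeriv i f) := by
  rw [isWeakDeriv_single_iff]
  refine ⟨(contDiff_partialDeriv hf i).continuous.memLp_restrict_of_isBounded hU,
    fun φ hφ => ?_⟩
  have hi : ∀ k ψ : E3 → ℝ, Continuous k → IsTestFun U ψ → Integrable (fun x => k x * ψ x) :=
    fun k ψ hk hψ => (hk.mul hψ.1.continuous).integrable_of_hasCompactSupport hψ.2.1.mul_left
  have h := integral_mul_fderiv_eq_neg_fderiv_mul_of_integrable (μ := (volume : Measure E3))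
    (f := f) (g := φ) (v := EuclideanSpace.single i 1)
    (hi _ _ (contDiff_partialDeriv hf i).continuous hφ)
    (hi _ _ hf.continuous (hφ.partialDeriv i)) (hi _ _ hf.continuous hφ)
    (fun x _ => hf.differentiable (by simp) x) (fun x _ => hφ.1.differentiable (by simp) x)
  rw [← setIntegral_testFun_eq MeasurableSet.univ (subset_univ U) (hφ.partialDeriv i),
    ← setIntegral_testFun_eq MeasurableSet.univ (subset_univ U) hφ, Measure.restrict_univ]
  exact h

theorem isWeakDeriv_weakDeriv {Ω : Set E3} {α : Fin 3 → ℕ} {u : E3 → ℝ}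
    (h : ∃ g, IsWeakDeriv Ω α u g) : IsWeakDeriv Ω α u (weakDeriv Ω α u) := by
  unfold weakDeriv
  rw [dif_pos h]
  exact h.choose_spec

theorem MemH.isWeakDeriv {Ω : Set E3} {k : ℕ} {u : E3 → ℝ} (h : MemH Ω k u) {α : Fin 3 → ℕ}
    (hα : ∑ i, α i ≤ k) : IsWeakDeriv Ω α u (weakDeriv Ω α u) :=
  isWeakDeriv_weakDeriv (h.2 α hα)

theorem MemH.isWeakDeriv_single {Ω : Set E3} {k : ℕ} {u : E3 → ℝ} (h : MemH Ω k u) (hk : 1 ≤ k)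
    (i : Fin 3) : IsWeakDeriv Ω (Pi.single i 1) u (weakDeriv Ω (Pi.single i 1) u) :=
  h.isWeakDeriv (by simpa using hk)

/-! ### Mollification -/

/-- A standard bump function supported in the ball of radius `1 / (n + 1)`. -/
noncomputable def mollBump (n : ℕ) : ContDiffBump (0 : E3) where
  rIn := 1 / (2 * (n + 1))
  rOut := 1 / (n + 1)
  rIn_pos := by positivity
  rIn_lt_rOut := by
    have : (0 : ℝ) < n + 1 := by positivity
    rw [div_lt_div_iff_of_pos_left one_pos (by positivity) this]
    linarith

/-- The mollifying kernel. -/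
noncomputable def mollKer (n : ℕ) : E3 → ℝ := (mollBump n).normed volume

/-- The mollification of a function. -/
noncomputable def moll (n : ℕ) (g : E3 → ℝ) : E3 → ℝ := fun x => ∫ y, mollKer n (x - y) * g y

theorem mollKer_nonneg (n : ℕ) (x : E3) : 0 ≤ mollKer n x := (mollBump n).nonneg_normed x

theorem contDiff_mollKer (n : ℕ) : ContDiff ℝ ∞ (mollKer n) := (mollBump n).contDiff_normed

theorem hasCompactSupport_mollKer (n : ℕ) : HasCompactSupport (mollKer n) :=
  (mollBump n).hasCompactSupport_normed

theorem tsupport_mollKer (n : ℕ) : tsupport (mollKer n) = Metric.closedBall 0 (1 / (n + 1)) :=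
  (mollBump n).tsupport_normed_eq

theorem integral_mollKer (n : ℕ) : ∫ x, mollKer n x = 1 := (mollBump n).integral_normed

theorem lintegral_mollKer (n : ℕ) : ∫⁻ x, ENNReal.ofReal (mollKer n x) = 1 := by
  rw [← ofReal_integral_eq_lintegral_ofReal, integral_mollKer, ENNReal.ofReal_one]
  · exact (mollBump n).integrable_normed
  · exact Filter.Eventually.of_forall (mollKer_nonneg n)

theorem moll_eq_convolution (n : ℕ) (g : E3 → ℝ) :
    moll n g = convolution (mollKer n) g (ContinuousLinearMap.lsmul ℝ ℝ) volume := by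
  funext x
  rw [convolution_eq_swap]
  rfl

theorem moll_eq (n : ℕ) (g : E3 → ℝ) (x : E3) : moll n g x = ∫ t, mollKer n t * g (x - t) := by
  rw [moll_eq_convolution]; rfl

theorem contDiff_moll (n : ℕ) {g : E3 → ℝ} (hg : LocallyIntegrable g) :
    ContDiff ℝ ∞ (moll n g) := by
  rw [moll_eq_convolution]
  exact (hasCompactSupport_mollKer n).contDiff_convolution_left _ (contDiff_mollKer n) hg

theorem ae_tendsto_moll {g : E3 → ℝ} (hg : LocallyIntegrable g) :
    ∀ᵐ x, Filter.Tendsto (fun n => moll n g x) Filter.atTop (nhds (g x)) := by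
  have h := ContDiffBump.ae_convolution_tendsto_right_of_locallyIntegrable
    (μ := (volume : Measure E3)) (φ := mollBump) (l := Filter.atTop) (K := 2) (g := g)
    (tendsto_one_div_add_atTop_nhds_zero_nat (𝕜 := ℝ))
    (Filter.Eventually.of_forall fun n => by
      simp only [mollBump]
      apply le_of_eq
      field_simp) hg
  filter_upwards [h] with x hx
  refine hx.congr fun n => ?_
  rw [moll_eq_convolution]; rfl

theorem locallyIntegrable_indicator {U : Set E3} (hU : MeasurableSet U) {g : E3 → ℝ}
    (hg : MemLp g 2 (volume.restrict U)) : LocallyIntegrable (U.indicator g) :=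
  ((memLp_indicator_iff_restrict hU).2 hg).locallyIntegrable one_le_two

theorem partialDeriv_moll (n : ℕ) {g : E3 → ℝ} (hg : LocallyIntegrable g) (i : Fin 3) (x : E3) :
    partialDeriv i (moll n g) x = ∫ y, partialDeriv i (mollKer n) (x - y) * g y := by
  have h := (hasCompactSupport_mollKer n).hasFDerivAt_convolution_left
    (ContinuousLinearMap.lsmul ℝ ℝ) (μ := volume)
    ((contDiff_mollKer n).of_le (by simp)) hg x
  unfold partialDeriv
  rw [moll_eq_convolution, h.fderiv, convolution_eq_swap,
    ContinuousLinearMap.integral_apply]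
  · rfl
  · have hc : HasCompactSupport (fderiv ℝ (mollKer n)) :=
      (hasCompactSupport_mollKer n).fderiv (𝕜 := ℝ)
    have := hc.convolutionExists_left
      (ContinuousLinearMap.precompL E3 (ContinuousLinearMap.lsmul ℝ ℝ)) (μ := volume)
      ((contDiff_mollKer n).continuous_fderiv (by simp)) hg x
    exact this.integrable_swap

theorem partialDeriv_comp_sub (f : E3 → ℝ) (hf : Differentiable ℝ f) (i : Fin 3) (x y : E3) :
    partialDeriv i (fun y => f (x - y)) y = - partialDeriv i f (x - y) := by
  unfold partialDeriv
  have h : HasFDerivAt (fun y => f (x - y))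
      ((fderiv ℝ f (x - y)).comp (-ContinuousLinearMap.id ℝ E3)) y :=
    ((hf (x - y)).hasFDerivAt).comp y ((hasFDerivAt_id y).const_sub x)
  rw [h.fderiv]
  simp

theorem isTestFun_mollKer_sub {U : Set E3} {n : ℕ} {x : E3}
    (hx : Metric.closedBall x (1 / (n + 1)) ⊆ U) : IsTestFun U fun y => mollKer n (x - y) := by
  have hsub : tsupport (fun y => mollKer n (x - y)) ⊆ Metric.closedBall x (1 / (n + 1)) := by
    refine closure_minimal (fun y hy => ?_) Metric.isClosed_closedBall
    have h1 : x - y ∈ tsupport (mollKer n) := subset_tsupport _ hy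
    rw [tsupport_mollKer, mem_closedBall_zero_iff] at h1
    rwa [mem_closedBall_iff_norm']
  refine ⟨(contDiff_mollKer n).comp (by fun_prop), ?_, hsub.trans hx⟩
  exact (isCompact_closedBall x _).of_isClosed_subset (isClosed_tsupport _) hsub

end MassLump

namespace MassLump

open scoped ENNReal
open Filter Topology

theorem integral_mul_indicator {U : Set E3} (hU : MeasurableSet U) (k g : E3 → ℝ) :
    ∫ y, k y * U.indicator g y = ∫ y in U, g y * k y := by
  rw [← integral_indicator hU]
  refine integral_congr_ae (Eventually.of_forall fun y => ?_)
  by_cases hy : y ∈ U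
  · simp [hy, mul_comm]
  · simp [hy]

/-- The kernel centred at `x` is a test function in `U`, so the jump of the extension by zero is not
seen. -/
theorem partialDeriv_moll_indicator {U : Set E3} (hU : IsOpen U) {u G : E3 → ℝ} {i : Fin 3}
    (hu : MemLp u 2 (volume.restrict U)) (h : IsWeakDeriv U (Pi.single i 1) u G) {n : ℕ} {x : E3}
    (hx : Metric.closedBall x (1 / (n + 1)) ⊆ U) :
    partialDeriv i (moll n (U.indicator u)) x = moll n (U.indicator G) x := by
  rw [partialDeriv_moll n (locallyIntegrable_indicator hU.measurableSet hu), moll,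
    integral_mul_indicator hU.measurableSet, integral_mul_indicator hU.measurableSet]
  have h1 := (isWeakDeriv_single_iff.1 h).2 _ (isTestFun_mollKer_sub hx)
  have h2 : ∀ y, partialDeriv i (fun y => mollKer n (x - y)) y =
      - partialDeriv i (mollKer n) (x - y) :=
    fun y => partialDeriv_comp_sub _ ((contDiff_mollKer n).differentiable (by simp)) i x y
  simp only [h2, mul_neg, integral_neg, neg_inj] at h1
  exact h1

/-- Jensen's inequality for the probability density `mollKer n`, in the form of Cauchy–Schwarz with
the density split into square roots. -/
theorem enorm_moll_sq_le (n : ℕ) {G : E3 → ℝ} (hG : Measurable G) (x : E3) :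
    ‖moll n G x‖ₑ ^ 2 ≤ ∫⁻ t, ENNReal.ofReal (mollKer n t) * ‖G (x - t)‖ₑ ^ 2 := by
  have hk : Measurable (mollKer n) := (contDiff_mollKer n).continuous.measurable
  have h1 : ‖moll n G x‖ₑ ≤ ∫⁻ t, ENNReal.ofReal (√(mollKer n t)) *
      (ENNReal.ofReal (√(mollKer n t)) * ‖G (x - t)‖ₑ) := by
    rw [moll_eq]
    refine (enorm_integral_le_lintegral_enorm _).trans (le_of_eq (lintegral_congr fun t => ?_))
    rw [enorm_mul, Real.enorm_of_nonneg (mollKer_nonneg n t), ← mul_assoc,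
      ← ENNReal.ofReal_mul (Real.sqrt_nonneg _), Real.mul_self_sqrt (mollKer_nonneg n t)]
  have h2 := lintegral_mul_sq_le (volume : Measure E3)
    (f := fun t => ENNReal.ofReal (√(mollKer n t)))
    (g := fun t => ENNReal.ofReal (√(mollKer n t)) * ‖G (x - t)‖ₑ) (by fun_prop) (by fun_prop)
  have h3 : ∀ t, ENNReal.ofReal (√(mollKer n t)) ^ 2 = ENNReal.ofReal (mollKer n t) := by
    intro t
    rw [← ENNReal.ofReal_pow (Real.sqrt_nonneg _), Real.sq_sqrt (mollKer_nonneg n t)]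
  simp only [mul_pow, h3, lintegral_mollKer, one_mul] at h2
  exact (pow_le_pow_left₀ zero_le h1 2).trans h2

/-- Mollification averages over translates, so an energy bound that is uniform in the translation
survives it. -/
theorem sum_setLIntegral_moll_le_of_measurable (n : ℕ) {G : Fin 3 → E3 → ℝ}
    (hG : ∀ i, Measurable (G i)) (B : Set E3) {c : ℝ≥0∞}
    (h : ∀ t, ∑ i, ∫⁻ x in B, ‖G i (x - t)‖ₑ ^ 2 ≤ c) :
    ∑ i, ∫⁻ x in B, ‖moll n (G i) x‖ₑ ^ 2 ≤ c := by
  have hk : Measurable (mollKer n) := (contDiff_mollKer n).continuous.measurable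
  calc ∑ i, ∫⁻ x in B, ‖moll n (G i) x‖ₑ ^ 2
      ≤ ∑ i, ∫⁻ x in B, ∫⁻ t, ENNReal.ofReal (mollKer n t) * ‖G i (x - t)‖ₑ ^ 2 :=
        Finset.sum_le_sum fun i _ => lintegral_mono fun x => enorm_moll_sq_le n (hG i) x
    _ = ∑ i, ∫⁻ t, ENNReal.ofReal (mollKer n t) * ∫⁻ x in B, ‖G i (x - t)‖ₑ ^ 2 := by
        refine Finset.sum_congr rfl fun i _ => ?_
        have := hG i
        rw [lintegral_lintegral_swap (Measurable.aemeasurable (by fun_prop))]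
        refine lintegral_congr fun t => ?_
        rw [lintegral_const_mul' _ _ ENNReal.ofReal_ne_top]
    _ = ∫⁻ t, ENNReal.ofReal (mollKer n t) * ∑ i, ∫⁻ x in B, ‖G i (x - t)‖ₑ ^ 2 := by
        simp_rw [Finset.mul_sum]
        rw [lintegral_finsetSum]
        intro i _
        have := hG i
        refine Measurable.mul (by fun_prop) ?_
        exact Measurable.lintegral_prod_right' (ν := volume.restrict B)
          (f := fun q : E3 × E3 => ‖G i (q.2 - q.1)‖ₑ ^ 2) (by fun_prop)
    _ ≤ ∫⁻ t, ENNReal.ofReal (mollKer n t) * c := by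
        gcongr with t
        exact h t
    _ = c := by
        rw [lintegral_mul_const _ (by fun_prop), lintegral_mollKer, one_mul]

theorem sum_setLIntegral_moll_le (n : ℕ) {G : Fin 3 → E3 → ℝ}
    (hG : ∀ i, AEStronglyMeasurable (G i)) (B : Set E3) {c : ℝ≥0∞}
    (h : ∀ t, ∑ i, ∫⁻ x in B, ‖G i (x - t)‖ₑ ^ 2 ≤ c) :
    ∑ i, ∫⁻ x in B, ‖moll n (G i) x‖ₑ ^ 2 ≤ c := by
  have h1 : ∀ i, moll n (G i) = moll n ((hG i).mk (G i)) := by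
    intro i
    funext x
    refine integral_congr_ae ((hG i).ae_eq_mk.mono fun y hy => ?_)
    simp only [hy]
  simp_rw [h1]
  refine sum_setLIntegral_moll_le_of_measurable n
    (fun i => (hG i).stronglyMeasurable_mk.measurable) B fun t => le_of_eq_of_le ?_ (h t)
  refine Finset.sum_congr rfl fun i _ => lintegral_congr_ae (ae_restrict_of_ae ?_)
  have := (measurePreserving_sub_right (volume : Measure E3) t).quasiMeasurePreserving.ae
    (hG i).ae_eq_mk
  filter_upwards [this] with x hx
  rw [hx]

theorem enorm_fderiv_sq_le (f : E3 → ℝ) (x : E3) :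
    ‖fderiv ℝ f x‖ₑ ^ 2 ≤ ∑ i, ‖partialDeriv i f x‖ₑ ^ 2 := by
  have key : ‖fderiv ℝ f x‖ ≤ √(∑ i, partialDeriv i f x ^ 2) := by
    refine ContinuousLinearMap.opNorm_le_bound _ (Real.sqrt_nonneg _) fun v => ?_
    have hv : v = ∑ i, v i • EuclideanSpace.single i (1 : ℝ) := by
      ext j
      fin_cases j <;> simp [Fin.sum_univ_three]
    have h1 : fderiv ℝ f x v = ∑ i, partialDeriv i f x * v i := by
      conv_lhs => rw [hv]
      rw [map_sum]
      refine Finset.sum_congr rfl fun i _ => ?_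
      rw [map_smul, smul_eq_mul, mul_comm]; rfl
    rw [h1, EuclideanSpace.norm_eq, ← Real.sqrt_mul (Finset.sum_nonneg fun i _ => sq_nonneg _),
      Real.norm_eq_abs]
    refine Real.abs_le_sqrt ?_
    simp only [Real.norm_eq_abs, sq_abs]
    exact Finset.sum_mul_sq_le_sq_mul_sq _ _ _
  have h2 : ‖fderiv ℝ f x‖ ^ 2 ≤ ∑ i, partialDeriv i f x ^ 2 := by
    have := pow_le_pow_left₀ (norm_nonneg _) key 2
    rwa [Real.sq_sqrt (Finset.sum_nonneg fun i _ => sq_nonneg _)] at this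
  have h3 : ∀ i, ‖partialDeriv i f x‖ₑ ^ 2 = ENNReal.ofReal (partialDeriv i f x ^ 2) := by
    intro i
    rw [Real.enorm_eq_ofReal_abs, ← ENNReal.ofReal_pow (abs_nonneg _), sq_abs]
  simp_rw [h3]
  rw [← ENNReal.ofReal_sum_of_nonneg (fun i _ => sq_nonneg _), ← ofReal_norm,
    ← ENNReal.ofReal_pow (norm_nonneg _)]
  exact ENNReal.ofReal_le_ofReal h2

/-- `G` is the weak gradient of `u ∈ L²(U)`. -/
def IsWeakGrad (U : Set E3) (u : E3 → ℝ) (G : Fin 3 → E3 → ℝ) : Prop :=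
  MemLp u 2 (volume.restrict U) ∧ ∀ i, IsWeakDeriv U (Pi.single i 1) u (G i)

/-! ### Weak gradients: smooth approximation and inequalities on convex sets -/

theorem exists_closedBall_subset {U K : Set E3} (hU : IsOpen U) (hK : IsCompact K)
    (hKU : K ⊆ U) : ∀ᶠ n : ℕ in atTop, ∀ x ∈ K, Metric.closedBall x (1 / ((n : ℝ) + 1)) ⊆ U := by
  obtain ⟨δ, hδ, h⟩ := hK.exists_cthickening_subset_open hU hKU
  have := (tendsto_one_div_add_atTop_nhds_zero_nat (𝕜 := ℝ)).eventually_lt_const hδ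
  filter_upwards [this] with n hn x hx
  refine subset_trans ?_ h
  exact (Metric.closedBall_subset_closedBall hn.le).trans
    (Metric.closedBall_subset_cthickening hx δ)

theorem IsWeakGrad.eventually_fderiv_moll_le {U K : Set E3} (hU : IsOpen U) (hK : IsCompact K)
    (hKU : K ⊆ U) {u : E3 → ℝ} {G : Fin 3 → E3 → ℝ} (h : IsWeakGrad U u G) :
    ∀ᶠ n : ℕ in atTop, ∀ x ∈ K, ‖fderiv ℝ (moll n (U.indicator u)) x‖ₑ ^ 2 ≤
      ∑ i, ‖moll n (U.indicator (G i)) x‖ₑ ^ 2 := by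
  filter_upwards [exists_closedBall_subset hU hK hKU] with n hn x hx
  refine (enorm_fderiv_sq_le _ _).trans (le_of_eq ?_)
  refine Finset.sum_congr rfl fun i _ => ?_
  rw [partialDeriv_moll_indicator hU h.1 (h.2 i) (hn x hx)]

theorem setLIntegral_indicator_sub {U : Set E3} (hU : MeasurableSet U) (B : Set E3)
    (g : E3 → ℝ) (t : E3) :
    ∫⁻ x in B, ‖U.indicator g (x - t)‖ₑ ^ 2 =
      ∫⁻ x in (fun x => x + t) ⁻¹' B ∩ U, ‖g x‖ₑ ^ 2 := by
  have h1 := (measurePreserving_add_right (volume : Measure E3) t).setLIntegral_comp_emb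
    (measurableEmbedding_addRight t) (fun x => ‖U.indicator g (x - t)‖ₑ ^ 2)
    ((fun x => x + t) ⁻¹' B)
  have h2 : (fun x => x + t) '' ((fun x => x + t) ⁻¹' B) = B :=
    image_preimage_eq _ (add_right_surjective t)
  rw [h2] at h1
  rw [← h1]
  simp only [add_sub_cancel_right]
  rw [inter_comm, ← setLIntegral_indicator hU]
  refine lintegral_congr fun x => ?_
  by_cases hx : x ∈ U <;> simp [hx]

/-- Translation preserves volume, so any energy bound that depends only on the volume of `B` passes
to the mollified function. This form serves both the total energy and Morrey's growth condition. -/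
theorem IsWeakGrad.eventually_setLIntegral_fderiv_moll_le {U K : Set E3} (hU : IsOpen U)
    (hK : IsCompact K) (hKU : K ⊆ U) {u : E3 → ℝ} {G : Fin 3 → E3 → ℝ} (h : IsWeakGrad U u G) :
    ∀ᶠ n : ℕ in atTop, ∀ B ⊆ K, MeasurableSet B → ∀ c : ℝ≥0∞,
      (∀ t : E3, ∑ i, ∫⁻ x in (fun x => x + t) ⁻¹' B ∩ U, ‖G i x‖ₑ ^ 2 ≤ c) →
      ∫⁻ x in B, ‖fderiv ℝ (moll n (U.indicator u)) x‖ₑ ^ 2 ≤ c := by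
  filter_upwards [h.eventually_fderiv_moll_le hU hK hKU] with n hn B hB hBm c hc
  have hm : ∀ i, AEStronglyMeasurable (U.indicator (G i)) := fun i =>
    ((memLp_indicator_iff_restrict hU.measurableSet).2 (h.2 i).1).aestronglyMeasurable
  calc _ ≤ ∫⁻ x in B, ∑ i, ‖moll n (U.indicator (G i)) x‖ₑ ^ 2 :=
        setLIntegral_mono' hBm fun x hx => hn x (hB hx)
    _ = ∑ i, ∫⁻ x in B, ‖moll n (U.indicator (G i)) x‖ₑ ^ 2 := by
        rw [lintegral_finsetSum]
        intro i _
        have := (contDiff_moll n (locallyIntegrable_indicator hU.measurableSet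
          (h.2 i).1)).continuous.measurable
        fun_prop
    _ ≤ c := by
        refine sum_setLIntegral_moll_le n hm B fun t => ?_
        simp_rw [setLIntegral_indicator_sub hU.measurableSet]
        exact hc t

/-- Fatou's lemma for the mollifications, which converge almost everywhere. Compactness of `K`
leaves room for the mollifying kernel inside `U`. -/
theorem IsWeakGrad.lintegral_sub_sq_le_of_isCompact {U K A : Set E3} (hU : IsOpen U)
    (hK : IsCompact K) (hKU : K ⊆ U) (hKc : Convex ℝ K) (hA : MeasurableSet A) (hAK : A ⊆ K)
    {u : E3 → ℝ} {G : Fin 3 → E3 → ℝ} (h : IsWeakGrad U u G)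
    {b d : ℝ} (hb : 0 < b) (hd : ∀ y ∈ K, ∀ z ∈ K, ‖z - y‖ ≤ d)
    (hvol : volume A ≤ ENNReal.ofReal (b ^ 6) * volume K) :
    ∫⁻ y in A, ∫⁻ z in K, ‖u z - u y‖ₑ ^ 2 ≤
      ENNReal.ofReal (2 ^ 14 * d ^ 2 * b ^ 4) *
        (volume K * ∑ i, ∫⁻ z in U, ‖G i z‖ₑ ^ 2) := by
  have hKm := hK.measurableSet
  have hloc := locallyIntegrable_indicator hU.measurableSet h.1
  set f : ℕ → E3 → ℝ := fun n => moll n (U.indicator u) with hf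
  have hfc : ∀ n, ContDiff ℝ ∞ (f n) := fun n => contDiff_moll n hloc
  have hfm : ∀ n, Measurable (f n) := fun n => (hfc n).continuous.measurable
  have hae : ∀ᵐ x, x ∈ U → Tendsto (fun n => f n x) atTop (𝓝 (u x)) := by
    filter_upwards [ae_tendsto_moll hloc] with x hx hxU
    rwa [indicator_of_mem hxU] at hx
  have hAU := hAK.trans hKU
  calc ∫⁻ y in A, ∫⁻ z in K, ‖u z - u y‖ₑ ^ 2
      = ∫⁻ y in A, ∫⁻ z in K, liminf (fun n => ‖f n z - f n y‖ₑ ^ 2) atTop := by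
        refine lintegral_congr_ae ?_
        filter_upwards [ae_restrict_of_ae hae, ae_restrict_mem hA] with y hy hyA
        refine lintegral_congr_ae ?_
        filter_upwards [ae_restrict_of_ae hae, ae_restrict_mem hKm] with z hz hzK
        have h1 := ((hz (hKU hzK)).sub (hy (hAU hyA))).enorm
        exact ((ENNReal.continuous_pow 2).continuousAt.tendsto.comp h1).liminf_eq.symm
    _ ≤ ∫⁻ y in A, liminf (fun n => ∫⁻ z in K, ‖f n z - f n y‖ₑ ^ 2) atTop := by
        refine lintegral_mono fun y => lintegral_liminf_le fun n => ?_
        have := hfm n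
        fun_prop
    _ ≤ liminf (fun n => ∫⁻ y in A, ∫⁻ z in K, ‖f n z - f n y‖ₑ ^ 2) atTop := by
        refine lintegral_liminf_le fun n => ?_
        have := hfm n
        exact Measurable.lintegral_prod_right' (ν := volume.restrict K)
          (f := fun q : E3 × E3 => ‖f n q.2 - f n q.1‖ₑ ^ 2) (by fun_prop)
    _ ≤ _ := by
        refine liminf_le_of_le (by isBoundedDefault) fun b' hb' => ?_
        obtain ⟨n, hn1, hn2⟩ := (hb'.and
          (h.eventually_setLIntegral_fderiv_moll_le hU hK hKU)).exists
        refine hn1.trans ((lintegral_sub_sq_le_of_contDiff ((hfc n).of_le (by simp)) hKm hKc hA hAK hb hd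
          hvol).trans ?_)
        gcongr
        refine hn2 K Subset.rfl hKm _ fun t => Finset.sum_le_sum fun i _ => ?_
        exact lintegral_mono_set inter_subset_right

/-- The closed homothetic copy of `U` with centre `z₀` and ratio `t`. -/
def shrink (U : Set E3) (z₀ : E3) (t : ℝ) : Set E3 := (fun z => z₀ + t • (z - z₀)) '' closure U

theorem isCompact_shrink {U : Set E3} (hU : Bornology.IsBounded U) (z₀ : E3) (t : ℝ) :
    IsCompact (shrink U z₀ t) := hU.isCompact_closure.image (by fun_prop)

theorem convex_shrink {U : Set E3} (hU : Convex ℝ U) (z₀ : E3) (t : ℝ) :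
    Convex ℝ (shrink U z₀ t) := by
  have e : (fun z => z₀ + t • (z - z₀)) = AffineMap.homothety z₀ t := by
    funext z; simp [AffineMap.homothety_apply, add_comm]
  rw [shrink, e]
  exact hU.closure.affine_image _

theorem shrink_subset {U : Set E3} (hUo : IsOpen U) (hU : Convex ℝ U) {z₀ : E3} (hz : z₀ ∈ U)
    {t : ℝ} (ht0 : 0 < t) (ht1 : t < 1) : shrink U z₀ t ⊆ U := by
  rintro _ ⟨w, hw, rfl⟩
  have h := hU.add_smul_sub_mem_interior' hw (by rwa [hUo.interior_eq])
    (t := 1 - t) ⟨by linarith, by linarith⟩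
  rw [hUo.interior_eq] at h
  convert h using 1
  module

theorem volume_shrink {U : Set E3} (hU : Convex ℝ U) (z₀ : E3) {t : ℝ} (ht0 : 0 < t) :
    volume (shrink U z₀ t) = ENNReal.ofReal (t ^ 3) * volume U := by
  rw [shrink, volume_homothety_image z₀ ht0]
  rw [measure_closure_of_null_frontier (hU.addHaar_frontier volume)]

theorem eventually_mem_shrink {U : Set E3} (hUo : IsOpen U) (z₀ : E3) {x : E3} (hx : x ∈ U)
    {t : ℕ → ℝ} (ht : Tendsto t atTop (𝓝 1)) :
    ∀ᶠ n in atTop, x ∈ (fun z => z₀ + t n • (z - z₀)) '' U := by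
  have h1 : Tendsto (fun n => z₀ + (t n)⁻¹ • (x - z₀)) atTop (𝓝 (z₀ + (1 : ℝ)⁻¹ • (x - z₀))) :=
    ((ht.inv₀ one_ne_zero).smul_const _).const_add _
  rw [inv_one, one_smul, add_sub_cancel] at h1
  filter_upwards [h1.eventually (hUo.mem_nhds hx), ht.eventually_ne one_ne_zero] with n hn hn0
  refine ⟨_, hn, ?_⟩
  simp [smul_smul, mul_inv_cancel₀ hn0]

end MassLump

namespace MassLump

open scoped ENNReal
open Filter Topology

theorem image_homothety_subset_shrink (U : Set E3) (z₀ : E3) (t : ℝ) :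
    (fun z => z₀ + t • (z - z₀)) '' U ⊆ shrink U z₀ t := image_mono subset_closure

/-- A sequence of ratios in `[1/2, 1)` tending to `1`. -/
noncomputable def shrinkRatio (n : ℕ) : ℝ := 1 - 1 / ((n : ℝ) + 2)

theorem shrinkRatio_lt_one (n : ℕ) : shrinkRatio n < 1 := by
  have : 0 < 1 / ((n : ℝ) + 2) := by positivity
  simp only [shrinkRatio]; linarith

theorem half_le_shrinkRatio (n : ℕ) : 1 / 2 ≤ shrinkRatio n := by
  have : 1 / ((n : ℝ) + 2) ≤ 1 / 2 := by
    apply one_div_le_one_div_of_le <;> linarith [(Nat.cast_nonneg n : (0 : ℝ) ≤ n)]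
  simp only [shrinkRatio]; linarith

theorem tendsto_shrinkRatio_sq : Tendsto (fun n => shrinkRatio n ^ 2) atTop (𝓝 1) := by
  have h1 : Tendsto (fun n : ℕ => 1 / ((n : ℝ) + 2)) atTop (𝓝 0) := by
    have := tendsto_const_div_atTop_nhds_zero_nat (1 : ℝ)
    have h2 := (tendsto_add_atTop_iff_nat 2).2 this
    refine h2.congr fun n => by push_cast; rfl
  have h2 : Tendsto (fun n : ℕ => 1 - 1 / ((n : ℝ) + 2)) atTop (𝓝 (1 - 0)) := h1.const_sub 1
  have := h2.pow 2
  rwa [sub_zero, one_pow] at this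

/-- Fatou's lemma again, for an exhaustion of `U` by compact homothetic copies. The ratio is a
square `μ ^ 2` so that the sixth root of the volume scales by `μ`; since `μ ≥ 1 / 2`, replacing `b`
by `b / μ` costs the factor `16` between `2 ^ 14` and `2 ^ 18`. -/
theorem IsWeakGrad.lintegral_sub_sq_le {U A : Set E3} (hU : IsOpen U)
    (hUc : Convex ℝ U) (hUb : Bornology.IsBounded U) (hA : MeasurableSet A) (hAU : A ⊆ U)
    {u : E3 → ℝ} {G : Fin 3 → E3 → ℝ} (h : IsWeakGrad U u G)
    {b d : ℝ} (hb : 0 < b) (hd : ∀ y ∈ U, ∀ z ∈ U, ‖z - y‖ ≤ d)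
    (hvol : volume A ≤ ENNReal.ofReal (b ^ 6) * volume U) :
    ∫⁻ y in A, ∫⁻ z in U, ‖u z - u y‖ₑ ^ 2 ≤
      ENNReal.ofReal (2 ^ 18 * d ^ 2 * b ^ 4) *
        (volume U * ∑ i, ∫⁻ z in U, ‖G i z‖ₑ ^ 2) := by
  wlog hum : Measurable u generalizing u
  · set u' := h.1.aestronglyMeasurable.mk u with hu'
    have hae : u =ᵐ[volume.restrict U] u' := h.1.aestronglyMeasurable.ae_eq_mk
    have h' : IsWeakGrad U u' G :=
      ⟨(memLp_congr_ae hae).1 h.1, fun i => (h.2 i).congr hae (ae_eq_refl _)⟩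
    refine le_of_eq_of_le ?_
      (this h' h.1.aestronglyMeasurable.stronglyMeasurable_mk.measurable)
    refine lintegral_congr_ae ?_
    filter_upwards [ae_restrict_of_ae_restrict_of_subset hAU hae] with y hy
    refine lintegral_congr_ae ?_
    filter_upwards [hae] with z hz
    rw [hy, hz]
  rcases U.eq_empty_or_nonempty with rfl | ⟨z₀, hz₀⟩
  · simp
  have hUm := hU.measurableSet
  set μ : ℕ → ℝ := shrinkRatio with hμ
  have hμ1 := shrinkRatio_lt_one
  have hμ0 := half_le_shrinkRatio
  have hlim := tendsto_shrinkRatio_sq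
  set K : ℕ → Set E3 := fun n => shrink U z₀ (μ n ^ 2) with hK
  have hsq : ∀ n, 0 < μ n ^ 2 := fun n => by have := hμ0 n; positivity
  have hsq1 : ∀ n, μ n ^ 2 < 1 := fun n => by nlinarith [hμ0 n, hμ1 n]
  have hKU : ∀ n, K n ⊆ U := fun n => shrink_subset hU hUc hz₀ (hsq n) (hsq1 n)
  have hKcp : ∀ n, IsCompact (K n) := fun n => isCompact_shrink hUb z₀ _
  have hmem : ∀ x ∈ U, ∀ᶠ n in atTop, x ∈ K n := fun x hx =>
    (eventually_mem_shrink hU z₀ hx hlim).mono fun n hn => image_homothety_subset_shrink U z₀ _ hn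
  have hbd : ∀ n, ∫⁻ y in A ∩ K n, ∫⁻ z in K n, ‖u z - u y‖ₑ ^ 2 ≤
      ENNReal.ofReal (2 ^ 18 * d ^ 2 * b ^ 4) *
        (volume U * ∑ i, ∫⁻ z in U, ‖G i z‖ₑ ^ 2) := by
    intro n
    have hμp : 0 < μ n := by linarith [hμ0 n]
    have hv : volume (A ∩ K n) ≤ ENNReal.ofReal ((b / μ n) ^ 6) * volume (K n) := by
      calc volume (A ∩ K n) ≤ volume A := measure_mono inter_subset_left
        _ ≤ ENNReal.ofReal (b ^ 6) * volume U := hvol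
        _ = _ := by
          rw [hK]
          simp only
          rw [volume_shrink hUc z₀ (hsq n), ← mul_assoc, ← ENNReal.ofReal_mul (by positivity)]
          congr 2
          field_simp
    refine (h.lintegral_sub_sq_le_of_isCompact hU (hKcp n) (hKU n) (convex_shrink hUc z₀ _)
      (hA.inter (hKcp n).measurableSet) inter_subset_right (div_pos hb hμp)
      (fun y hy z hz => hd y (hKU n hy) z (hKU n hz)) hv).trans ?_
    refine mul_le_mul' (ENNReal.ofReal_le_ofReal ?_) (mul_le_mul' (measure_mono (hKU n)) le_rfl)
    rw [div_pow, show (2 : ℝ) ^ 18 = 2 ^ 14 * 16 by norm_num]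
    have h4 : b ^ 4 / μ n ^ 4 ≤ 16 * b ^ 4 := by
      rw [div_le_iff₀ (by positivity)]
      have : (1 / 2 : ℝ) ^ 4 ≤ μ n ^ 4 := pow_le_pow_left₀ (by norm_num) (hμ0 n) 4
      have hb4 : 0 < b ^ 4 := by positivity
      nlinarith
    nlinarith [sq_nonneg d, mul_le_mul_of_nonneg_left h4 (sq_nonneg d)]
  calc ∫⁻ y in A, ∫⁻ z in U, ‖u z - u y‖ₑ ^ 2
      = ∫⁻ y in A, ∫⁻ z in U, liminf (fun n => (K n).indicator (fun y =>
          (K n).indicator (fun z => ‖u z - u y‖ₑ ^ 2) z) y) atTop := by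
        refine setLIntegral_congr_fun hA fun y hy => setLIntegral_congr_fun hUm fun z hz => ?_
        refine (Tendsto.liminf_eq ?_).symm
        refine tendsto_const_nhds.congr' ?_
        filter_upwards [hmem y (hAU hy), hmem z hz] with n hn1 hn2
        simp [hn1, hn2]
    _ ≤ ∫⁻ y in A, liminf (fun n => ∫⁻ z in U, (K n).indicator (fun y =>
          (K n).indicator (fun z => ‖u z - u y‖ₑ ^ 2) z) y) atTop := by
        refine lintegral_mono fun y => lintegral_liminf_le fun n => ?_
        have hm : Measurable fun z => ‖u z - u y‖ₑ ^ 2 := by fun_prop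
        by_cases hy : y ∈ K n
        · simpa only [indicator_of_mem hy] using hm.indicator (hKcp n).measurableSet
        · simp only [indicator_of_notMem hy]; exact measurable_const
    _ = ∫⁻ y in A, liminf (fun n => (K n).indicator (fun y =>
          ∫⁻ z in K n, ‖u z - u y‖ₑ ^ 2) y) atTop := by
        refine lintegral_congr fun y => ?_
        congr 1
        funext n
        by_cases hy : y ∈ K n
        · simp only [indicator_of_mem hy]
          rw [setLIntegral_indicator (hKcp n).measurableSet, inter_eq_left.2 (hKU n)]
        · simp [indicator_of_notMem hy]
    _ ≤ liminf (fun n => ∫⁻ y in A, (K n).indicator (fun y =>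
          ∫⁻ z in K n, ‖u z - u y‖ₑ ^ 2) y) atTop := by
        refine lintegral_liminf_le fun n => Measurable.indicator ?_ (hKcp n).measurableSet
        exact Measurable.lintegral_prod_right' (ν := volume.restrict (K n))
          (f := fun q : E3 × E3 => ‖u q.2 - u q.1‖ₑ ^ 2) (by fun_prop)
    _ ≤ _ := by
        refine liminf_le_of_le (by isBoundedDefault) fun b' hb' => ?_
        obtain ⟨n, hn⟩ := hb'.exists
        refine hn.trans ?_
        rw [setLIntegral_indicator (hKcp n).measurableSet, inter_comm]
        exact hbd n

theorem ennreal_add_sq_le (a b : ℝ≥0∞) : (a + b) ^ 2 ≤ 2 * a ^ 2 + 2 * b ^ 2 := by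
  have h := ENNReal.rpow_add_le_mul_rpow_add_rpow a b (p := 2) (by norm_num)
  have e : (2 : ℝ≥0∞) ^ ((2 : ℝ) - 1) = 2 := by norm_num
  rw [e] at h
  simp only [ENNReal.rpow_two] at h
  rwa [mul_add] at h

/-- The substitute for the embedding of `H¹` in `L⁶`: a set of volume `θ ^ 3` carries only a
multiple of `θ ^ 2` of the `L²` energy. It comes from `u y = (u y - u z) + u z`, squared and
integrated over `y ∈ A` and `z ∈ U`. -/
theorem IsWeakGrad.setLIntegral_sq_le {U A : Set E3} (hU : IsOpen U)
    (hUc : Convex ℝ U) (hUb : Bornology.IsBounded U) (hA : MeasurableSet A) (hAU : A ⊆ U)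
    {u : E3 → ℝ} {G : Fin 3 → E3 → ℝ} (h : IsWeakGrad U u G)
    {s d θ : ℝ} (hs : 0 < s) (hθ : 0 < θ) (hd : ∀ y ∈ U, ∀ z ∈ U, ‖z - y‖ ≤ d)
    (hUv : volume U = ENNReal.ofReal (s ^ 6)) (hAv : volume A ≤ ENNReal.ofReal (θ ^ 3)) :
    ∫⁻ y in A, ‖u y‖ₑ ^ 2 ≤ ENNReal.ofReal (2 ^ 19 * θ ^ 2 / s ^ 4) *
      ((∫⁻ z in U, ‖u z‖ₑ ^ 2) + ENNReal.ofReal (d ^ 2) * ∑ i, ∫⁻ z in U, ‖G i z‖ₑ ^ 2) := by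
  -- Chosen so that `b ^ 6` is the ratio of `θ ^ 3` to the volume of `U`.
  set b := √θ / s with hb
  have hb0 : 0 < b := by positivity
  have hb2 : b ^ 2 = θ / s ^ 2 := by rw [hb, div_pow, Real.sq_sqrt hθ.le]
  have hb6 : b ^ 6 * s ^ 6 = θ ^ 3 := by
    rw [show b ^ 6 = (b ^ 2) ^ 3 by ring, hb2]; field_simp
  have hb4 : b ^ 4 = θ ^ 2 / s ^ 4 := by
    rw [show b ^ 4 = (b ^ 2) ^ 2 by ring, hb2]; field_simp
  have hvol : volume A ≤ ENNReal.ofReal (b ^ 6) * volume U := by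
    rw [hUv, ← ENNReal.ofReal_mul (by positivity), hb6]; exact hAv
  -- For `b ≤ 1` the exponent `6` may be lowered to `4`; for `b > 1` the inclusion `A ⊆ U` is
  -- enough.
  have hvol4 : volume A ≤ ENNReal.ofReal (b ^ 4) * volume U := by
    rcases le_or_gt b 1 with h1 | h1
    · refine hvol.trans ?_
      gcongr ENNReal.ofReal ?_ * _
      exact pow_le_pow_of_le_one hb0.le h1 (by norm_num)
    · calc volume A ≤ volume U := measure_mono hAU
        _ = ENNReal.ofReal 1 * volume U := by simp
        _ ≤ _ := by
          gcongr
          exact one_le_pow₀ h1.le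
  have hUne : volume U ≠ 0 := by rw [hUv]; simp; positivity
  have hUtop : volume U ≠ ⊤ := by rw [hUv]; simp
  have h1 := h.lintegral_sub_sq_le hU hUc hUb hA hAU hb0 hd hvol
  have hm := h.1.aestronglyMeasurable
  set I := ∫⁻ z in U, ‖u z‖ₑ ^ 2
  set S := ∑ i, ∫⁻ z in U, ‖G i z‖ₑ ^ 2
  rw [← ENNReal.mul_le_mul_iff_right hUne hUtop]
  calc volume U * ∫⁻ y in A, ‖u y‖ₑ ^ 2 = ∫⁻ y in A, ∫⁻ _ in U, ‖u y‖ₑ ^ 2 := by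
        simp_rw [setLIntegral_const]
        rw [lintegral_mul_const' _ _ hUtop, mul_comm]
    _ ≤ ∫⁻ y in A, ((2 * ∫⁻ z in U, ‖u z - u y‖ₑ ^ 2) + 2 * I) := by
        refine lintegral_mono fun y => ?_
        have hm2 : AEMeasurable (fun z => 2 * ‖u z‖ₑ ^ 2) (volume.restrict U) :=
          (hm.enorm.pow_const 2).const_mul 2
        rw [← lintegral_const_mul' _ _ (by simp), ← lintegral_const_mul' _ _ (by simp),
          ← lintegral_add_right' _ hm2]
        refine lintegral_mono fun z => ?_
        have e : u y = -(u z - u y) + u z := by ring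
        have h2 : ‖u y‖ₑ ≤ ‖u z - u y‖ₑ + ‖u z‖ₑ := by
          conv_lhs => rw [e]
          exact (enorm_add_le _ _).trans (by rw [enorm_neg])
        exact (pow_le_pow_left₀ zero_le h2 2).trans (ennreal_add_sq_le _ _)
    _ = 2 * (∫⁻ y in A, ∫⁻ z in U, ‖u z - u y‖ₑ ^ 2) + 2 * I * volume A := by
        rw [lintegral_add_right _ measurable_const, setLIntegral_const,
          lintegral_const_mul' _ _ (by simp)]
    _ ≤ 2 * (ENNReal.ofReal (2 ^ 18 * d ^ 2 * b ^ 4) * (volume U * S)) +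
        2 * I * (ENNReal.ofReal (b ^ 4) * volume U) := by gcongr
    _ ≤ volume U * (ENNReal.ofReal (2 ^ 19 * b ^ 4) * (I + ENNReal.ofReal (d ^ 2) * S)) := by
        have e2 : ENNReal.ofReal 2 = 2 := ENNReal.ofReal_ofNat 2
        have e5 : 2 * ENNReal.ofReal (2 ^ 18 * d ^ 2 * b ^ 4) =
            ENNReal.ofReal (2 ^ 19 * b ^ 4) * ENNReal.ofReal (d ^ 2) := by
          rw [← ENNReal.ofReal_mul (by positivity), ← e2, ← ENNReal.ofReal_mul (by norm_num)]
          congr 1; ring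
        have e3 : 2 * (ENNReal.ofReal (2 ^ 18 * d ^ 2 * b ^ 4) * (volume U * S)) =
            volume U * (ENNReal.ofReal (2 ^ 19 * b ^ 4) * (ENNReal.ofReal (d ^ 2) * S)) := by
          rw [← mul_assoc, e5]; ring
        have e4 : 2 * I * (ENNReal.ofReal (b ^ 4) * volume U) ≤
            volume U * (ENNReal.ofReal (2 ^ 19 * b ^ 4) * I) := by
          calc _ = volume U * (ENNReal.ofReal (2 * b ^ 4) * I) := by
                rw [ENNReal.ofReal_mul (by norm_num), e2]; ring
            _ ≤ _ := by
                gcongr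
                norm_num
        rw [e3, mul_add, mul_add, add_comm]
        gcongr
    _ = _ := by rw [hb4, mul_div_assoc]

/-- The case `A = U`, `b = 1`. As `u` has mean zero, the integral of `u z - u y` over `z` equals
`-|U| u y`, and Cauchy–Schwarz brings in the double integral. -/
theorem IsWeakGrad.poincare {U : Set E3} (hU : IsOpen U)
    (hUc : Convex ℝ U) (hUb : Bornology.IsBounded U)
    {u : E3 → ℝ} {G : Fin 3 → E3 → ℝ} (h : IsWeakGrad U u G)
    {d : ℝ} (hd : ∀ y ∈ U, ∀ z ∈ U, ‖z - y‖ ≤ d) (hmean : ∫ x in U, u x = 0) :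
    ∫⁻ y in U, ‖u y‖ₑ ^ 2 ≤ ENNReal.ofReal (2 ^ 18 * d ^ 2) * ∑ i, ∫⁻ z in U, ‖G i z‖ₑ ^ 2 := by
  have hUtop : volume U ≠ ⊤ := hUb.measure_lt_top.ne
  rcases eq_or_ne (volume U) 0 with h0 | hUne
  · rw [Measure.restrict_eq_zero.2 h0]; simp
  have hfin : IsFiniteMeasure (volume.restrict U) := ⟨by simpa using hUtop.lt_top⟩
  have hi : Integrable u (volume.restrict U) := h.1.integrable one_le_two
  have h1 := h.lintegral_sub_sq_le hU hUc hUb hU.measurableSet Subset.rfl one_pos hd (by simp)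
  rw [one_pow, mul_one] at h1
  have hpt : ∀ y, (volume U * ‖u y‖ₑ) ^ 2 ≤ volume U * ∫⁻ z in U, ‖u z - u y‖ₑ ^ 2 := by
    intro y
    have e1 : ∫ z in U, (u z - u y) = - (volume.real U * u y) := by
      rw [integral_sub hi (integrable_const _), hmean, setIntegral_const]
      simp
    have e2 : volume U * ‖u y‖ₑ ≤ ∫⁻ z in U, ‖u z - u y‖ₑ := by
      have := enorm_integral_le_lintegral_enorm (μ := volume.restrict U) (fun z => u z - u y)
      rw [e1, enorm_neg, enorm_mul, Real.enorm_of_nonneg measureReal_nonneg,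
        ofReal_measureReal hUtop] at this
      exact this
    have e3 := lintegral_sq_le (volume.restrict U) (f := fun z => ‖u z - u y‖ₑ)
      (h.1.aestronglyMeasurable.sub aestronglyMeasurable_const).enorm
    rw [Measure.restrict_apply_univ] at e3
    exact (pow_le_pow_left₀ zero_le e2 2).trans e3
  have hne2 : volume U ^ 2 ≠ 0 := pow_ne_zero _ hUne
  have htop2 : volume U ^ 2 ≠ ⊤ := ENNReal.pow_ne_top hUtop
  rw [← ENNReal.mul_le_mul_iff_right hne2 htop2]
  calc volume U ^ 2 * ∫⁻ y in U, ‖u y‖ₑ ^ 2 = ∫⁻ y in U, (volume U * ‖u y‖ₑ) ^ 2 := by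
        simp_rw [mul_pow]
        rw [lintegral_const_mul' _ _ htop2]
    _ ≤ ∫⁻ y in U, volume U * ∫⁻ z in U, ‖u z - u y‖ₑ ^ 2 := lintegral_mono hpt
    _ = volume U * ∫⁻ y in U, ∫⁻ z in U, ‖u z - u y‖ₑ ^ 2 := lintegral_const_mul' _ _ hUtop
    _ ≤ volume U * _ := mul_le_mul_right h1 _
    _ = _ := by ring

/-- The growth condition passes to the mollifications, and the bound passes to the limit at points
where they converge. -/
theorem IsWeakGrad.abs_sub_le_of_growth {U K : Set E3} (hU : IsOpen U) (hK : IsCompact K)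
    (hKU : K ⊆ U) (hKc : Convex ℝ K) {u : E3 → ℝ} {G : Fin 3 → E3 → ℝ} (h : IsWeakGrad U u G)
    {s d M : ℝ} (hs : 0 < s) (hM : 0 ≤ M) (hd : ∀ y ∈ K, ∀ z ∈ K, ‖z - y‖ ≤ d)
    (hvol : volume K = ENNReal.ofReal (s ^ 6))
    (hgr : ∀ θ > 0, ∀ B ⊆ U, MeasurableSet B → volume B ≤ ENNReal.ofReal (θ ^ 3) →
      ∑ i, ∫⁻ z in B, ‖G i z‖ₑ ^ 2 ≤ ENNReal.ofReal (M ^ 2 * θ ^ 2)) {x y : E3} (hx : x ∈ K)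
    (hy : y ∈ K)
    (hxl : Tendsto (fun n => moll n (U.indicator u) x) atTop (𝓝 (u x)))
    (hyl : Tendsto (fun n => moll n (U.indicator u) y) atTop (𝓝 (u y))) :
    |u x - u y| ≤ 4 * d * M / s := by
  refine le_of_tendsto (hxl.sub hyl).abs ?_
  filter_upwards [h.eventually_setLIntegral_fderiv_moll_le hU hK hKU] with n hn
  refine MassLump.abs_sub_le_of_growth
    ((contDiff_moll n (locallyIntegrable_indicator hU.measurableSet h.1)).of_le (by simp))
    hK.measurableSet hKc hs hM hd hvol (fun θ hθ B hB hBm hBv => ?_) hx hy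
  refine hn B hB hBm _ fun t => ?_
  refine hgr θ hθ _ inter_subset_right ((measurable_add_const t hBm).inter hU.measurableSet) ?_
  refine (measure_mono inter_subset_left).trans ?_
  rwa [measure_preimage_add_right]

theorem exists_mem_of_ae {V : Set E3} (hV : IsOpen V) (hne : V.Nonempty) {P : E3 → Prop}
    (h : ∀ᵐ x, P x) : ∃ x ∈ V, P x := by
  have hd := (Measure.dense_of_ae (μ := (volume : Measure E3)) h)
  obtain ⟨x, hx, hx'⟩ := hd.inter_open_nonempty V hV hne
  exact ⟨x, hx, hx'⟩

/-- Oscillation bound for functions with two weak derivatives on a convex set. -/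
theorem abs_sub_sq_le_of_hessian {U : Set E3} (hU : IsOpen U)
    (hUc : Convex ℝ U) (hUb : Bornology.IsBounded U)
    {u g : E3 → ℝ} {G : Fin 3 → E3 → ℝ} {H : Fin 3 → Fin 3 → E3 → ℝ} (h : IsWeakGrad U u G)
    (hG : ∀ i, IsWeakGrad U (G i) (H i)) (hg : ContinuousOn g U)
    (hgu : g =ᵐ[volume.restrict U] u)
    {s d S : ℝ} (hs : 0 < s) (hd : ∀ y ∈ U, ∀ z ∈ U, ‖z - y‖ ≤ d)
    (hUv : volume U = ENNReal.ofReal (s ^ 6)) (hS : 0 ≤ S)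
    (hbd : ∑ i, ((∫⁻ z in U, ‖G i z‖ₑ ^ 2) +
      ENNReal.ofReal (d ^ 2) * ∑ j, ∫⁻ z in U, ‖H i j z‖ₑ ^ 2) ≤ ENNReal.ofReal S)
    {x y : E3} (hx : x ∈ U) (hy : y ∈ U) :
    (g x - g y) ^ 2 ≤ 2 ^ 25 * d ^ 2 * S / s ^ 6 := by
  have h' : IsWeakGrad U g G := ⟨(memLp_congr_ae hgu).2 h.1,
    fun i => (h.2 i).congr hgu.symm (ae_eq_refl _)⟩
  have hd0 : 0 ≤ d := (norm_nonneg _).trans (hd x hx x hx)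
  -- With this `M` the small-set estimate for the components of the gradient becomes Morrey's growth
  -- condition.
  set M := √(2 ^ 19 * S) / s ^ 2 with hM
  have hM0 : 0 ≤ M := by positivity
  have hM2 : M ^ 2 = 2 ^ 19 * S / s ^ 4 := by
    rw [hM, div_pow, Real.sq_sqrt (by positivity)]; ring_nf
  have hgr : ∀ θ > 0, ∀ B ⊆ U, MeasurableSet B → volume B ≤ ENNReal.ofReal (θ ^ 3) →
      ∑ i, ∫⁻ z in B, ‖G i z‖ₑ ^ 2 ≤ ENNReal.ofReal (M ^ 2 * θ ^ 2) := by
    intro θ hθ B hB hBm hBv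
    calc _ ≤ ∑ i, ENNReal.ofReal (2 ^ 19 * θ ^ 2 / s ^ 4) *
          ((∫⁻ z in U, ‖G i z‖ₑ ^ 2) + ENNReal.ofReal (d ^ 2) * ∑ j, ∫⁻ z in U, ‖H i j z‖ₑ ^ 2) :=
          Finset.sum_le_sum fun i _ =>
            (hG i).setLIntegral_sq_le hU hUc hUb hBm hB hs hθ hd hUv hBv
      _ ≤ ENNReal.ofReal (2 ^ 19 * θ ^ 2 / s ^ 4) * ENNReal.ofReal S := by
          rw [← Finset.mul_sum]
          gcongr
      _ = _ := by
          rw [← ENNReal.ofReal_mul (by positivity), hM2]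
          congr 1; ring
  have hae : ∀ᵐ z, z ∈ U → Tendsto (fun n => moll n (U.indicator g) z) atTop (𝓝 (g z)) := by
    filter_upwards [ae_tendsto_moll (locallyIntegrable_indicator hU.measurableSet h'.1)]
      with z hz hzU
    rwa [indicator_of_mem hzU] at hz
  -- The mollifications are known to converge only almost everywhere. A violation at `(x, y)`
  -- persists nearby, hence occurs at points `x'`, `y'` of convergence that lie in a common compact
  -- copy of `U`.
  by_contra! hcon
  have hc : ∀ᶠ q : E3 × E3 in 𝓝 (x, y),
      2 ^ 25 * d ^ 2 * S / s ^ 6 < (g q.1 - g q.2) ^ 2 := by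
    have hcx : Tendsto (fun q : E3 × E3 => g q.1) (𝓝 (x, y)) (𝓝 (g x)) :=
      (hg.continuousAt (hU.mem_nhds hx)).tendsto.comp (continuous_fst.tendsto (x, y))
    have hcy : Tendsto (fun q : E3 × E3 => g q.2) (𝓝 (x, y)) (𝓝 (g y)) :=
      (hg.continuousAt (hU.mem_nhds hy)).tendsto.comp (continuous_snd.tendsto (x, y))
    exact ((hcx.sub hcy).pow 2).eventually (lt_mem_nhds hcon)
  obtain ⟨V, W, hV, hxV, hW, hyW, hVW⟩ := mem_nhds_prod_iff'.1 hc
  obtain ⟨n, hnx, hny⟩ := ((eventually_mem_shrink hU x hx tendsto_shrinkRatio_sq).and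
    (eventually_mem_shrink hU x hy tendsto_shrinkRatio_sq)).exists
  have h1 := half_le_shrinkRatio n
  have h2 := shrinkRatio_lt_one n
  set μ := shrinkRatio n with hμ
  have hμ0 : 0 < μ := by linarith
  have hopen : IsOpen ((fun z => x + μ ^ 2 • (z - x)) '' U) := by
    have e : (fun z => x + μ ^ 2 • (z - x)) = AffineMap.homothety x (μ ^ 2) := by
      funext z; simp [AffineMap.homothety_apply, add_comm]
    rw [e]
    exact AffineMap.homothety_isOpenMap x (μ ^ 2) (by positivity) U hU
  have hsub := shrink_subset hU hUc hx (t := μ ^ 2) (by positivity) (by nlinarith)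
  obtain ⟨x', ⟨hx'V, hx'⟩, hx''⟩ := exists_mem_of_ae (hV.inter hopen) ⟨x, hxV, hnx⟩ hae
  obtain ⟨y', ⟨hy'W, hy'⟩, hy''⟩ := exists_mem_of_ae (hW.inter hopen) ⟨y, hyW, hny⟩ hae
  have hx's := image_homothety_subset_shrink U x _ hx'
  have hy's := image_homothety_subset_shrink U x _ hy'
  have hK := h'.abs_sub_le_of_growth hU (isCompact_shrink hUb x (μ ^ 2)) hsub
    (convex_shrink hUc x _) (s := μ * s) (by positivity) hM0
    (fun y hy z hz => hd y (hsub hy) z (hsub hz)) (by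
      rw [volume_shrink hUc x (by positivity), hUv, ← ENNReal.ofReal_mul (by positivity)]
      congr 1; ring) hgr hx's hy's (hx'' (hsub hx's)) (hy'' (hsub hy's))
  have hlt : 2 ^ 25 * d ^ 2 * S / s ^ 6 < (g x' - g y') ^ 2 := hVW (mk_mem_prod hx'V hy'W)
  -- Since `μ ≥ 1 / 2`, the factor `4` becomes `8`; then `8 ^ 2 * 2 ^ 19 = 2 ^ 25`.
  have hK2 : |g x' - g y'| ≤ 8 * d * M / s := by
    refine hK.trans ?_
    rw [div_le_div_iff₀ (by positivity) hs]
    have : 0 ≤ d * M * s := by positivity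
    nlinarith
  have hK3 := pow_le_pow_left₀ (abs_nonneg _) hK2 2
  rw [sq_abs] at hK3
  have e : (8 * d * M / s) ^ 2 = 2 ^ 25 * d ^ 2 * S / s ^ 6 := by
    rw [div_pow, mul_pow, hM2]
    field_simp
    ring
  linarith

end MassLump

namespace MassLump

open scoped ENNReal
open Filter Topology

/-! ### Polynomials -/

theorem polyEval_add (q r : MvPolynomial (Fin 3) ℝ) : polyEval (q + r) = polyEval q + polyEval r := by
  funext x; simp [polyEval]

theorem polyEval_sub (q r : MvPolynomial (Fin 3) ℝ) : polyEval (q - r) = polyEval q - polyEval r := by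
  funext x; simp [polyEval]

theorem polyEval_mul (q r : MvPolynomial (Fin 3) ℝ) (x : E3) :
    polyEval (q * r) x = polyEval q x * polyEval r x := by simp [polyEval]

theorem polyEval_smul (a : ℝ) (q : MvPolynomial (Fin 3) ℝ) (x : E3) :
    polyEval (a • q) x = a * polyEval q x := by simp [polyEval]

theorem polyEval_sum {ι : Type*} (s : Finset ι) (q : ι → MvPolynomial (Fin 3) ℝ) (x : E3) :
    polyEval (∑ i ∈ s, q i) x = ∑ i ∈ s, polyEval (q i) x := by simp [polyEval]

theorem polyEval_C (a : ℝ) (x : E3) : polyEval (MvPolynomial.C a) x = a := by simp [polyEval]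

theorem contDiff_polyEval (q : MvPolynomial (Fin 3) ℝ) : ContDiff ℝ ∞ (polyEval q) := by
  induction q using MvPolynomial.induction_on with
  | C a => rw [show polyEval (MvPolynomial.C a) = fun _ => a from funext (polyEval_C a)]; exact contDiff_const
  | add p q hp hq => rw [polyEval_add]; exact hp.add hq
  | mul_X p i hp =>
    have h : ContDiff ℝ ∞ fun x : E3 => x i := by fun_prop
    have e : polyEval (p * MvPolynomial.X i) = fun x => polyEval p x * x i := by
      funext x; simp [polyEval]
    rw [e]
    exact hp.mul h

theorem continuous_polyEval (q : MvPolynomial (Fin 3) ℝ) : Continuous (polyEval q) :=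
  (contDiff_polyEval q).continuous

theorem partialDeriv_polyEval (i : Fin 3) (q : MvPolynomial (Fin 3) ℝ) :
    partialDeriv i (polyEval q) = polyEval (MvPolynomial.pderiv i q) := by
  funext x
  induction q using MvPolynomial.induction_on with
  | C a =>
    have : polyEval (MvPolynomial.C a) = fun _ => a := funext (polyEval_C a)
    unfold partialDeriv
    rw [this]
    simp [polyEval]
  | add p q hp hq =>
    unfold partialDeriv at *
    rw [polyEval_add, fderiv_add ((contDiff_polyEval p).differentiable (by simp) x)
      ((contDiff_polyEval q).differentiable (by simp) x), map_add, polyEval_add]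
    simp [hp, hq]
  | mul_X p j hp =>
    unfold partialDeriv at *
    have e : polyEval (p * MvPolynomial.X j) = fun x => polyEval p x * x j := by
      funext x; simp [polyEval]
    have h1 : HasFDerivAt (fun x : E3 => x j) (EuclideanSpace.proj (𝕜 := ℝ) j) x :=
      (EuclideanSpace.proj (𝕜 := ℝ) j).hasFDerivAt
    have h2 := ((contDiff_polyEval p).differentiable (by simp) x).hasFDerivAt
    have h3 : HasFDerivAt (fun x => polyEval p x * x j) _ x := h2.mul h1
    rw [e, h3.fderiv]
    simp only [add_apply, smul_apply, smul_eq_mul, hp]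
    rw [MvPolynomial.pderiv_mul, MvPolynomial.pderiv_X]
    simp [polyEval, Pi.single_apply, mul_comm]
    split_ifs <;> simp_all [add_comm]

/-- The formal derivative `D^α` of polynomials. -/
noncomputable def polyDeriv (α : Fin 3 → ℕ) :
    MvPolynomial (Fin 3) ℝ →ₗ[ℝ] MvPolynomial (Fin 3) ℝ :=
  ((MvPolynomial.pderiv 0).toLinearMap ^ α 0) * ((MvPolynomial.pderiv 1).toLinearMap ^ α 1) *
    ((MvPolynomial.pderiv 2).toLinearMap ^ α 2)

theorem iterate_partialDeriv_polyEval (i : Fin 3) (n : ℕ) (q : MvPolynomial (Fin 3) ℝ) :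
    (partialDeriv i)^[n] (polyEval q) =
      polyEval (((MvPolynomial.pderiv (R := ℝ) i).toLinearMap ^ n) q) := by
  induction n with
  | zero => simp
  | succ n ih =>
    rw [Function.iterate_succ_apply', ih, partialDeriv_polyEval, pow_succ']
    rfl

theorem multiDeriv_polyEval (α : Fin 3 → ℕ) (q : MvPolynomial (Fin 3) ℝ) :
    multiDeriv α (polyEval q) = polyEval (polyDeriv α q) := by
  unfold multiDeriv
  rw [iterate_partialDeriv_polyEval, iterate_partialDeriv_polyEval, iterate_partialDeriv_polyEval]
  rfl

theorem pderiv_pow_monomial (i : Fin 3) (n : ℕ) (s : Fin 3 →₀ ℕ) (a : ℝ) :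
    ((MvPolynomial.pderiv (R := ℝ) i).toLinearMap ^ n) (MvPolynomial.monomial s a) =
      MvPolynomial.monomial (s - Finsupp.single i n) (a * (s i).descFactorial n) := by
  induction n with
  | zero => simp
  | succ n ih =>
    rw [pow_succ', Module.End.mul_apply, ih]
    change MvPolynomial.pderiv i _ = _
    rw [MvPolynomial.pderiv_monomial, Nat.descFactorial_succ, tsub_tsub, ← Finsupp.single_add]
    congr 1
    simp
    ring

theorem polyDeriv_monomial (α : Fin 3 → ℕ) (s : Fin 3 →₀ ℕ) (a : ℝ) :
    polyDeriv α (MvPolynomial.monomial s a) =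
      MvPolynomial.monomial (s - Finsupp.equivFunOnFinite.symm α)
        (a * ∏ i, ((s i).descFactorial (α i) : ℝ)) := by
  unfold polyDeriv
  rw [Module.End.mul_apply, Module.End.mul_apply, pderiv_pow_monomial, pderiv_pow_monomial,
    pderiv_pow_monomial]
  have e1 : s - Finsupp.single 2 (α 2) - Finsupp.single 1 (α 1) - Finsupp.single 0 (α 0) =
      s - Finsupp.equivFunOnFinite.symm α := by
    ext i
    fin_cases i <;> simp
  rw [e1]
  congr 1
  simp [Fin.prod_univ_three]
  ring

theorem polyDeriv_monomial_eq_zero {α : Fin 3 → ℕ} {s : Fin 3 →₀ ℕ} (a : ℝ)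
    (h : ∃ i, s i < α i) : polyDeriv α (MvPolynomial.monomial s a) = 0 := by
  obtain ⟨i, hi⟩ := h
  rw [polyDeriv_monomial, Finset.prod_eq_zero (Finset.mem_univ i), mul_zero, map_zero]
  rw [Nat.descFactorial_of_lt hi, Nat.cast_zero]

theorem polyDeriv_eq_zero {k : ℕ} {q : MvPolynomial (Fin 3) ℝ} (hq : q ∈ Poly k)
    {α : Fin 3 → ℕ} (hα : k < ∑ i, α i) : polyDeriv α q = 0 := by
  rw [MvPolynomial.mem_restrictTotalDegree] at hq
  rw [q.as_sum, map_sum]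
  refine Finset.sum_eq_zero fun s hs => polyDeriv_monomial_eq_zero _ ?_
  by_contra! hcon
  have h1 : ∑ i, α i ≤ ∑ i, s i := Finset.sum_le_sum fun i _ => hcon i
  have h2 := MvPolynomial.le_totalDegree hs
  rw [Finsupp.sum_fintype _ _ (by simp)] at h2
  omega

/-- Multi-indices of order exactly `k`. -/
def levelIndices (k : ℕ) : Finset (Fin 3 → ℕ) := (multiIndices k).filter fun α => ∑ i, α i = k

theorem mem_multiIndices {k : ℕ} {α : Fin 3 → ℕ} : α ∈ multiIndices k ↔ ∑ i, α i ≤ k := by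
  unfold multiIndices
  rw [Finset.mem_filter, Fintype.mem_piFinset]
  refine ⟨fun h => h.2, fun h => ⟨fun i => ?_, h⟩⟩
  have := Finset.single_le_sum (f := α) (fun i _ => Nat.zero_le _) (Finset.mem_univ i)
  rw [Finset.mem_range]; omega

theorem mem_levelIndices {k : ℕ} {α : Fin 3 → ℕ} : α ∈ levelIndices k ↔ ∑ i, α i = k := by
  unfold levelIndices
  rw [Finset.mem_filter, mem_multiIndices]
  omega

/-- The monomial `X ^ β / β!` has `D^β` equal to `1`, while its other derivatives of order `|β|`
vanish. -/
theorem exists_poly_polyDeriv_eq (k : ℕ) (c : (Fin 3 → ℕ) → ℝ) :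
    ∃ q ∈ Poly k, ∀ α : Fin 3 → ℕ, ∑ i, α i = k → polyDeriv α q = MvPolynomial.C (c α) := by
  set m : (Fin 3 → ℕ) → MvPolynomial (Fin 3) ℝ := fun β =>
    MvPolynomial.monomial (Finsupp.equivFunOnFinite.symm β) (c β / ∏ i, ((β i).factorial : ℝ))
  refine ⟨∑ β ∈ levelIndices k, m β, ?_, fun α hα => ?_⟩
  · refine Submodule.sum_mem _ fun β hβ => ?_
    rw [mem_levelIndices] at hβ
    rw [MvPolynomial.mem_restrictTotalDegree]
    refine (MvPolynomial.totalDegree_monomial_le _ _).trans ?_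
    rw [Finsupp.sum_fintype _ _ (by simp)]
    simp [hβ]
  · rw [map_sum, Finset.sum_eq_single α]
    · rw [polyDeriv_monomial, tsub_self]
      have : (∏ i, ((α i).factorial : ℝ)) ≠ 0 :=
        Finset.prod_ne_zero_iff.2 fun i _ => by exact_mod_cast (α i).factorial_ne_zero
      simp only [Finsupp.equivFunOnFinite_symm_apply_apply, Nat.descFactorial_self]
      rw [div_mul_cancel₀ _ this]
      rfl
    · intro β hβ hne
      rw [mem_levelIndices] at hβ
      refine polyDeriv_monomial_eq_zero _ ?_
      by_contra! hcon
      apply hne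
      have h2 : ∀ i, α i ≤ β i := fun i => by simpa using hcon i
      funext i
      refine ((Finset.sum_eq_sum_iff_of_le fun i _ => h2 i).1 (hα.trans hβ.symm) i
        (Finset.mem_univ i)).symm
    · intro h
      exact absurd (mem_levelIndices.2 hα) h

theorem sum_add_single (α : Fin 3 → ℕ) (i : Fin 3) :
    ∑ j, (α + Pi.single i 1 : Fin 3 → ℕ) j = ∑ j, α j + 1 := by
  simp [Finset.sum_add_distrib]

/-! ### Families of weak derivatives -/

/-- `F α`, `|α| ≤ m`, are the weak derivatives of a function in `H^m(U)`. -/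
def IsFam (U : Set E3) (m : ℕ) (F : (Fin 3 → ℕ) → E3 → ℝ) : Prop :=
  (∀ α : Fin 3 → ℕ, ∑ i, α i ≤ m → MemLp (F α) 2 (volume.restrict U)) ∧
    ∀ (α : Fin 3 → ℕ) (i : Fin 3), ∑ j, α j + 1 ≤ m →
      IsWeakDeriv U (Pi.single i 1) (F α) (F (α + Pi.single i 1))

theorem IsFam.isWeakGrad {U : Set E3} {m : ℕ} {F : (Fin 3 → ℕ) → E3 → ℝ} (h : IsFam U m F)
    {α : Fin 3 → ℕ} (hα : ∑ i, α i + 1 ≤ m) :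
    IsWeakGrad U (F α) fun i => F (α + Pi.single i 1) :=
  ⟨h.1 α (by omega), fun i => h.2 α i hα⟩

theorem IsFam.mono {U V : Set E3} (hU : IsOpen U) (hVU : V ⊆ U) {m k : ℕ} (hk : k ≤ m)
    {F : (Fin 3 → ℕ) → E3 → ℝ} (h : IsFam U m F) : IsFam V k F :=
  ⟨fun α hα => (h.1 α (hα.trans hk)).mono_measure (Measure.restrict_mono hVU le_rfl),
    fun α i hα => (h.2 α i (hα.trans hk)).mono hU.measurableSet hVU⟩

theorem MemH.isFam {Ω : Set E3} {m : ℕ} {u : E3 → ℝ} (h : MemH Ω m u) :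
    IsFam Ω m fun α => weakDeriv Ω α u :=
  ⟨fun _ hα => (h.isWeakDeriv hα).1, fun α i hα => (h.isWeakDeriv (α := α) (by omega)).of_add_single
    (h.isWeakDeriv (by rw [sum_add_single]; exact hα))⟩

theorem contDiff_multiDeriv {f : E3 → ℝ} (hf : ContDiff ℝ ∞ f) (α : Fin 3 → ℕ) :
    ContDiff ℝ ∞ (multiDeriv α f) :=
  contDiff_iterate_partialDeriv (contDiff_iterate_partialDeriv
    (contDiff_iterate_partialDeriv hf 2 _) 1 _) 0 _

theorem partialDeriv_multiDeriv {f : E3 → ℝ} (hf : ContDiff ℝ ∞ f) (α : Fin 3 → ℕ) (i : Fin 3) :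
    partialDeriv i (multiDeriv α f) = multiDeriv (α + Pi.single i 1) f := by
  rw [multiDeriv_add_single hf]
  unfold multiDeriv
  have h2 := contDiff_iterate_partialDeriv hf 2 (α 2)
  have h1 := contDiff_iterate_partialDeriv h2 1 (α 1)
  rw [partialDeriv_iterate_comm h1, partialDeriv_iterate_comm h2, partialDeriv_iterate_comm hf]

theorem IsFam.sub_contDiff {U : Set E3} (hU : Bornology.IsBounded U) {m : ℕ}
    {F : (Fin 3 → ℕ) → E3 → ℝ} (h : IsFam U m F) {f : E3 → ℝ} (hf : ContDiff ℝ ∞ f) :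
    IsFam U m fun α => F α - multiDeriv α f := by
  have hm : ∀ α, MemLp (multiDeriv α f) 2 (volume.restrict U) := fun α =>
    (contDiff_multiDeriv hf α).continuous.memLp_restrict_of_isBounded hU
  refine ⟨fun α hα => (h.1 α hα).sub (hm α), fun α i hα => ?_⟩
  refine IsWeakDeriv.sub (h.1 α (by omega)) (hm α) (h.2 α i hα) ?_
  rw [← partialDeriv_multiDeriv hf]
  exact isWeakDeriv_of_contDiff hU (contDiff_multiDeriv hf α) i

/-- Downward induction on the order. The means of order `k - (j + 1)` are corrected by a polynomial
of that degree; its derivatives of higher order vanish, so the means corrected before are unchanged.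
-/
theorem exists_poly_mean_zero {U : Set E3} (hUb : Bornology.IsBounded U)
    (hU0 : volume U ≠ 0) {m : ℕ} {F : (Fin 3 → ℕ) → E3 → ℝ} (h : IsFam U m F) {k : ℕ}
    (hk : k ≤ m) : ∃ q ∈ Poly (k - 1), ∀ α : Fin 3 → ℕ, ∑ i, α i < k →
      ∫ x in U, (F α - multiDeriv α (polyEval q)) x = 0 := by
  have hUtop : volume U ≠ ⊤ := hUb.measure_lt_top.ne
  have hfin : IsFiniteMeasure (volume.restrict U) := ⟨by simpa using hUtop.lt_top⟩
  have key : ∀ j ≤ k, ∃ q ∈ Poly (k - 1), ∀ α : Fin 3 → ℕ, ∑ i, α i < k → k - j ≤ ∑ i, α i →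
      ∫ x in U, (F α - multiDeriv α (polyEval q)) x = 0 := by
    intro j
    induction j with
    | zero => exact fun _ => ⟨0, Submodule.zero_mem _, fun α h1 h2 => by omega⟩
    | succ j ih =>
      intro hj
      obtain ⟨q, hq, hq2⟩ := ih (by omega)
      obtain ⟨r, hr, hr2⟩ := exists_poly_polyDeriv_eq (k - (j + 1)) fun α =>
        (volume.real U)⁻¹ * ∫ x in U, (F α - multiDeriv α (polyEval q)) x
      have hr' : r ∈ Poly (k - 1) := by
        rw [MvPolynomial.mem_restrictTotalDegree] at hr ⊢
        omega
      refine ⟨q + r, Submodule.add_mem _ hq hr', fun α h1 h2 => ?_⟩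
      have hmi : Integrable (F α - multiDeriv α (polyEval q)) (volume.restrict U) :=
        ((h.sub_contDiff hUb (contDiff_polyEval q)).1 α (by omega)).integrable one_le_two
      have e : F α - multiDeriv α (polyEval (q + r)) =
          (F α - multiDeriv α (polyEval q)) - polyEval (polyDeriv α r) := by
        rw [multiDeriv_polyEval, multiDeriv_polyEval, map_add, polyEval_add]
        abel
      rcases (Nat.eq_or_lt_of_le h2) with h3 | h3
      · have e2 : polyEval (polyDeriv α r) = fun _ =>
            (volume.real U)⁻¹ * ∫ x in U, (F α - multiDeriv α (polyEval q)) x := by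
          rw [hr2 α h3.symm]
          funext x
          rw [polyEval_C]
        have h0 : volume.real U ≠ 0 := (ENNReal.toReal_pos hU0 hUtop).ne'
        rw [e, integral_sub' hmi (by rw [e2]; exact integrable_const _), e2, setIntegral_const,
          smul_eq_mul, ← mul_assoc, mul_inv_cancel₀ h0, one_mul, sub_self]
      · rw [polyDeriv_eq_zero hr h3] at e
        have e3 : polyEval 0 = 0 := by funext x; simp [polyEval]
        rw [e, e3, sub_zero]
        exact hq2 α h1 (by omega)
  obtain ⟨q, hq, hq2⟩ := key k le_rfl
  exact ⟨q, hq, fun α hα => hq2 α hα (by omega)⟩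

end MassLump

namespace MassLump

open scoped ENNReal
open Filter Topology

/-! ### Polynomial approximation on convex sets -/

theorem enorm_sq_eq_ofReal (a : ℝ) : ‖a‖ₑ ^ 2 = ENNReal.ofReal (a ^ 2) := by
  rw [Real.enorm_eq_ofReal_abs, ← ENNReal.ofReal_pow (abs_nonneg _), sq_abs]

theorem lintegral_enorm_sq {U : Set E3} {f : E3 → ℝ} (hf : MemLp f 2 (volume.restrict U)) :
    ∫⁻ x in U, ‖f x‖ₑ ^ 2 = ENNReal.ofReal (∫ x in U, f x ^ 2) := by
  simp_rw [enorm_sq_eq_ofReal]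
  rw [ofReal_integral_eq_lintegral_ofReal hf.integrable_sq
    (Eventually.of_forall fun x => sq_nonneg _)]

theorem setIntegral_sq_nonneg (U : Set E3) (f : E3 → ℝ) : 0 ≤ ∫ x in U, f x ^ 2 :=
  integral_nonneg fun _ => sq_nonneg _

/-- The squared Sobolev seminorm of order exactly `k` of a family of derivatives. -/
noncomputable def levelEnergy (U : Set E3) (F : (Fin 3 → ℕ) → E3 → ℝ) (k : ℕ) : ℝ :=
  ∑ α ∈ levelIndices k, ∫ x in U, F α x ^ 2

theorem levelEnergy_nonneg (U : Set E3) (F : (Fin 3 → ℕ) → E3 → ℝ) (k : ℕ) :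
    0 ≤ levelEnergy U F k := Finset.sum_nonneg fun _ _ => setIntegral_sq_nonneg _ _

theorem setIntegral_sq_le_levelEnergy (U : Set E3) (F : (Fin 3 → ℕ) → E3 → ℝ) (α : Fin 3 → ℕ) :
    ∫ x in U, F α x ^ 2 ≤ levelEnergy U F (∑ i, α i) :=
  Finset.single_le_sum (f := fun α => ∫ x in U, F α x ^ 2)
    (fun _ _ => setIntegral_sq_nonneg _ _) (mem_levelIndices.2 rfl)

theorem IsWeakGrad.poincare_real {U : Set E3} (hU : IsOpen U)
    (hUc : Convex ℝ U) (hUb : Bornology.IsBounded U)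
    {u : E3 → ℝ} {G : Fin 3 → E3 → ℝ} (h : IsWeakGrad U u G)
    {d : ℝ} (hd : ∀ y ∈ U, ∀ z ∈ U, ‖z - y‖ ≤ d) (hmean : ∫ x in U, u x = 0) :
    ∫ x in U, u x ^ 2 ≤ 2 ^ 18 * d ^ 2 * ∑ i, ∫ x in U, G i x ^ 2 := by
  have h1 := h.poincare hU hUc hUb hd hmean
  simp_rw [fun i => lintegral_enorm_sq (h.2 i).1] at h1
  rw [lintegral_enorm_sq h.1, ← ENNReal.ofReal_sum_of_nonneg
    (fun i _ => setIntegral_sq_nonneg _ _), ← ENNReal.ofReal_mul (by positivity)] at h1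
  refine (ENNReal.ofReal_le_ofReal_iff ?_).1 h1
  exact mul_nonneg (by positivity) (Finset.sum_nonneg fun i _ => setIntegral_sq_nonneg _ _)

/-- The Bramble–Hilbert lemma on convex sets. All derivatives of order below `k` of the difference
have mean zero, so each use of the Poincaré inequality gains `d ^ 2` and raises the order by one; at
order `k` the polynomial, of degree below `k`, has dropped out. The constant `2 ^ 20` exceeds `3 * 2
^ 18` and absorbs the sum over the three partial derivatives. -/
theorem exists_poly_approx {U : Set E3} (hU : IsOpen U) (hUc : Convex ℝ U)
    (hUb : Bornology.IsBounded U) (hU0 : volume U ≠ 0) {d : ℝ}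
    (hd : ∀ y ∈ U, ∀ z ∈ U, ‖z - y‖ ≤ d)
    {m : ℕ} {F : (Fin 3 → ℕ) → E3 → ℝ} (h : IsFam U m F) {k : ℕ} (hk1 : 1 ≤ k) (hk : k ≤ m) :
    ∃ q ∈ Poly (k - 1), ∀ α : Fin 3 → ℕ, ∑ i, α i ≤ k →
      ∫ x in U, (F α - multiDeriv α (polyEval q)) x ^ 2 ≤
        (2 ^ 20 * d ^ 2) ^ (k - ∑ i, α i) * levelEnergy U F k := by
  obtain ⟨q, hq, hq2⟩ := exists_poly_mean_zero hUb hU0 h hk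
  refine ⟨q, hq, ?_⟩
  have hH := h.sub_contDiff hUb (contDiff_polyEval q)
  have key : ∀ j ≤ k, ∀ α : Fin 3 → ℕ, ∑ i, α i + j = k →
      ∫ x in U, (F α - multiDeriv α (polyEval q)) x ^ 2 ≤
        (2 ^ 20 * d ^ 2) ^ j * levelEnergy U F k := by
    intro j
    induction j with
    | zero =>
      intro _ α hα
      rw [add_zero] at hα
      have e : F α - multiDeriv α (polyEval q) = F α := by
        rw [multiDeriv_polyEval, polyDeriv_eq_zero hq (by omega)]
        funext x; simp [polyEval]
      rw [e, pow_zero, one_mul, ← hα]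
      exact setIntegral_sq_le_levelEnergy U F α
    | succ j ih =>
      intro hj α hα
      have hp := (hH.isWeakGrad (α := α) (by omega)).poincare_real hU hUc hUb hd
        (hq2 α (by omega))
      refine hp.trans ?_
      have hs : ∑ i, ∫ x in U, (F (α + Pi.single i 1) -
          multiDeriv (α + Pi.single i 1) (polyEval q)) x ^ 2 ≤
          ∑ _i : Fin 3, (2 ^ 20 * d ^ 2) ^ j * levelEnergy U F k :=
        Finset.sum_le_sum fun i _ => ih (by omega) _ (by rw [sum_add_single]; omega)
      rw [Finset.sum_const, Finset.card_univ, Fintype.card_fin, nsmul_eq_mul] at hs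
      refine (mul_le_mul_of_nonneg_left hs (by positivity)).trans ?_
      have hT := levelEnergy_nonneg U F k
      rw [pow_succ' (2 ^ 20 * d ^ 2) j, mul_assoc (2 ^ 20 * d ^ 2)]
      have h0 : 0 ≤ (2 ^ 20 * d ^ 2) ^ j * levelEnergy U F k := by positivity
      generalize (2 ^ 20 * d ^ 2) ^ j * levelEnergy U F k = X at h0 ⊢
      have h1 : 0 ≤ d ^ 2 * X := by positivity
      push_cast
      nlinarith
  intro α hα
  exact key _ (by omega) α (by omega)

/-- A scaled embedding of `H²` in the continuous functions: `g x ^ 2 ≤ 2 * (g x - g y) ^ 2 + 2 * g y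
^ 2` is averaged over `y`, and the oscillation is bounded through the Hessian. The exponent `26` is
one more than the `25` of the oscillation bound. -/
theorem sq_le_of_isFam {U : Set E3} (hU : IsOpen U) (hUc : Convex ℝ U)
    (hUb : Bornology.IsBounded U) (hU0 : volume U ≠ 0) {d : ℝ}
    (hd : ∀ y ∈ U, ∀ z ∈ U, ‖z - y‖ ≤ d) {m : ℕ} (hm : 2 ≤ m) {F : (Fin 3 → ℕ) → E3 → ℝ}
    (h : IsFam U m F) {g : E3 → ℝ} (hg : ContinuousOn g U) (hgF : g =ᵐ[volume.restrict U] F 0)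
    {x : E3} (hx : x ∈ U) :
    g x ^ 2 ≤ 2 ^ 26 / volume.real U * ((∫ x in U, F 0 x ^ 2) + ∑ i, (d ^ 2 *
      (∫ x in U, F (Pi.single i 1) x ^ 2) +
      d ^ 4 * ∑ j, ∫ x in U, F (Pi.single i 1 + Pi.single j 1) x ^ 2)) := by
  have hUtop : volume U ≠ ⊤ := hUb.measure_lt_top.ne
  have hfin : IsFiniteMeasure (volume.restrict U) := ⟨by simpa using hUtop.lt_top⟩
  have hd0 : 0 ≤ d := (norm_nonneg _).trans (hd x hx x hx)
  set V := volume.real U with hV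
  have hV0 : 0 < V := ENNReal.toReal_pos hU0 hUtop
  set s := V ^ (1 / 6 : ℝ) with hs
  have hs0 : 0 < s := by positivity
  have hs6 : s ^ 6 = V := by
    rw [hs, ← Real.rpow_natCast, ← Real.rpow_mul hV0.le]; norm_num
  have hUv : volume U = ENNReal.ofReal (s ^ 6) := by
    rw [hs6, hV, ofReal_measureReal hUtop]
  have h1 : IsWeakGrad U (F 0) fun i => F (Pi.single i 1) := by
    have := h.isWeakGrad (α := 0) (by simp; omega)
    simpa only [zero_add] using this
  have h2 : ∀ i : Fin 3, IsWeakGrad U (F (Pi.single i 1)) fun j => F (Pi.single i 1 + Pi.single j 1) :=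
    fun i => h.isWeakGrad (by simp; omega)
  set S : ℝ := ∑ i, ((∫ x in U, F (Pi.single i 1) x ^ 2) +
    d ^ 2 * ∑ j, ∫ x in U, F (Pi.single i 1 + Pi.single j 1) x ^ 2) with hS
  have hS0 : 0 ≤ S := Finset.sum_nonneg fun i _ => add_nonneg (setIntegral_sq_nonneg _ _)
    (mul_nonneg (sq_nonneg _) (Finset.sum_nonneg fun j _ => setIntegral_sq_nonneg _ _))
  have hosc : ∀ y ∈ U, (g x - g y) ^ 2 ≤ 2 ^ 25 * d ^ 2 * S / V := by
    intro y hy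
    rw [← hs6]
    refine abs_sub_sq_le_of_hessian hU hUc hUb h1 h2 hg hgF hs0 hd hUv hS0 ?_ hx hy
    rw [hS, ENNReal.ofReal_sum_of_nonneg fun i _ => add_nonneg (setIntegral_sq_nonneg _ _)
      (mul_nonneg (sq_nonneg _) (Finset.sum_nonneg fun j _ => setIntegral_sq_nonneg _ _))]
    refine Finset.sum_le_sum fun i _ => le_of_eq ?_
    rw [ENNReal.ofReal_add (setIntegral_sq_nonneg _ _)
      (mul_nonneg (sq_nonneg _) (Finset.sum_nonneg fun j _ => setIntegral_sq_nonneg _ _)),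
      ENNReal.ofReal_mul (sq_nonneg _), ENNReal.ofReal_sum_of_nonneg
      fun j _ => setIntegral_sq_nonneg _ _, lintegral_enorm_sq (h2 i).1]
    congr 2
    exact Finset.sum_congr rfl fun j _ => lintegral_enorm_sq ((h2 i).2 j).1
  have hgm : MemLp g 2 (volume.restrict U) := (memLp_congr_ae hgF).2 h1.1
  have hI : ∫ y in U, g x ^ 2 ≤ ∫ y in U, (2 ^ 26 * d ^ 2 * S / V + 2 * g y ^ 2) := by
    refine setIntegral_mono_on (integrable_const _)
      ((integrable_const _).add (hgm.integrable_sq.const_mul 2)) hU.measurableSet fun y hy => ?_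
    have h3 := hosc y hy
    have e : 2 ^ 26 * d ^ 2 * S / V = 2 * (2 ^ 25 * d ^ 2 * S / V) := by ring
    rw [e]
    nlinarith [sq_nonneg (g x - 2 * g y)]
  rw [integral_add (integrable_const _) (hgm.integrable_sq.const_mul 2), setIntegral_const,
    setIntegral_const, integral_const_mul, smul_eq_mul, smul_eq_mul] at hI
  have hI2 : ∫ y in U, g y ^ 2 = ∫ y in U, F 0 y ^ 2 :=
    integral_congr_ae (hgF.mono fun y hy => by simp only [hy])
  rw [hI2, ← hV, mul_div_cancel₀ _ hV0.ne'] at hI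
  have e : ∑ i, (d ^ 2 * (∫ x in U, F (Pi.single i 1) x ^ 2) +
      d ^ 4 * ∑ j, ∫ x in U, F (Pi.single i 1 + Pi.single j 1) x ^ 2) = d ^ 2 * S := by
    rw [hS, Finset.mul_sum]
    refine Finset.sum_congr rfl fun i _ => ?_
    ring
  rw [e, div_mul_eq_mul_div, le_div_iff₀ hV0]
  have := setIntegral_sq_nonneg U (F 0)
  nlinarith

/-- One polynomial serves in `L²` and in the supremum norm. The last bound includes `k = 1`, where
the second derivatives needed for the supremum have order `k + 1` and are not reduced by the
approximation; this case occurs in the quadrature estimate for `m = 2`. -/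
theorem exists_poly_approx_sup {U : Set E3} (hU : IsOpen U) (hUc : Convex ℝ U)
    (hUb : Bornology.IsBounded U) (hU0 : volume U ≠ 0) {d : ℝ}
    (hd : ∀ y ∈ U, ∀ z ∈ U, ‖z - y‖ ≤ d) {m : ℕ} (hm : 2 ≤ m) {F : (Fin 3 → ℕ) → E3 → ℝ}
    (h : IsFam U m F) {g : E3 → ℝ} (hg : ContinuousOn g U) (hgF : g =ᵐ[volume.restrict U] F 0)
    {k : ℕ} (hk1 : 1 ≤ k) (hk : k ≤ m) :
    ∃ q ∈ Poly (k - 1), (∀ α : Fin 3 → ℕ, ∑ i, α i ≤ k →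
      ∫ x in U, (F α - multiDeriv α (polyEval q)) x ^ 2 ≤
        (2 ^ 20 * d ^ 2) ^ (k - ∑ i, α i) * levelEnergy U F k) ∧
      (2 ≤ k → ∀ x ∈ U, (g x - polyEval q x) ^ 2 ≤
        2 ^ (30 + 20 * k) / volume.real U * (d ^ (2 * k) * levelEnergy U F k)) ∧
      ∀ x ∈ U, (g x - polyEval q x) ^ 2 ≤ 2 ^ (30 + 20 * k) / volume.real U *
        (d ^ (2 * k) * levelEnergy U F k + d ^ (2 * (k + 1)) * levelEnergy U F (k + 1)) := by
  obtain ⟨q, hq, hq2⟩ := exists_poly_approx hU hUc hUb hU0 hd h hk1 hk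
  have hH := h.sub_contDiff hUb (contDiff_polyEval q)
  set H := fun α => F α - multiDeriv α (polyEval q) with hHdef
  set T := levelEnergy U F k with hT
  have hT0 : 0 ≤ T := levelEnergy_nonneg _ _ _
  have hV0 : 0 ≤ volume.real U := measureReal_nonneg
  have hsup : ∀ x ∈ U, (g x - polyEval q x) ^ 2 ≤ 2 ^ 26 / volume.real U *
      ((∫ x in U, H 0 x ^ 2) + ∑ i, (d ^ 2 * (∫ x in U, H (Pi.single i 1) x ^ 2) +
      d ^ 4 * ∑ j, ∫ x in U, H (Pi.single i 1 + Pi.single j 1) x ^ 2)) := by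
    intro x hx
    refine sq_le_of_isFam hU hUc hUb hU0 hd hm hH (g := fun x => g x - polyEval q x)
      (hg.sub (continuous_polyEval q).continuousOn) ?_ hx
    filter_upwards [hgF] with y hy
    simp only [hHdef, Pi.sub_apply, hy, multiDeriv_zero]
  have h0 : ∫ x in U, H 0 x ^ 2 ≤ (2 ^ 20 * d ^ 2) ^ k * T := by
    have := hq2 0 (by simp)
    simpa [hHdef] using this
  have h1 : ∀ i : Fin 3, ∫ x in U, H (Pi.single i 1) x ^ 2 ≤ (2 ^ 20 * d ^ 2) ^ (k - 1) * T := by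
    intro i
    have := hq2 (Pi.single i 1) (by simpa using hk1)
    simpa [hHdef] using this
  have e2 : ∀ i j : Fin 3, ∑ l, (Pi.single i 1 + Pi.single j 1 : Fin 3 → ℕ) l = 2 := by
    intro i j
    rw [sum_add_single]; simp
  have hmain : ∀ B : ℝ, (∀ i j : Fin 3, ∫ x in U, H (Pi.single i 1 + Pi.single j 1) x ^ 2 ≤ B) →
      ∀ x ∈ U, (g x - polyEval q x) ^ 2 ≤ 2 ^ 26 / volume.real U *
        ((2 ^ 20 * d ^ 2) ^ k * T + 3 * (d ^ 2 * ((2 ^ 20 * d ^ 2) ^ (k - 1) * T) +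
          d ^ 4 * (3 * B))) := by
    intro B hB x hx
    refine (hsup x hx).trans (mul_le_mul_of_nonneg_left ?_ (by positivity))
    refine add_le_add h0 ?_
    have h3 : ∀ i ∈ (Finset.univ : Finset (Fin 3)), d ^ 2 * (∫ x in U, H (Pi.single i 1) x ^ 2) +
        d ^ 4 * ∑ j, ∫ x in U, H (Pi.single i 1 + Pi.single j 1) x ^ 2 ≤
        d ^ 2 * ((2 ^ 20 * d ^ 2) ^ (k - 1) * T) + d ^ 4 * (3 * B) := by
      intro i _
      refine add_le_add (mul_le_mul_of_nonneg_left (h1 i) (by positivity))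
        (mul_le_mul_of_nonneg_left ?_ (by positivity))
      refine (Finset.sum_le_sum fun j _ => hB i j).trans (le_of_eq ?_)
      simp
    refine (Finset.sum_le_sum h3).trans (le_of_eq ?_)
    simp
    ring
  have hk2 : 2 ≤ k → ∀ x ∈ U, (g x - polyEval q x) ^ 2 ≤
        2 ^ (30 + 20 * k) / volume.real U * (d ^ (2 * k) * T) := by
    intro hk2 x hx
    refine (hmain ((2 ^ 20 * d ^ 2) ^ (k - 2) * T) (fun i j => ?_) x hx).trans ?_
    · have := hq2 (Pi.single i 1 + Pi.single j 1) (by rw [e2]; exact hk2)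
      rwa [e2] at this
    · obtain ⟨l, rfl⟩ := Nat.exists_eq_add_of_le hk2
      have e3 : 2 + l - 1 = l + 1 := by omega
      have e4 : 2 + l - 2 = l := by omega
      rw [e3, e4, div_mul_eq_mul_div, div_mul_eq_mul_div]
      refine div_le_div_of_nonneg_right ?_ hV0
      have hp : (0 : ℝ) ≤ (2 ^ 20) ^ l * (d ^ 2) ^ l * d ^ 4 * T := by positivity
      have e5 : (2 : ℝ) ^ (30 + 20 * (2 + l)) * (d ^ (2 * (2 + l)) * T) =
        2 ^ 70 * ((2 ^ 20) ^ l * (d ^ 2) ^ l * d ^ 4 * T) := by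
        rw [show (2 : ℝ) ^ (30 + 20 * (2 + l)) = 2 ^ 70 * (2 ^ 20) ^ l by
          rw [← pow_mul, ← pow_add]; congr 1; ring]
        ring
      have e6 : (2 : ℝ) ^ 26 * ((2 ^ 20 * d ^ 2) ^ (2 + l) * T + 3 * (d ^ 2 *
          ((2 ^ 20 * d ^ 2) ^ (l + 1) * T) + d ^ 4 * (3 * ((2 ^ 20 * d ^ 2) ^ l * T)))) =
        2 ^ 26 * (2 ^ 40 + 3 * 2 ^ 20 + 9) * ((2 ^ 20) ^ l * (d ^ 2) ^ l * d ^ 4 * T) := by ring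
      rw [e5, e6]
      exact mul_le_mul_of_nonneg_right (by norm_num) hp
  refine ⟨q, hq, hq2, hk2, fun x hx => ?_⟩
  have hT1 : 0 ≤ d ^ (2 * (k + 1)) * levelEnergy U F (k + 1) :=
    mul_nonneg (by rw [pow_mul]; positivity) (levelEnergy_nonneg _ _ _)
  rcases Nat.lt_or_ge k 2 with hlt | hge
  · obtain rfl : k = 1 := by omega
    refine (hmain (levelEnergy U F 2) (fun i j => ?_) x hx).trans ?_
    · have e : H (Pi.single i 1 + Pi.single j 1) = F (Pi.single i 1 + Pi.single j 1) := by
        rw [hHdef]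
        simp only
        rw [multiDeriv_polyEval, polyDeriv_eq_zero hq (by rw [e2]; norm_num)]
        funext x; simp [polyEval]
      have h8 := setIntegral_sq_le_levelEnergy U F (Pi.single i 1 + Pi.single j 1)
      rwa [e2, ← e] at h8
    · rw [div_mul_eq_mul_div, div_mul_eq_mul_div]
      refine div_le_div_of_nonneg_right ?_ hV0
      have h5 := levelEnergy_nonneg U F 2
      have h6 : 0 ≤ d ^ 2 * T := by positivity
      have h7 : 0 ≤ d ^ 4 * levelEnergy U F 2 := by positivity
      norm_num
      nlinarith
  · refine (hk2 hge x hx).trans (mul_le_mul_of_nonneg_left ?_ (by positivity))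
    linarith

end MassLump

namespace MassLump

open scoped ENNReal
open Filter Topology

/-! ### The reference tetrahedron -/

/-- Linear part of the barycentric coordinates. -/
noncomputable def baryLin (i : Fin 4) : E3 →L[ℝ] ℝ :=
  Fin.cases (-(EuclideanSpace.proj 0 + EuclideanSpace.proj 1 + EuclideanSpace.proj 2))
    (fun j => EuclideanSpace.proj j) i

/-- Barycentric coordinates with respect to the reference tetrahedron. -/
noncomputable def bary (i : Fin 4) (x : E3) : ℝ := (if i = 0 then 1 else 0) + baryLin i x

theorem bary_zero (x : E3) : bary 0 x = 1 - (x 0 + x 1 + x 2) := by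
  simp [bary, baryLin, sub_eq_add_neg]

theorem bary_succ (j : Fin 3) (x : E3) : bary j.succ x = x j := by
  simp [bary, baryLin, Fin.succ_ne_zero]

theorem bary_add (i : Fin 4) (x v : E3) : bary i (x + v) = bary i x + baryLin i v := by
  simp [bary, add_assoc]

theorem bary_sub (i : Fin 4) (x y : E3) : bary i x - bary i y = baryLin i (x - y) := by
  simp [bary]

theorem continuous_bary (i : Fin 4) : Continuous (bary i) := by
  unfold bary; fun_prop

theorem sum_bary (x : E3) : ∑ i, bary i x = 1 := by
  rw [Fin.sum_univ_succ, bary_zero]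
  simp only [bary_succ, Fin.sum_univ_three]
  ring

theorem refVertex_zero : refVertex 0 = 0 := rfl

theorem refVertex_succ (j : Fin 3) : refVertex j.succ = EuclideanSpace.single j 1 := rfl

theorem sum_bary_smul (x : E3) : ∑ i, bary i x • refVertex i = x := by
  rw [Fin.sum_univ_succ, refVertex_zero, smul_zero, zero_add]
  simp only [bary_succ, refVertex_succ]
  ext j
  fin_cases j <;> simp [Fin.sum_univ_three]

theorem bary_refVertex (i j : Fin 4) : bary i (refVertex j) = if i = j then 1 else 0 := by
  refine Fin.cases ?_ (fun i => ?_) i <;> refine Fin.cases ?_ (fun j => ?_) j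
  · simp [bary_zero, refVertex_zero]
  · rw [bary_zero, refVertex_succ]
    fin_cases j <;> simp
  · simp [bary_succ, refVertex_zero, Fin.succ_ne_zero]
  · rw [bary_succ, refVertex_succ]
    simp

theorem ext_bary {x y : E3} (h : ∀ i, bary i x = bary i y) : x = y := by
  rw [← sum_bary_smul x, ← sum_bary_smul y]
  simp only [h]

theorem bary_sum {ι : Type*} (s : Finset ι) (w : ι → ℝ) (hw : ∑ i ∈ s, w i = 1) (x : ι → E3)
    (k : Fin 4) : bary k (∑ i ∈ s, w i • x i) = ∑ i ∈ s, w i * bary k (x i) := by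
  simp only [bary, map_sum, map_smul, smul_eq_mul, mul_add, Finset.sum_add_distrib]
  rw [← Finset.sum_mul, hw, one_mul]

theorem convex_bary_nonneg (S : Set (Fin 4)) :
    Convex ℝ {x : E3 | (∀ i, 0 ≤ bary i x) ∧ ∀ i ∉ S, bary i x = 0} := by
  intro x hx y hy a b ha hb hab
  have key : ∀ i, bary i (a • x + b • y) = a * bary i x + b * bary i y := by
    intro i
    simp only [bary, map_add, map_smul, smul_eq_mul]
    linear_combination -(if i = 0 then (1 : ℝ) else 0) * hab
  refine ⟨fun i => ?_, fun i hi => ?_⟩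
  · rw [key]
    exact add_nonneg (mul_nonneg ha (hx.1 i)) (mul_nonneg hb (hy.1 i))
  · rw [key, hx.2 i hi, hy.2 i hi]; simp

theorem mem_convexHull_refVertex {S : Set (Fin 4)} {x : E3} :
    x ∈ convexHull ℝ (refVertex '' S) ↔ (∀ i, 0 ≤ bary i x) ∧ ∀ i ∉ S, bary i x = 0 := by
  constructor
  · intro hx
    refine convexHull_min ?_ (convex_bary_nonneg S) hx
    rintro _ ⟨j, hj, rfl⟩
    refine ⟨fun i => ?_, fun i hi => ?_⟩
    · rw [bary_refVertex]; split_ifs <;> norm_num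
    · rw [bary_refVertex, if_neg]
      rintro rfl
      exact hi hj
  · rintro ⟨h1, h2⟩
    classical
    rw [← sum_bary_smul x]
    have h3 : ∑ i, bary i x • refVertex i =
        ∑ i ∈ Finset.univ.filter (· ∈ S), bary i x • refVertex i := by
      rw [Finset.sum_filter]
      refine Finset.sum_congr rfl fun i _ => ?_
      split_ifs with hi
      · rfl
      · rw [h2 i hi, zero_smul]
    have h4 : ∑ i ∈ Finset.univ.filter (· ∈ S), bary i x = 1 := by
      rw [← sum_bary x, Finset.sum_filter]
      refine Finset.sum_congr rfl fun i _ => ?_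
      split_ifs with hi
      · rfl
      · rw [h2 i hi]
    rw [h3]
    refine (convex_convexHull ℝ _).sum_mem (fun i _ => h1 i) h4 fun i hi => ?_
    exact subset_convexHull ℝ _ ⟨i, (Finset.mem_filter.1 hi).2, rfl⟩

theorem mem_refTet {x : E3} : x ∈ refTet ↔ ∀ i, 0 ≤ bary i x := by
  unfold refTet
  rw [← image_univ, mem_convexHull_refVertex]
  simp

theorem mem_refFace {i : Fin 4} {x : E3} :
    x ∈ refFace i ↔ x ∈ refTet ∧ bary i x = 0 := by
  unfold refFace
  rw [mem_convexHull_refVertex, mem_refTet]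
  simp

theorem convex_refTet : Convex ℝ refTet := convex_convexHull ℝ _

theorem isCompact_refTet : IsCompact refTet := (finite_range refVertex).isCompact_convexHull ℝ

theorem interior_refTet_nonempty : (interior refTet).Nonempty := by
  have ho : IsOpen {x : E3 | ∀ i, 0 < bary i x} := by
    simp only [ofPred_forall]
    exact isOpen_iInter_of_finite fun i => isOpen_lt continuous_const (continuous_bary i)
  refine ⟨∑ i : Fin 4, (1 / 4 : ℝ) • refVertex i, interior_maximal (fun x hx => ?_) ho ?_⟩
  · exact mem_refTet.2 fun i => (hx i).le
  · intro k
    rw [bary_sum _ _ (by simp)]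
    simp [bary_refVertex]

theorem norm_sub_le_of_mem_refTet {x y : E3} (hx : x ∈ refTet) (hy : y ∈ refTet) :
    ‖x - y‖ ≤ 2 := by
  have hn : ∀ z ∈ refTet, ‖z‖ ≤ 1 := by
    intro z hz
    have hsub : refTet ⊆ Metric.closedBall 0 1 := by
      refine convexHull_min ?_ (convex_closedBall _ _)
      rintro _ ⟨j, rfl⟩
      refine Fin.cases ?_ (fun j => ?_) j
      · simp [refVertex_zero]
      · simp [refVertex_succ]
    simpa using hsub hz
  calc ‖x - y‖ ≤ ‖x‖ + ‖y‖ := norm_sub_le _ _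
    _ ≤ 2 := by linarith [hn x hx, hn y hy]

/-! ### Affine images of the reference tetrahedron -/

section AffineElement

variable (φ : E3 ≃ᵃ[ℝ] E3)

theorem affineEquiv_add (x v : E3) : φ (x + v) = φ x + φ.linear v := by
  have := φ.map_vadd x v
  rwa [vadd_eq_add, vadd_eq_add, add_comm v x, add_comm (φ.linear v)] at this

theorem affineEquiv_sub (x y : E3) : φ x - φ y = φ.linear (x - y) := by
  have := affineEquiv_add φ y (x - y)
  rw [add_sub_cancel] at this
  rw [this]; abel

theorem affineEquiv_eq (x : E3) : φ x = φ.linear x + φ 0 := by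
  have := affineEquiv_add φ 0 x
  rwa [zero_add, add_comm] at this

theorem continuous_affineEquiv : Continuous φ :=
  (φ : E3 →ᵃ[ℝ] E3).continuous_of_finiteDimensional

theorem interior_image_affineEquiv (S : Set E3) : interior (φ '' S) = φ '' interior S :=
  ((AffineEquiv.toContinuousAffineEquiv φ).toHomeomorph.image_interior S).symm

theorem convex_elt : Convex ℝ (φ '' refTet) := convex_refTet.affine_image (φ : E3 →ᵃ[ℝ] E3)

theorem isCompact_elt : IsCompact (φ '' refTet) :=
  isCompact_refTet.image (continuous_affineEquiv φ)

theorem interior_elt_nonempty : (interior (φ '' refTet)).Nonempty := by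
  rw [interior_image_affineEquiv]
  exact interior_refTet_nonempty.image _

theorem closure_interior_elt : closure (interior (φ '' refTet)) = φ '' refTet := by
  rw [(convex_elt φ).closure_interior_eq_closure_of_nonempty_interior (interior_elt_nonempty φ),
    (isCompact_elt φ).isClosed.closure_eq]

theorem isBounded_interior_elt : Bornology.IsBounded (interior (φ '' refTet)) :=
  (isCompact_elt φ).isBounded.subset interior_subset

theorem volume_interior_elt_ne_zero : volume (interior (φ '' refTet)) ≠ 0 :=
  (isOpen_interior.measure_pos volume (interior_elt_nonempty φ)).ne'

theorem interior_ae_eq_elt : (interior (φ '' refTet) : Set E3) =ᵐ[volume] φ '' refTet :=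
  interior_ae_eq_of_null_frontier ((convex_elt φ).addHaar_frontier volume)

theorem volume_real_interior_elt :
    volume.real (interior (φ '' refTet)) = volume.real (φ '' refTet) :=
  measureReal_congr (interior_ae_eq_elt φ)

theorem volume_real_elt_pos : 0 < volume.real (φ '' refTet) := by
  rw [← volume_real_interior_elt]
  exact ENNReal.toReal_pos (volume_interior_elt_ne_zero φ)
    (isBounded_interior_elt φ).measure_lt_top.ne

theorem volume_real_refTet_pos : 0 < volume.real refTet := by
  have := volume_real_elt_pos (AffineEquiv.refl ℝ E3)
  simpa using this

theorem setIntegral_elt (f : E3 → ℝ) : ∫ x in φ '' refTet, f x =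
    volume.real (φ '' refTet) / volume.real refTet * ∫ x in refTet, f (φ x) := by
  have hd : ∀ x ∈ refTet, HasFDerivWithinAt φ
      (LinearMap.toContinuousLinearMap (φ.linear : E3 →ₗ[ℝ] E3)) refTet x := by
    intro x _
    have h1 : (φ : E3 → E3) = fun x =>
        LinearMap.toContinuousLinearMap (φ.linear : E3 →ₗ[ℝ] E3) x + φ 0 :=
      funext (affineEquiv_eq φ)
    rw [h1]
    exact ((ContinuousLinearMap.hasFDerivAt _).add_const _).hasFDerivWithinAt
  have key := fun g : E3 → ℝ => integral_image_eq_integral_abs_det_fderiv_smul volume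
    isCompact_refTet.measurableSet hd φ.injective.injOn g
  have h1 := key fun _ => 1
  simp only [smul_eq_mul, mul_one, setIntegral_const] at h1
  rw [key f, h1, mul_div_cancel_left₀ _ volume_real_refTet_pos.ne']
  simp only [smul_eq_mul]
  rw [integral_const_mul]

/-- For `‖u‖ = r` the preimages of `z + u` and `z - u` lie in the reference tetrahedron, whose
diameter is at most `2`. -/
theorem norm_linear_symm_le {z : E3} {r : ℝ} (hr : 0 < r)
    (h : Metric.closedBall z r ⊆ φ '' refTet) (v : E3) : ‖φ.linear.symm v‖ ≤ ‖v‖ / r := by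
  rcases eq_or_ne v 0 with rfl | hv
  · simp
  have hv0 : 0 < ‖v‖ := norm_pos_iff.2 hv
  set u := (r / ‖v‖) • v with hu
  have hun : ‖u‖ = r := by
    rw [hu, norm_smul, Real.norm_of_nonneg (by positivity), div_mul_cancel₀ _ hv0.ne']
  obtain ⟨x, hx, hx'⟩ := h (show z + u ∈ Metric.closedBall z r by simp [hun])
  obtain ⟨y, hy, hy'⟩ := h (show z - u ∈ Metric.closedBall z r by simp [hun])
  have h1 : φ.linear (x - y) = (2 * (r / ‖v‖)) • v := by
    rw [← affineEquiv_sub, hx', hy', hu]; module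
  have h2 : x - y = (2 * (r / ‖v‖)) • φ.linear.symm v := by
    rw [← map_smul, ← h1]; simp
  have h3 := norm_sub_le_of_mem_refTet hx hy
  rw [h2, norm_smul, Real.norm_of_nonneg (by positivity)] at h3
  rw [le_div_iff₀ hr]
  have h4 : 2 * (r / ‖v‖) * ‖φ.linear.symm v‖ = 2 * (‖φ.linear.symm v‖ * r) / ‖v‖ := by ring
  rw [h4, div_le_iff₀ hv0] at h3
  linarith

end AffineElement

/-! ### Domains with Lipschitz boundary -/

/-- The point is reached from `x` by moving down in the third coordinate of the chart; a whole
neighbourhood of it lies below the graph. -/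
theorem exists_notMem_closure {Ω : Set E3} (hΩ : IsOpen Ω) (hL : HasLipschitzBoundary Ω) {x : E3}
    (hx : x ∈ frontier Ω) {ε : ℝ} (hε : 0 < ε) : ∃ y, dist y x < ε ∧ y ∉ closure Ω := by
  obtain ⟨A, r, K, γ, hr, hγ, h⟩ := hL x hx
  have hxΩ : x ∉ Ω := by
    rw [hΩ.frontier_eq] at hx
    exact hx.2
  have hxγ : A x 2 ≤ γ !₂[A x 0, A x 1] := by
    by_contra! hcon
    exact hxΩ ((h x (Metric.mem_ball_self hr)).2 hcon)
  set t := min ε r / 2 with ht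
  have ht0 : 0 < t := by positivity
  have htε : t < ε := by have := min_le_left ε r; linarith
  have htr : t < r := by have := min_le_right ε r; linarith
  set v : E3 := A.symm (EuclideanSpace.single 2 1) with hv
  have hvn : ‖v‖ = 1 := by rw [hv, A.symm.norm_map]; simp
  set y := x - t • v with hy
  have hyx : dist y x = t := by
    rw [hy, dist_eq_norm, sub_sub_cancel_left, norm_neg, norm_smul, hvn, mul_one,
      Real.norm_of_nonneg ht0.le]
  have hAy : ∀ i, A y i = A x i - t * (EuclideanSpace.single (2 : Fin 3) (1 : ℝ)) i := by
    intro i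
    rw [hy, map_sub, map_smul, hv, A.apply_symm_apply]
    simp
  have hylt : A y 2 < γ !₂[A y 0, A y 1] := by
    have h0 : A y 0 = A x 0 := by rw [hAy]; simp
    have h1 : A y 1 = A x 1 := by rw [hAy]; simp
    have h2 : A y 2 = A x 2 - t := by rw [hAy]; simp
    rw [h0, h1, h2]; linarith
  refine ⟨y, by rw [hyx]; exact htε, fun hcl => ?_⟩
  have hc1 : Continuous fun z : E3 => A z 2 := by fun_prop
  have hc2 : Continuous fun z : E3 => γ !₂[A z 0, A z 1] := by
    refine hγ.continuous.comp ?_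
    refine (PiLp.continuous_toLp 2 _).comp (continuous_pi fun i => ?_)
    fin_cases i
    · change Continuous fun z : E3 => A z 0
      fun_prop
    · change Continuous fun z : E3 => A z 1
      fun_prop
  have hn : {z : E3 | A z 2 < γ !₂[A z 0, A z 1]} ∩ Metric.ball x r ∈ 𝓝 y :=
    Filter.inter_mem ((isOpen_lt hc1 hc2).mem_nhds hylt)
      (Metric.isOpen_ball.mem_nhds (by rw [Metric.mem_ball, hyx]; exact htr))
  obtain ⟨z, ⟨hz1, hz2⟩, hz3⟩ := mem_closure_iff_nhds.1 hcl _ hn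
  exact absurd ((h z hz2).1 hz3) (not_lt.2 (le_of_lt hz1))

/-- A domain with Lipschitz boundary has no slits or punctures. The tessellation covers only the
closure of `Ω`, so this is what places the interiors of the elements in `Ω`. -/
theorem interior_closure_subset {Ω : Set E3} (hΩ : IsOpen Ω) (hL : HasLipschitzBoundary Ω) :
    interior (closure Ω) ⊆ Ω := by
  intro x hx
  by_contra hxΩ
  have hf : x ∈ frontier Ω := by
    rw [hΩ.frontier_eq]
    exact ⟨interior_subset hx, hxΩ⟩
  obtain ⟨ε, hε, hb⟩ := Metric.isOpen_iff.1 isOpen_interior x hx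
  obtain ⟨y, hy, hy'⟩ := exists_notMem_closure hΩ hL hf hε
  exact hy' (interior_subset (hb hy))

end MassLump

namespace MassLump

open scoped ENNReal
open Filter Topology

/-! ### Meshes -/

namespace TetMesh

variable {Ω : Set E3} (T : TetMesh Ω)

theorem elt_subset_closure (i : Fin T.n) : T.elt i ⊆ closure Ω := by
  rw [← T.covers]
  exact subset_iUnion (fun i => T.φ i '' refTet) i

theorem exists_mem_elt {x : E3} (hx : x ∈ closure Ω) : ∃ i, x ∈ T.elt i := by
  rw [← T.covers] at hx
  exact mem_iUnion.1 hx

theorem mem_elt_iff {i : Fin T.n} {y : E3} : y ∈ T.elt i ↔ (T.φ i).symm y ∈ refTet := by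
  constructor
  · rintro ⟨x, hx, rfl⟩
    simpa using hx
  · intro h
    exact ⟨_, h, by simp⟩

theorem interior_elt_subset (hΩ : IsOpen Ω) (hL : HasLipschitzBoundary Ω) (i : Fin T.n) :
    interior (T.elt i) ⊆ Ω :=
  (interior_mono (T.elt_subset_closure i)).trans (interior_closure_subset hΩ hL)

/-- The elements are convex, so their frontiers are null sets. -/
theorem ae_eq_iUnion (hΩ : IsOpen Ω) (hL : HasLipschitzBoundary Ω) :
    (⋃ i, interior (T.elt i) : Set E3) =ᵐ[volume] Ω := by
  have h1 : (⋃ i, interior (T.elt i) : Set E3) =ᵐ[volume] (⋃ i, T.elt i : Set E3) :=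
    Filter.EventuallyEq.countable_iUnion fun i => interior_ae_eq_elt (T.φ i)
  refine Filter.EventuallyLE.antisymm ?_ ?_
  · exact LE.le.eventuallyLE (iUnion_subset fun i => T.interior_elt_subset hΩ hL i)
  · refine EventuallyLE.trans (LE.le.eventuallyLE ?_) h1.symm.le
    exact subset_closure.trans (le_of_eq T.covers.symm)

theorem pairwise_disjoint : Pairwise (Function.onFun Disjoint fun i => interior (T.elt i)) :=
  fun i j hij => T.disjoint i j hij

theorem setIntegral_eq_sum (hΩ : IsOpen Ω) (hL : HasLipschitzBoundary Ω) {f : E3 → ℝ}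
    (hf : IntegrableOn f Ω) : ∫ x in Ω, f x = ∑ i, ∫ x in interior (T.elt i), f x := by
  rw [← setIntegral_congr_set (T.ae_eq_iUnion hΩ hL)]
  exact integral_iUnion_fintype (fun i => isOpen_interior.measurableSet) T.pairwise_disjoint
    fun i => hf.mono_set (T.interior_elt_subset hΩ hL i)

theorem setLIntegral_inter_eq_sum (hΩ : IsOpen Ω) (hL : HasLipschitzBoundary Ω) {A : Set E3}
    (hA : MeasurableSet A) (f : E3 → ℝ≥0∞) :
    ∫⁻ x in A ∩ Ω, f x = ∑ i, ∫⁻ x in A ∩ interior (T.elt i), f x := by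
  have h1 : (A ∩ ⋃ i, interior (T.elt i) : Set E3) =ᵐ[volume] (A ∩ Ω : Set E3) :=
    (ae_eq_refl A).inter (T.ae_eq_iUnion hΩ hL)
  rw [← setLIntegral_congr h1, inter_iUnion, lintegral_iUnion, tsum_fintype]
  · exact fun i => hA.inter isOpen_interior.measurableSet
  · exact fun i j hij => (T.disjoint i j hij).mono inter_subset_right inter_subset_right

theorem dist_le_diam {i : Fin T.n} {x y : E3} (hx : x ∈ T.elt i) (hy : y ∈ T.elt i) :
    ‖x - y‖ ≤ Metric.diam (T.elt i) := by
  rw [← dist_eq_norm]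
  exact Metric.dist_le_diam_of_mem (isCompact_elt (T.φ i)).isBounded hx hy

theorem diam_pos (i : Fin T.n) : 0 < Metric.diam (T.elt i) := by
  obtain ⟨x, hx, y, hy, hxy⟩ : (T.elt i).Nontrivial := by
    obtain ⟨x, hx⟩ := interior_elt_nonempty (T.φ i)
    refine (infinite_of_mem_nhds x (mem_interior_iff_mem_nhds.1 hx)).nontrivial
  exact (norm_pos_iff.2 (sub_ne_zero.2 hxy)).trans_le (T.dist_le_diam hx hy)

theorem size_nonneg : 0 ≤ T.size := Real.sInf_nonneg fun _ hd => hd.1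

theorem diam_le_size (hΩb : Bornology.IsBounded Ω) (i : Fin T.n) :
    Metric.diam (T.elt i) ≤ T.size := by
  refine le_csInf ?_ ?_
  · obtain ⟨r, hr⟩ := (Metric.isBounded_iff_subset_closedBall 0).1 hΩb.closure
    refine ⟨2 * max r 0, by positivity, fun j => ⟨0, (T.elt_subset_closure j).trans (hr.trans ?_)⟩⟩
    refine Metric.closedBall_subset_closedBall ?_
    rw [mul_div_cancel_left₀ _ two_ne_zero]
    exact le_max_left _ _
  · rintro d ⟨hd0, hd⟩
    obtain ⟨z, hz⟩ := hd i
    refine (Metric.diam_mono hz Metric.isBounded_closedBall).trans ?_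
    refine (Metric.diam_closedBall (by positivity)).trans (le_of_eq ?_)
    ring

theorem diam_le_diam (hΩb : Bornology.IsBounded Ω) (i : Fin T.n) :
    Metric.diam (T.elt i) ≤ Metric.diam (closure Ω) :=
  Metric.diam_mono (T.elt_subset_closure i) hΩb.closure

/-! ### Conformity -/

theorem affineEquiv_sum (φ : E3 ≃ᵃ[ℝ] E3) (w : Fin 4 → ℝ) (hw : ∑ k, w k = 1) (v : Fin 4 → E3) :
    φ (∑ k, w k • v k) = ∑ k, w k • φ (v k) := by
  rw [affineEquiv_eq, map_sum]
  have : ∀ k, w k • φ (v k) = w k • φ.linear (v k) + w k • φ 0 := fun k => by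
    rw [affineEquiv_eq φ (v k), smul_add]
  simp only [this, Finset.sum_add_distrib, ← Finset.sum_smul, hw, one_smul, map_smul]

theorem bary_symm_eq_zero {i j : Fin T.n} {y : E3} (hi : y ∈ T.elt i) (hj : y ∈ T.elt j)
    {k : Fin 4} (hk : T.φ i (refVertex k) ∉ T.φ j '' range refVertex) :
    bary k ((T.φ i).symm y) = 0 := by
  have h : y ∈ convexHull ℝ (T.φ i '' range refVertex ∩ T.φ j '' range refVertex) := by
    rw [← T.face_to_face]; exact ⟨hi, hj⟩
  have e : T.φ i '' range refVertex ∩ T.φ j '' range refVertex =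
      (T.φ i : E3 →ᵃ[ℝ] E3) '' (refVertex '' {l | T.φ i (refVertex l) ∈ T.φ j '' range refVertex}) := by
    ext x
    constructor
    · rintro ⟨⟨_, ⟨l, rfl⟩, rfl⟩, hx⟩
      exact ⟨_, ⟨l, hx, rfl⟩, rfl⟩
    · rintro ⟨_, ⟨l, hl, rfl⟩, rfl⟩
      exact ⟨⟨_, ⟨l, rfl⟩, rfl⟩, hl⟩
  rw [e, ← AffineMap.image_convexHull] at h
  obtain ⟨x, hx, rfl⟩ := h
  have := (mem_convexHull_refVertex.1 hx).2 k hk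
  simpa using this

/-- The hypothesis `h` places `z` in the smallest face of element `i` that contains `y`. All
vertices of that face are common to both elements, by the face-to-face condition. -/
theorem mem_elt_of_support {i j : Fin T.n} {y z : E3} (hi : y ∈ T.elt i) (hj : y ∈ T.elt j)
    (hz : z ∈ T.elt i)
    (h : ∀ k, bary k ((T.φ i).symm y) = 0 → bary k ((T.φ i).symm z) = 0) : z ∈ T.elt j := by
  set S : Set (Fin 4) := {l | T.φ i (refVertex l) ∈ T.φ j '' range refVertex} with hS
  have h1 : (T.φ i).symm z ∈ convexHull ℝ (refVertex '' S) :=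
    mem_convexHull_refVertex.2 ⟨mem_refTet.1 (T.mem_elt_iff.1 hz),
      fun k hk => h k (T.bary_symm_eq_zero hi hj hk)⟩
  have h2 : z ∈ (T.φ i : E3 →ᵃ[ℝ] E3) '' convexHull ℝ (refVertex '' S) := ⟨_, h1, by simp⟩
  rw [AffineMap.image_convexHull] at h2
  refine convexHull_min ?_ (convex_elt (T.φ j)) h2
  rintro _ ⟨_, ⟨l, hl, rfl⟩, rfl⟩
  obtain ⟨_, ⟨l', rfl⟩, hl'⟩ := hl
  exact ⟨_, subset_convexHull ℝ _ ⟨l', rfl⟩, hl'⟩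

end TetMesh

/-- The affine map that permutes the vertices of the reference tetrahedron. -/
noncomputable def permAff (π : Equiv.Perm (Fin 4)) : E3 →ᵃ[ℝ] E3 :=
  AffineMap.mk' (fun x => ∑ k, bary k x • refVertex (π k))
    (∑ k, (baryLin k : E3 →ₗ[ℝ] ℝ).smulRight (refVertex (π k))) 0 (by
      intro x
      have h : ∀ k, bary k x = baryLin k x + bary k 0 := fun k => by simp [bary, add_comm]
      simp [h, add_smul, Finset.sum_add_distrib])

theorem permAff_apply (π : Equiv.Perm (Fin 4)) (x : E3) :
    permAff π x = ∑ k, bary k x • refVertex (π k) := rfl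

theorem bary_permAff (π : Equiv.Perm (Fin 4)) (x : E3) (k : Fin 4) :
    bary (π k) (permAff π x) = bary k x := by
  rw [permAff_apply, bary_sum _ _ (sum_bary x)]
  simp [bary_refVertex]

theorem permAff_injective (π : Equiv.Perm (Fin 4)) : Function.Injective (permAff π) := by
  intro x y h
  refine ext_bary fun k => ?_
  rw [← bary_permAff π x, ← bary_permAff π y, h]

theorem permAff_mem_refTet (π : Equiv.Perm (Fin 4)) {x : E3} (hx : x ∈ refTet) :
    permAff π x ∈ refTet := by
  rw [mem_refTet] at hx ⊢
  intro k
  have := bary_permAff π x (π.symm k)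
  rw [π.apply_symm_apply] at this
  rw [this]; exact hx _

theorem permAff_image_refTet (π : Equiv.Perm (Fin 4)) : permAff π '' refTet = refTet := by
  refine Subset.antisymm (image_subset_iff.2 fun x hx => permAff_mem_refTet π hx) fun x hx => ?_
  refine ⟨permAff π.symm x, permAff_mem_refTet _ hx, ext_bary fun k => ?_⟩
  obtain ⟨l, rfl⟩ := π.surjective k
  rw [bary_permAff]
  have := bary_permAff π.symm x (π l)
  rwa [π.symm_apply_apply] at this

namespace TetMesh

variable {Ω : Set E3} (T : TetMesh Ω)

/-- The matching of the common vertices is an injection between sets of indices and extends to a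
permutation. How the other vertices are matched is irrelevant, as their barycentric coordinates
vanish on the intersection. -/
theorem exists_permAff (i j : Fin T.n) : ∃ π : Equiv.Perm (Fin 4), ∀ x ∈ refTet,
    T.φ i x ∈ T.elt j → T.φ j (permAff π x) = T.φ i x := by
  classical
  set I : Fin 4 → Prop := fun k => T.φ i (refVertex k) ∈ T.φ j '' range refVertex with hI
  have hf : ∀ k : {k // I k}, ∃ l, T.φ j (refVertex l) = T.φ i (refVertex k) := by
    rintro ⟨k, _, ⟨l, rfl⟩, hl⟩
    exact ⟨l, hl⟩
  choose f hf using hf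
  have hvinj : Function.Injective refVertex := by
    intro a b hab
    by_contra hne
    have h1 := bary_refVertex a b
    rw [← hab, bary_refVertex, if_pos rfl, if_neg hne] at h1
    exact one_ne_zero h1
  have hinj : Function.Injective f := by
    intro a b hab
    have : T.φ i (refVertex a) = T.φ i (refVertex b) := by rw [← hf a, ← hf b, hab]
    exact Subtype.ext (hvinj ((T.φ i).injective this))
  set e : {k // I k} ≃ {l // l ∈ range f} := Equiv.ofInjective f hinj with he
  refine ⟨e.extendSubtype, fun x hx hxj => ?_⟩
  have hx2 : T.φ i x ∈ T.elt i := ⟨x, hx, rfl⟩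
  have hz : ∀ k, ¬ I k → bary k x = 0 := fun k hk => by
    have := T.bary_symm_eq_zero hx2 hxj hk
    simpa using this
  rw [permAff_apply, affineEquiv_sum _ _ (sum_bary x)]
  conv_rhs => rw [← sum_bary_smul x, affineEquiv_sum _ _ (sum_bary x)]
  refine Finset.sum_congr rfl fun k _ => ?_
  by_cases hk : I k
  · rw [Equiv.extendSubtype_apply_of_mem _ _ hk]
    congr 1
    exact hf ⟨k, hk⟩
  · rw [hz k hk, zero_smul, zero_smul]

/-- The boundary of `Ω` is a union of faces. Suppose `z ∈ Ω` and take `z' ∈ Ω` on the segment from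
`z` to `y`, close to `z`. The elements that contain `z'` cover a neighbourhood of `z'`, and all of
them contain `y` as well, with no fewer positive barycentric coordinates there. Scaled down, the
covering becomes one of a neighbourhood of `y`, so `y` is interior to the closure of `Ω` and thus in
`Ω`. -/
theorem mem_frontier_of_support (hΩ : IsOpen Ω) (hL : HasLipschitzBoundary Ω) {i : Fin T.n}
    {y z : E3} (hy : y ∈ frontier Ω) (hyi : y ∈ T.elt i) (hzi : z ∈ T.elt i)
    (h : ∀ k, bary k ((T.φ i).symm y) = 0 → bary k ((T.φ i).symm z) = 0) : z ∈ frontier Ω := by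
  rw [hΩ.frontier_eq]
  refine ⟨T.elt_subset_closure i hzi, fun hzΩ => ?_⟩
  -- barycentric coordinates of points on the line through `y` and `z`
  have hb : ∀ (j : Fin T.n) (k : Fin 4) (t : ℝ) (a v : E3),
      bary k ((T.φ j).symm (a + t • v)) =
        bary k ((T.φ j).symm a) + t * baryLin k ((T.φ j).symm.linear v) := by
    intro j k t a v
    rw [affineEquiv_add, bary_add, map_smul, map_smul, smul_eq_mul]
  have hbs : ∀ (j : Fin T.n) (k : Fin 4) (a b : E3), baryLin k ((T.φ j).symm.linear (a - b)) =
      bary k ((T.φ j).symm a) - bary k ((T.φ j).symm b) := by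
    intro j k a b
    rw [bary_sub, affineEquiv_sub]
  have hnn : ∀ {j : Fin T.n} {a : E3}, a ∈ T.elt j → ∀ k, 0 ≤ bary k ((T.φ j).symm a) :=
    fun ha k => mem_refTet.1 (T.mem_elt_iff.1 ha) k
  have hle1 : ∀ {j : Fin T.n} {a : E3}, a ∈ T.elt j → ∀ k, bary k ((T.φ j).symm a) ≤ 1 := by
    intro j a ha k
    rw [← sum_bary ((T.φ j).symm a)]
    exact Finset.single_le_sum (f := fun k => bary k ((T.φ j).symm a)) (fun l _ => hnn ha l)
      (Finset.mem_univ k)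
  -- a small parameter below all positive barycentric coordinates of `y`
  obtain ⟨κ, hκ, hκ0⟩ : ∃ κ : ℝ, (∀ (j : Fin T.n) (k : Fin 4), 0 < bary k ((T.φ j).symm y) →
      κ < bary k ((T.φ j).symm y)) ∧ 0 < κ := by
    have h1 : ∀ᶠ κ : ℝ in 𝓝[>] 0, ∀ (j : Fin T.n) (k : Fin 4), 0 < bary k ((T.φ j).symm y) →
        κ < bary k ((T.φ j).symm y) := by
      refine eventually_all.2 fun j => eventually_all.2 fun k => ?_
      by_cases hp : 0 < bary k ((T.φ j).symm y)
      · exact ((eventually_lt_nhds hp).filter_mono nhdsWithin_le_nhds).mono fun κ h _ => h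
      · exact Eventually.of_forall fun κ h => absurd h hp
    exact (h1.and self_mem_nhdsWithin).exists
  -- This point continues the segment beyond `y`. In an element that contains it and `z`, a
  -- barycentric coordinate that vanishes at `y` must vanish at `z`, since `y` lies strictly between
  -- them.
  have hw : y + κ • (y - z) ∈ T.elt i := by
    rw [T.mem_elt_iff, mem_refTet]
    intro k
    rw [hb, hbs]
    rcases (hnn hyi k).eq_or_lt with h0 | h0
    · rw [← h0, h k h0.symm]; simp
    · nlinarith [hκ i k h0, hle1 hzi k]
  obtain ⟨η, hη, hη1, hη0⟩ : ∃ η : ℝ, z + η • (y - z) ∈ Ω ∧ η < 1 ∧ 0 < η := by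
    have h1 : Tendsto (fun η : ℝ => z + η • (y - z)) (𝓝[>] 0) (𝓝 (z + (0 : ℝ) • (y - z))) :=
      (Continuous.tendsto (by fun_prop) 0).mono_left nhdsWithin_le_nhds
    rw [zero_smul, add_zero] at h1
    have h2 := h1.eventually (hΩ.mem_nhds hzΩ)
    have h3 : ∀ᶠ η : ℝ in 𝓝[>] 0, η < 1 :=
      (eventually_lt_nhds one_pos).filter_mono nhdsWithin_le_nhds
    exact (h2.and (h3.and self_mem_nhdsWithin)).exists
  set z' := z + η • (y - z) with hz'
  have hz'i : z' ∈ T.elt i := (convex_elt (T.φ i)).add_smul_sub_mem hzi hyi ⟨hη0.le, hη1.le⟩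
  have hz'b : ∀ (j : Fin T.n) (k : Fin 4), bary k ((T.φ j).symm z') =
      (1 - η) * bary k ((T.φ j).symm z) + η * bary k ((T.φ j).symm y) := by
    intro j k
    rw [hz', hb, hbs]; ring
  have hstar : ∀ j, z' ∈ T.elt j → y ∈ T.elt j ∧
      ∀ k, bary k ((T.φ j).symm y) = 0 → bary k ((T.φ j).symm z') = 0 := by
    intro j hj
    have hyj : y ∈ T.elt j := by
      refine T.mem_elt_of_support hz'i hj hyi fun k hk => ?_
      rw [hz'b] at hk
      have h1 := mul_nonneg (by linarith : 0 ≤ 1 - η) (hnn hzi k)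
      have h2 := mul_nonneg hη0.le (hnn hyi k)
      have h3 : η * bary k ((T.φ i).symm y) = 0 := by linarith
      exact (mul_eq_zero.1 h3).resolve_left hη0.ne'
    have hzj : z ∈ T.elt j := T.mem_elt_of_support hyi hyj hzi h
    have hwj : y + κ • (y - z) ∈ T.elt j := by
      refine T.mem_elt_of_support hyi hyj hw fun k hk => ?_
      rw [hb, hbs, hk, h k hk]; simp
    refine ⟨hyj, fun k hk => ?_⟩
    have h1 := hnn hwj k
    rw [hb, hbs, hk] at h1
    have h2 := hnn hzj k
    have h3 : bary k ((T.φ j).symm z) = 0 := by nlinarith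
    rw [hz'b, hk, h3]; simp
  -- The elements are closed and finite in number, so near `z'` only those containing `z'` are met.
  have hnear : ∀ᶠ x in 𝓝 z', ∃ j, x ∈ T.elt j ∧ z' ∈ T.elt j := by
    have h1 : ∀ᶠ x in 𝓝 z', ∀ j, x ∈ T.elt j → z' ∈ T.elt j := by
      refine eventually_all.2 fun j => ?_
      by_cases hj : z' ∈ T.elt j
      · exact Eventually.of_forall fun _ _ => hj
      · filter_upwards [(isCompact_elt (T.φ j)).isClosed.isOpen_compl.mem_nhds hj] with x hx hx'
        exact absurd hx' hx
    filter_upwards [h1, hΩ.mem_nhds hη] with x hx hxΩ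
    obtain ⟨j, hj⟩ := T.exists_mem_elt (subset_closure hxΩ)
    exact ⟨j, hj, hx j hj⟩
  have hyint : y ∈ interior (closure Ω) := by
    rw [mem_interior_iff_mem_nhds]
    have hc : Tendsto (fun x => z' + κ⁻¹ • (x - y)) (𝓝 y) (𝓝 (z' + κ⁻¹ • (y - y))) :=
      Continuous.tendsto (by fun_prop) y
    rw [sub_self, smul_zero, add_zero] at hc
    -- The point `z' + κ⁻¹ • (x - y)` lies in some element `j` containing `z'`; then so does `x`.
    -- Coordinates positive at `y` exceed `κ` and stay positive, and those that vanish at `y` vanish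
    -- at `z'` too, so they are scaled from nonnegative values.
    filter_upwards [hc.eventually hnear] with x hx
    obtain ⟨j, hj, hj'⟩ := hx
    obtain ⟨hyj, hs⟩ := hstar j hj'
    refine T.elt_subset_closure j (T.mem_elt_iff.2 (mem_refTet.2 fun k => ?_))
    have e : x = y + κ • (κ⁻¹ • (x - y)) := by
      rw [smul_smul, mul_inv_cancel₀ hκ0.ne', one_smul]; abel
    have h1 := hnn hj k
    have h2 : bary k ((T.φ j).symm (z' + κ⁻¹ • (x - y))) =
        bary k ((T.φ j).symm z') + baryLin k ((T.φ j).symm.linear (κ⁻¹ • (x - y))) := by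
      have := hb j k 1 z' (κ⁻¹ • (x - y))
      rwa [one_smul, one_mul] at this
    rw [e, hb]
    rw [h2] at h1
    rcases (hnn hyj k).eq_or_lt with h0 | h0
    · rw [hs k h0.symm] at h1
      rw [← h0]
      have := mul_nonneg hκ0.le h1
      linarith
    · have h3 := hle1 hj' k
      have h4 := hκ j k h0
      nlinarith
  have := interior_closure_subset hΩ hL hyint
  rw [hΩ.frontier_eq] at hy
  exact hy.2 this

end TetMesh

end MassLump

namespace MassLump

open scoped ENNReal
open Filter Topology

/-! ### The norm of `H¹` -/

theorem l2Norm_sq {U : Set E3} {u : E3 → ℝ} (hu : MemLp u 2 (volume.restrict U)) :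
    l2Norm U u ^ 2 = ∫ x in U, u x ^ 2 := by
  have h0 : 0 ≤ ∫ x in U, u x ^ 2 := integral_nonneg fun x => sq_nonneg _
  have h1 : eLpNorm u 2 (volume.restrict U) ^ 2 = ENNReal.ofReal (∫ x in U, u x ^ 2) := by
    rw [← lintegral_enorm_sq hu, ← ENNReal.rpow_natCast, eLpNorm_eq_lintegral_rpow_enorm_toReal
      two_ne_zero ENNReal.ofNat_ne_top, ← ENNReal.rpow_mul]
    norm_num
  unfold l2Norm
  rw [← ENNReal.toReal_pow, h1, ENNReal.toReal_ofReal h0]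

theorem multiIndices_one : multiIndices 1 = {0, Pi.single 0 1, Pi.single 1 1, Pi.single 2 1} := by
  decide

theorem sum_multiIndices_one (f : (Fin 3 → ℕ) → ℝ) :
    ∑ α ∈ multiIndices 1, f α = f 0 + ∑ i, f (Pi.single i 1) := by
  rw [multiIndices_one, Finset.sum_insert (by decide), Finset.sum_insert (by decide),
    Finset.sum_insert (by decide), Finset.sum_singleton, Fin.sum_univ_three]
  ring

theorem weakDeriv_ae_eq {U : Set E3} (hU : IsOpen U) {α : Fin 3 → ℕ} {u g : E3 → ℝ}
    (h : IsWeakDeriv U α u g) : weakDeriv U α u =ᵐ[volume.restrict U] g :=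
  (isWeakDeriv_weakDeriv ⟨g, h⟩).unique hU h

theorem IsWeakGrad.memH {U : Set E3} {u : E3 → ℝ} {G : Fin 3 → E3 → ℝ} (h : IsWeakGrad U u G) :
    MemH U 1 u := by
  refine ⟨h.1, fun α hα => ?_⟩
  rw [← mem_multiIndices, multiIndices_one] at hα
  simp only [Finset.mem_insert, Finset.mem_singleton] at hα
  rcases hα with rfl | rfl | rfl | rfl
  exacts [⟨_, isWeakDeriv_zero h.1⟩, ⟨_, h.2 0⟩, ⟨_, h.2 1⟩, ⟨_, h.2 2⟩]

theorem MemH.isWeakGrad {U : Set E3} {u : E3 → ℝ} (h : MemH U 1 u) :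
    IsWeakGrad U u fun i => weakDeriv U (Pi.single i 1) u :=
  ⟨h.1, fun i => h.isWeakDeriv_single le_rfl i⟩

theorem IsWeakGrad.sobolevNorm_sq {U : Set E3} (hU : IsOpen U) {u : E3 → ℝ}
    {G : Fin 3 → E3 → ℝ} (h : IsWeakGrad U u G) :
    sobolevNorm U 1 u ^ 2 = (∫ x in U, u x ^ 2) + ∑ i, ∫ x in U, G i x ^ 2 := by
  have key : ∀ {α : Fin 3 → ℕ} {g : E3 → ℝ}, IsWeakDeriv U α u g →
      l2Norm U (weakDeriv U α u) ^ 2 = ∫ x in U, g x ^ 2 := by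
    intro α g hg
    rw [l2Norm, eLpNorm_congr_ae (weakDeriv_ae_eq hU hg), ← l2Norm, l2Norm_sq hg.1]
  unfold sobolevNorm
  rw [Real.sq_sqrt (Finset.sum_nonneg fun _ _ => sq_nonneg _), sum_multiIndices_one,
    key (isWeakDeriv_zero h.1)]
  simp only [key (h.2 _)]

theorem IsWeakGrad.add {U : Set E3} {u v : E3 → ℝ} {G H : Fin 3 → E3 → ℝ}
    (h : IsWeakGrad U u G) (h' : IsWeakGrad U v H) :
    IsWeakGrad U (u + v) fun i => G i + H i :=
  ⟨h.1.add h'.1, fun i => IsWeakDeriv.add h.1 h'.1 (h.2 i) (h'.2 i)⟩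

theorem IsWeakGrad.sub {U : Set E3} {u v : E3 → ℝ} {G H : Fin 3 → E3 → ℝ}
    (h : IsWeakGrad U u G) (h' : IsWeakGrad U v H) :
    IsWeakGrad U (u - v) fun i => G i - H i :=
  ⟨h.1.sub h'.1, fun i => IsWeakDeriv.sub h.1 h'.1 (h.2 i) (h'.2 i)⟩

theorem setIntegral_add_sq_le {U : Set E3} {f g : E3 → ℝ} (hf : MemLp f 2 (volume.restrict U))
    (hg : MemLp g 2 (volume.restrict U)) :
    ∫ x in U, (f x + g x) ^ 2 ≤ 2 * (∫ x in U, f x ^ 2) + 2 * ∫ x in U, g x ^ 2 := by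
  rw [← integral_const_mul, ← integral_const_mul,
    ← integral_add (hf.integrable_sq.const_mul 2) (hg.integrable_sq.const_mul 2)]
  refine integral_mono (hf.add hg).integrable_sq
    ((hf.integrable_sq.const_mul 2).add (hg.integrable_sq.const_mul 2)) fun x => ?_
  nlinarith [sq_nonneg (f x - g x)]

theorem IsWeakGrad.sobolevNorm_add_sq_le {U : Set E3} (hU : IsOpen U) {u v : E3 → ℝ}
    {G H : Fin 3 → E3 → ℝ} (h : IsWeakGrad U u G) (h' : IsWeakGrad U v H) :
    sobolevNorm U 1 (u + v) ^ 2 ≤ 2 * sobolevNorm U 1 u ^ 2 + 2 * sobolevNorm U 1 v ^ 2 := by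
  rw [h.sobolevNorm_sq hU, h'.sobolevNorm_sq hU, (h.add h').sobolevNorm_sq hU]
  have h1 := setIntegral_add_sq_le h.1 h'.1
  have h2 := Finset.sum_le_sum fun i (_ : i ∈ (Finset.univ : Finset (Fin 3))) =>
    setIntegral_add_sq_le (h.2 i).1 (h'.2 i).1
  rw [Finset.sum_add_distrib, ← Finset.mul_sum, ← Finset.mul_sum] at h2
  simp only [Pi.add_apply]
  linarith

theorem sobolevNorm_nonneg (U : Set E3) (k : ℕ) (u : E3 → ℝ) : 0 ≤ sobolevNorm U k u :=
  Real.sqrt_nonneg _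

theorem IsTestFun.isWeakGrad {U : Set E3} (hUb : Bornology.IsBounded U) {φ : E3 → ℝ}
    (h : IsTestFun U φ) : IsWeakGrad U φ fun i => MassLump.partialDeriv i φ :=
  ⟨h.memLp _, fun i => isWeakDeriv_of_contDiff hUb h.1 i⟩

theorem IsTestFun.memH10 {U : Set E3} (hU : IsOpen U) (hUb : Bornology.IsBounded U) {φ : E3 → ℝ}
    (h : IsTestFun U φ) : MemH10 U φ := by
  refine ⟨(h.isWeakGrad hUb).memH, fun ε hε => ⟨φ, h, ?_⟩⟩
  have h1 := ((h.isWeakGrad hUb).sub (h.isWeakGrad hUb)).sobolevNorm_sq hU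
  simp only [sub_self, Pi.zero_apply, ne_eq, OfNat.ofNat_ne_zero, not_false_eq_true, zero_pow,
    integral_zero, Finset.sum_const_zero, add_zero] at h1
  rw [sub_self, pow_eq_zero_iff two_ne_zero |>.1 h1]
  exact hε

theorem MemH10.of_approx {U : Set E3} (hU : IsOpen U) (hUb : Bornology.IsBounded U) {w : E3 → ℝ}
    (hw : MemH U 1 w) (h : ∀ ε > 0, ∃ f, MemH10 U f ∧ sobolevNorm U 1 (w - f) < ε) :
    MemH10 U w := by
  refine ⟨hw, fun ε hε => ?_⟩
  obtain ⟨f, hf, hwf⟩ := h (ε / 2) (by positivity)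
  obtain ⟨φ, hφ, hfφ⟩ := hf.2 (ε / 2) (by positivity)
  refine ⟨φ, hφ, ?_⟩
  have h1 := (hw.isWeakGrad.sub hf.1.isWeakGrad).sobolevNorm_add_sq_le hU
    (hf.1.isWeakGrad.sub (hφ.isWeakGrad hUb))
  rw [sub_add_sub_cancel] at h1
  refine lt_of_pow_lt_pow_left₀ 2 hε.le ?_
  have h2 := sobolevNorm_nonneg U 1 (w - f)
  have h3 := sobolevNorm_nonneg U 1 (f - φ)
  nlinarith

theorem MemH10.sub {U : Set E3} (hU : IsOpen U) (hUb : Bornology.IsBounded U) {u v : E3 → ℝ}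
    (hu : MemH10 U u) (hv : MemH10 U v) : MemH10 U (u - v) := by
  refine MemH10.of_approx hU hUb (hu.1.isWeakGrad.sub hv.1.isWeakGrad).memH fun ε hε => ?_
  obtain ⟨φ, hφ, h1⟩ := hu.2 (ε / 2) (by positivity)
  obtain ⟨ψ, hψ, h2⟩ := hv.2 (ε / 2) (by positivity)
  have hφψ : IsTestFun U (φ - ψ) := by
    refine ⟨hφ.1.sub hψ.1, hφ.2.1.sub hψ.2.1, ?_⟩
    exact (tsupport_sub φ ψ).trans (union_subset hφ.2.2 hψ.2.2)
  refine ⟨φ - ψ, hφψ.memH10 hU hUb, ?_⟩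
  have hg1 := hu.1.isWeakGrad.sub (hφ.isWeakGrad hUb)
  have hg2 := hv.1.isWeakGrad.sub (hψ.isWeakGrad hUb)
  have hg3 := (hψ.isWeakGrad hUb).sub hv.1.isWeakGrad
  have h3 := hg1.sobolevNorm_add_sq_le hU hg3
  have h4 : sobolevNorm U 1 (ψ - v) ^ 2 = sobolevNorm U 1 (v - ψ) ^ 2 := by
    rw [hg2.sobolevNorm_sq hU, hg3.sobolevNorm_sq hU]
    simp only [Pi.sub_apply, sub_sq_comm]
  have e : u - v - (φ - ψ) = u - φ + (ψ - v) := by abel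
  rw [e]
  rw [h4] at h3
  refine lt_of_pow_lt_pow_left₀ 2 hε.le ?_
  have h5 := sobolevNorm_nonneg U 1 (u - φ)
  have h6 := sobolevNorm_nonneg U 1 (v - ψ)
  nlinarith

/-- Convergence in `H¹` from bounded almost everywhere convergence. -/
theorem tendsto_sobolevNorm_sub {U : Set E3} (hU : IsOpen U) (hUb : Bornology.IsBounded U)
    {f : E3 → ℝ} {G : Fin 3 → E3 → ℝ} (hf : IsWeakGrad U f G) {fn : ℕ → E3 → ℝ}
    {Gn : ℕ → Fin 3 → E3 → ℝ} (hfn : ∀ n, IsWeakGrad U (fn n) (Gn n)) {B : ℝ}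
    (hfB : ∀ n, ∀ x ∈ U, |f x - fn n x| ≤ B) (hGB : ∀ n i, ∀ x ∈ U, |G i x - Gn n i x| ≤ B)
    (hlim : ∀ᵐ x ∂volume.restrict U, Tendsto (fun n => fn n x) atTop (𝓝 (f x)))
    (hlimG : ∀ i, ∀ᵐ x ∂volume.restrict U, Tendsto (fun n => Gn n i x) atTop (𝓝 (G i x))) :
    Tendsto (fun n => sobolevNorm U 1 (f - fn n)) atTop (𝓝 0) := by
  have hfin : IsFiniteMeasure (volume.restrict U) := ⟨by simpa using hUb.measure_lt_top⟩
  have key : ∀ {g : E3 → ℝ} {gn : ℕ → E3 → ℝ},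
      (∀ n, MemLp (g - gn n) 2 (volume.restrict U)) → (∀ n, ∀ x ∈ U, |g x - gn n x| ≤ B) →
      (∀ᵐ x ∂volume.restrict U, Tendsto (fun n => gn n x) atTop (𝓝 (g x))) →
      Tendsto (fun n => ∫ x in U, (g - gn n) x ^ 2) atTop (𝓝 0) := by
    intro g gn hm hb hl
    have := tendsto_integral_of_dominated_convergence (μ := volume.restrict U)
      (F := fun n x => (g - gn n) x ^ 2) (f := fun _ => 0) (fun _ => B ^ 2)
      (fun n => (hm n).integrable_sq.aestronglyMeasurable) (integrable_const _)
      (fun n => (ae_restrict_mem hU.measurableSet).mono fun x hx => by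
        rw [Real.norm_of_nonneg (sq_nonneg _), ← sq_abs]
        exact pow_le_pow_left₀ (abs_nonneg _) (hb n x hx) 2)
      (hl.mono fun x hx => by
        have h1 := (hx.const_sub (g x)).pow 2
        simpa using h1)
    simpa using this
  have hsq : Tendsto (fun n => sobolevNorm U 1 (f - fn n) ^ 2) atTop (𝓝 0) := by
    simp_rw [fun n => (hf.sub (hfn n)).sobolevNorm_sq hU]
    have h1 := key (fun n => hf.1.sub (hfn n).1) hfB hlim
    have h2 := tendsto_finsetSum (Finset.univ : Finset (Fin 3)) fun i _ =>
      key (fun n => (hf.2 i).1.sub ((hfn n).2 i).1) (fun n => hGB n i) (hlimG i)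
    simpa using h1.add h2
  have := hsq.sqrt
  simpa [Real.sqrt_sq (sobolevNorm_nonneg _ _ _)] using this

/-! ### Lipschitz functions -/

theorem abs_partialDeriv_le {K : NNReal} {w : E3 → ℝ} (hw : LipschitzWith K w) (i : Fin 3)
    (x : E3) : |partialDeriv i w x| ≤ K := by
  have h1 := norm_fderiv_le_of_lipschitz ℝ hw (x₀ := x)
  have h2 := (fderiv ℝ w x).le_opNorm (EuclideanSpace.single i 1)
  rw [PiLp.norm_single, norm_one, mul_one] at h2
  exact h2.trans h1

/-- By Rademacher's theorem the classical gradient exists almost everywhere, and integration by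
parts holds for Lipschitz functions. -/
theorem isWeakGrad_of_lipschitzWith {K : NNReal} {w : E3 → ℝ} (hw : LipschitzWith K w) {U : Set E3}
    (hU : MemLp w 2 (volume.restrict U))
    (hU' : ∀ i, MemLp (partialDeriv i w) 2 (volume.restrict U)) :
    IsWeakGrad U w fun i => partialDeriv i w := by
  refine ⟨hU, fun i => isWeakDeriv_single_iff.2 ⟨hU' i, fun φ hφ => ?_⟩⟩
  obtain ⟨L, hL⟩ := (hφ.1.of_le (m := 1) (by simp)).lipschitzWith_of_hasCompactSupport hφ.2.1
    one_ne_zero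
  have h1 := hw.integral_lineDeriv_mul_eq (μ := volume) hL hφ.2.1 (EuclideanSpace.single i 1)
  have h2 : ∫ x, lineDeriv ℝ w x (EuclideanSpace.single i 1) * φ x =
      ∫ x, partialDeriv i w x * φ x := by
    refine integral_congr_ae (hw.ae_differentiableAt.mono fun x hx => ?_)
    simp only [hx.lineDeriv_eq_fderiv, partialDeriv]
  have h3 : ∀ x, lineDeriv ℝ φ x (-EuclideanSpace.single i 1) * w x =
      - (w x * partialDeriv i φ x) := by
    intro x
    rw [((hφ.1.differentiable (by simp)) x).lineDeriv_eq_fderiv, map_neg, neg_mul, mul_comm]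
    rfl
  rw [h2, integral_congr_ae (Eventually.of_forall h3), integral_neg] at h1
  have e1 := setIntegral_testFun_eq MeasurableSet.univ (subset_univ U) (hφ.partialDeriv i) w
  have e2 := setIntegral_testFun_eq MeasurableSet.univ (subset_univ U) hφ (partialDeriv i w)
  rw [Measure.restrict_univ] at e1 e2
  rw [← e1, ← e2, h1, neg_neg]

theorem aestronglyMeasurable_partialDeriv (w : E3 → ℝ) (i : Fin 3) (μ : Measure E3) :
    AEStronglyMeasurable (partialDeriv i w) μ :=
  (measurable_fderiv_apply_const ℝ w _).aestronglyMeasurable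

theorem LipschitzWith.isWeakGrad_of_isBounded {K : NNReal} {w : E3 → ℝ} (hw : LipschitzWith K w)
    {U : Set E3} (hU : Bornology.IsBounded U) : IsWeakGrad U w fun i => partialDeriv i w := by
  have hfin : IsFiniteMeasure (volume.restrict U) := ⟨by simpa using hU.measure_lt_top⟩
  refine isWeakGrad_of_lipschitzWith hw (hw.continuous.memLp_restrict_of_isBounded hU) fun i => ?_
  exact MemLp.of_bound (aestronglyMeasurable_partialDeriv w i _) K
    (Eventually.of_forall fun x => abs_partialDeriv_le hw i x)

theorem abs_moll_le (n : ℕ) {g : E3 → ℝ} {B : ℝ} (hg : ∀ x, |g x| ≤ B) (x : E3) :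
    |moll n g x| ≤ B := by
  rw [moll_eq, ← Real.norm_eq_abs]
  have hi : Integrable (mollKer n) := (mollBump n).integrable_normed
  refine (norm_integral_le_of_norm_le (hi.mul_const B) (Eventually.of_forall fun t => ?_)).trans
    (le_of_eq ?_)
  · rw [norm_mul, Real.norm_of_nonneg (mollKer_nonneg n t)]
    exact mul_le_mul_of_nonneg_left (hg _) (mollKer_nonneg n t)
  · rw [integral_mul_const, integral_mollKer, one_mul]

theorem eventually_isTestFun_moll {U : Set E3} (hU : IsOpen U) {w : E3 → ℝ} (hw : Continuous w)
    (hc : HasCompactSupport w) (hs : tsupport w ⊆ U) :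
    ∀ᶠ n in atTop, IsTestFun U (moll n w) := by
  obtain ⟨δ, hδ, h⟩ := hc.isCompact.exists_cthickening_subset_open hU hs
  filter_upwards [(tendsto_one_div_add_atTop_nhds_zero_nat (𝕜 := ℝ)).eventually_lt_const hδ]
    with n hn
  have hsupp : Function.support (moll n w) ⊆ Metric.cthickening δ (tsupport w) := by
    intro x hx
    by_contra hcon
    refine hx (integral_eq_zero_of_ae (Eventually.of_forall fun y => ?_))
    by_contra hne
    have h1 : mollKer n (x - y) ≠ 0 := left_ne_zero_of_mul hne
    have h2 : w y ≠ 0 := right_ne_zero_of_mul hne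
    have h3 : x - y ∈ Metric.closedBall (0 : E3) (1 / (n + 1)) := by
      rw [← tsupport_mollKer]; exact subset_tsupport _ h1
    refine hcon (Metric.mem_cthickening_of_dist_le x y δ _ (subset_tsupport _ h2) ?_)
    rw [dist_eq_norm, ← mem_closedBall_zero_iff]
    exact Metric.closedBall_subset_closedBall hn.le h3
  have hts : tsupport (moll n w) ⊆ Metric.cthickening δ (tsupport w) :=
    closure_minimal hsupp Metric.isClosed_cthickening
  exact ⟨contDiff_moll n hw.locallyIntegrable,
    (hc.isCompact.cthickening).of_isClosed_subset (isClosed_tsupport _) hts, hts.trans h⟩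

/-- The mollifications are eventually test functions in `U`. They and their gradients are uniformly
bounded and converge almost everywhere. -/
theorem memH10_of_hasCompactSupport {U : Set E3} (hU : IsOpen U) (hUb : Bornology.IsBounded U)
    {K : NNReal} {w : E3 → ℝ} (hw : LipschitzWith K w) (hc : HasCompactSupport w)
    (hs : tsupport w ⊆ U) : MemH10 U w := by
  obtain ⟨B, hB⟩ := hc.exists_bound_of_continuous hw.continuous
  have hB0 : 0 ≤ B := (norm_nonneg _).trans (hB 0)
  have hcd : ∀ i, HasCompactSupport (partialDeriv i w) := fun i =>
    hc.fderiv_apply (𝕜 := ℝ) (EuclideanSpace.single i 1)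
  have hbd : IsWeakGrad univ w fun i => partialDeriv i w := by
    refine isWeakGrad_of_lipschitzWith hw (hw.continuous.memLp_of_hasCompactSupport hc) fun i => ?_
    rw [Measure.restrict_univ]
    have h1 : MemLp (partialDeriv i w) ⊤ volume :=
      memLp_top_of_bound (aestronglyMeasurable_partialDeriv w i _) K
        (Eventually.of_forall fun x => abs_partialDeriv_le hw i x)
    refine h1.mono_exponent_of_measure_support_ne_top (s := tsupport (partialDeriv i w))
      (fun x hx => image_eq_zero_of_notMem_tsupport hx) (hcd i).isCompact.measure_lt_top.ne le_top
  have hloc : ∀ i, LocallyIntegrable (partialDeriv i w) := fun i => by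
    have := (hbd.2 i).1
    rw [Measure.restrict_univ] at this
    exact this.locallyIntegrable one_le_two
  have hmd : ∀ n i, partialDeriv i (moll n w) = moll n (partialDeriv i w) := by
    intro n i
    funext x
    have := partialDeriv_moll_indicator isOpen_univ hbd.1 (hbd.2 i) (n := n) (subset_univ
      (Metric.closedBall x (1 / (n + 1))))
    rwa [indicator_univ, indicator_univ] at this
  have hlim := tendsto_sobolevNorm_sub hU hUb (f := w) (fn := fun n => moll n w) (B := 2 * (B + K))
    (LipschitzWith.isWeakGrad_of_isBounded hw hUb)
    (fun n => ⟨(contDiff_moll n hw.continuous.locallyIntegrable).continuous.memLp_restrict_of_isBounded hUb,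
      fun i => isWeakDeriv_of_contDiff hUb (contDiff_moll n hw.continuous.locallyIntegrable) i⟩)
    (fun n x _ => by
      have h1 := abs_sub (w x) (moll n w x)
      have h2 := hB x
      have h3 := abs_moll_le n hB x
      rw [Real.norm_eq_abs] at h2
      have := K.2
      linarith)
    (fun n i x _ => by
      have h1 := abs_sub (partialDeriv i w x) (partialDeriv i (moll n w) x)
      have h2 := abs_partialDeriv_le hw i x
      have h3 := abs_moll_le n (fun x => abs_partialDeriv_le hw i x) x
      rw [← hmd] at h3
      linarith)
    (ae_restrict_of_ae (ae_tendsto_moll hw.continuous.locallyIntegrable))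
    (fun i => by
      simp_rw [hmd]
      exact ae_restrict_of_ae (ae_tendsto_moll (hloc i)))
  refine ⟨(LipschitzWith.isWeakGrad_of_isBounded hw hUb).memH, fun ε hε => ?_⟩
  obtain ⟨n, h1, h2⟩ := ((eventually_isTestFun_moll hU hw.continuous hc hs).and
    (hlim.eventually_lt_const hε)).exists
  exact ⟨_, h1, h2⟩

/-- The function `t ↦ t - max (-ε) (min t ε)`, which vanishes for `|t| ≤ ε`. -/
noncomputable def cutoff (ε t : ℝ) : ℝ := t - max (-ε) (min t ε)

theorem lipschitzWith_cutoff (ε : ℝ) : LipschitzWith 2 (cutoff ε) := by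
  have h : LipschitzWith 1 fun t : ℝ => max (-ε) (min t ε) :=
    (LipschitzWith.id.min_const ε).const_max (-ε)
  have := LipschitzWith.id.sub h
  rwa [one_add_one_eq_two] at this

theorem cutoff_eq_zero {ε t : ℝ} (h : |t| ≤ ε) : cutoff ε t = 0 := by
  obtain ⟨h1, h2⟩ := abs_le.1 h
  rw [cutoff, min_eq_left h2, max_eq_right h1, sub_self]

theorem cutoff_eq_sub {ε t : ℝ} (hε : 0 ≤ ε) (h : ε ≤ t) : cutoff ε t = t - ε := by
  rw [cutoff, min_eq_right h, max_eq_right (by linarith)]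

theorem cutoff_eq_add {ε t : ℝ} (hε : 0 ≤ ε) (h : t ≤ -ε) : cutoff ε t = t + ε := by
  rw [cutoff, min_eq_left (by linarith), max_eq_left h, sub_neg_eq_add]

theorem abs_sub_cutoff_le {ε t : ℝ} (hε : 0 ≤ ε) : |t - cutoff ε t| ≤ ε := by
  rw [cutoff, sub_sub_cancel, abs_le]
  exact ⟨le_max_left _ _, max_le (by linarith) (min_le_right _ _)⟩

/-- A zero of `w` is a minimum of `|w|`, so the derivative of `|w|` vanishes there; the remainder
estimates for `|w|` and `w` are then the same. -/
theorem hasFDerivAt_zero_of_abs {w : E3 → ℝ} {x : E3} (hx : w x = 0)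
    (h : DifferentiableAt ℝ (fun y => |w y|) x) : HasFDerivAt w (0 : E3 →L[ℝ] ℝ) x := by
  have hmin : IsLocalMin (fun y => |w y|) x := Eventually.of_forall fun y => by
    simp [hx]
  have h1 := h.hasFDerivAt
  rw [hmin.fderiv_eq_zero] at h1
  rw [hasFDerivAt_iff_isLittleO_nhds_zero] at h1 ⊢
  simp only [hx, abs_zero, sub_zero, _root_.zero_apply] at h1 ⊢
  simpa using h1

/-- Where `w x ≠ 0`, the truncation differs from `w` by a constant near `x` once `ε n < |w x|`. At a
zero of `w` the truncation vanishes nearby, and `w` has zero gradient wherever `|w|` is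
differentiable, which by Rademacher's theorem is almost everywhere. -/
theorem ae_eventually_partialDeriv_cutoff {K : NNReal} {w : E3 → ℝ} (hw : LipschitzWith K w)
    {ε : ℕ → ℝ} (hε0 : ∀ n, 0 < ε n) (hε : Tendsto ε atTop (𝓝 0)) :
    ∀ᵐ x, ∀ᶠ n in atTop, ∀ i, partialDeriv i (fun y => cutoff (ε n) (w y)) x =
      partialDeriv i w x := by
  have hwa : LipschitzWith K fun y => |w y| := by
    have := lipschitzWith_one_norm.comp hw
    simpa [Function.comp_def] using this
  filter_upwards [hwa.ae_differentiableAt] with x hx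
  have hcont := hw.continuous.continuousAt (x := x)
  rcases lt_trichotomy (w x) 0 with h | h | h
  · filter_upwards [hε.eventually_lt_const (neg_pos.2 h)] with n hn i
    have : (fun y => cutoff (ε n) (w y)) =ᶠ[𝓝 x] fun y => w y + ε n := by
      filter_upwards [hcont.eventually_lt_const (show w x < -ε n by linarith)] with y hy
      exact cutoff_eq_add (hε0 n).le hy.le
    rw [partialDeriv, this.fderiv_eq, fderiv_add_const, partialDeriv]
  · refine Eventually.of_forall fun n i => ?_
    have : (fun y => cutoff (ε n) (w y)) =ᶠ[𝓝 x] fun y => 0 := by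
      have h1 : ContinuousAt (fun y => |w y|) x := hcont.abs
      filter_upwards [h1.eventually_lt_const (show |w x| < ε n by simpa [h] using hε0 n)] with y hy
      exact cutoff_eq_zero hy.le
    rw [partialDeriv, this.fderiv_eq, partialDeriv, (hasFDerivAt_zero_of_abs h hx).fderiv]
    simp
  · filter_upwards [hε.eventually_lt_const h] with n hn i
    have : (fun y => cutoff (ε n) (w y)) =ᶠ[𝓝 x] fun y => w y - ε n := by
      filter_upwards [hcont.eventually_const_lt (show ε n < w x by linarith)] with y hy
      exact cutoff_eq_sub (hε0 n).le hy.le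
    rw [partialDeriv, this.fderiv_eq, fderiv_sub_const, partialDeriv]

/-- A Lipschitz function that vanishes outside a bounded open set `U` belongs to `H₀¹(U)`. -/
theorem memH10_of_lipschitzWith {U : Set E3} (hU : IsOpen U) (hUb : Bornology.IsBounded U)
    {K : NNReal} {w : E3 → ℝ} (hw : LipschitzWith K w) (hz : ∀ x ∉ U, w x = 0) : MemH10 U w := by
  set ε : ℕ → ℝ := fun n => 1 / ((n : ℝ) + 1) with hε
  have hε0 : ∀ n, 0 < ε n := fun n => by positivity
  have hε1 : ∀ n, ε n ≤ 1 := fun n => by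
    rw [hε]; simp only; rw [div_le_one (by positivity)]; simp
  have hεlim : Tendsto ε atTop (𝓝 0) := tendsto_one_div_add_atTop_nhds_zero_nat
  have hL : ∀ n, LipschitzWith (2 * K) fun y => cutoff (ε n) (w y) := fun n =>
    (lipschitzWith_cutoff _).comp hw
  -- The set where `|w| ≥ ε n` is closed and misses the complement of `U`; thus truncation produces
  -- compact support inside `U`.
  have hts : ∀ n, tsupport (fun y => cutoff (ε n) (w y)) ⊆ {x | ε n ≤ |w x|} := by
    intro n
    refine closure_minimal (fun x hx => ?_) (isClosed_le continuous_const hw.continuous.abs)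
    by_contra hcon
    exact hx (cutoff_eq_zero (not_le.1 hcon).le)
  have htU : ∀ n, tsupport (fun y => cutoff (ε n) (w y)) ⊆ U := by
    intro n x hx
    by_contra hxU
    have h1 := hts n hx
    simp only [mem_ofPred_eq, hz x hxU, abs_zero] at h1
    linarith [hε0 n]
  have hmem : ∀ n, MemH10 U fun y => cutoff (ε n) (w y) := fun n =>
    memH10_of_hasCompactSupport hU hUb (hL n)
      (Metric.isCompact_of_isClosed_isBounded (isClosed_tsupport _) (hUb.subset (htU n))) (htU n)
  have hwG := LipschitzWith.isWeakGrad_of_isBounded hw hUb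
  have hlim := tendsto_sobolevNorm_sub hU hUb hwG (fn := fun n y => cutoff (ε n) (w y))
    (B := 1 + 3 * K) (fun n => LipschitzWith.isWeakGrad_of_isBounded (hL n) hUb)
    (fun n x _ => by
      have := abs_sub_cutoff_le (t := w x) (hε0 n).le
      have := hε1 n
      have := K.2
      simp only [NNReal.val_eq_coe] at this
      linarith)
    (fun n i x _ => by
      have h1 := abs_sub (partialDeriv i w x) (partialDeriv i (fun y => cutoff (ε n) (w y)) x)
      have h2 := abs_partialDeriv_le hw i x
      have h3 := abs_partialDeriv_le (hL n) i x
      push_cast at h3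
      linarith)
    (ae_of_all _ fun x => by
      rw [tendsto_iff_norm_sub_tendsto_zero]
      refine squeeze_zero (fun _ => norm_nonneg _) (fun n => ?_) hεlim
      rw [norm_sub_rev]
      exact abs_sub_cutoff_le (hε0 n).le)
    (fun i => ae_restrict_of_ae ((ae_eventually_partialDeriv_cutoff hw hε0 hεlim).mono fun x hx =>
      tendsto_const_nhds.congr' (hx.mono fun n hn => (hn i).symm)))
  refine MemH10.of_approx hU hUb hwG.memH fun δ hδ => ?_
  obtain ⟨n, hn⟩ := (hlim.eventually_lt_const hδ).exists
  exact ⟨_, hmem n, hn⟩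

end MassLump

namespace MassLump

open scoped ENNReal
open Filter Topology

/-! ### Gluing Lipschitz functions -/

theorem continuous_of_closed_cover {ι : Type*} [Finite ι] {S : ι → Set E3}
    (hS : ∀ i, IsClosed (S i)) (hcov : ⋃ i, S i = univ) {f : E3 → ℝ}
    (hf : ∀ i, ContinuousOn f (S i)) : Continuous f :=
  (locallyFinite_of_finite S).continuous hcov hS hf

/-- The bound propagates along the segment from `x` to `y`. Close to a point of the segment only
pieces that contain this point occur, as they are closed and finite in number, and the Lipschitz
bound on such a piece carries the estimate further. The pieces need not be convex, which matters for
the complement of `Ω`. -/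
theorem lipschitzWith_of_closed_cover {ι : Type*} [Finite ι] {S : ι → Set E3}
    (hS : ∀ i, IsClosed (S i)) (hcov : ⋃ i, S i = univ) {f : E3 → ℝ} {K : NNReal}
    (hf : ∀ i, LipschitzOnWith K f (S i)) : LipschitzWith K f := by
  have hc : Continuous f := continuous_of_closed_cover hS hcov fun i => (hf i).continuousOn
  refine LipschitzWith.of_dist_le_mul fun x y => ?_
  set γ : ℝ → E3 := fun t => x + t • (y - x) with hγ
  have hγc : Continuous γ := by fun_prop
  have hγd : ∀ s t, dist (γ s) (γ t) = |s - t| * dist x y := by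
    intro s t
    rw [hγ, dist_eq_norm, dist_eq_norm, add_sub_add_left_eq_sub, ← sub_smul, norm_smul,
      Real.norm_eq_abs, norm_sub_rev x y]
  set A : Set ℝ := {t | dist (f (γ 0)) (f (γ t)) ≤ K * (t * dist x y)} with hA
  have hAc : IsClosed A := isClosed_le (by fun_prop) (by fun_prop)
  have hsub : Icc (0 : ℝ) 1 ⊆ A := by
    refine (hAc.inter isClosed_Icc).Icc_subset_of_forall_mem_nhdsWithin (by simp [hA]) ?_
    rintro t ⟨htA, ht⟩
    have hnear : ∀ᶠ s in 𝓝 t, ∀ i, γ s ∈ S i → γ t ∈ S i := by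
      rw [eventually_all]
      intro i
      by_cases hi : γ t ∈ S i
      · exact Eventually.of_forall fun _ _ => hi
      · filter_upwards [hγc.continuousAt.eventually_mem ((hS i).isOpen_compl.mem_nhds hi)]
          with s hs hs'
        exact absurd hs' hs
    filter_upwards [nhdsWithin_le_nhds hnear, self_mem_nhdsWithin] with s hs hts
    have hsS : γ s ∈ ⋃ i, S i := hcov ▸ mem_univ _
    obtain ⟨i, hi⟩ := mem_iUnion.1 hsS
    have h1 := (hf i).dist_le_mul _ (hs i hi) _ hi
    rw [hγd, abs_sub_comm, abs_of_pos (sub_pos.2 hts)] at h1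
    have h2 : dist (f (γ 0)) (f (γ t)) ≤ K * (t * dist x y) := htA
    have h3 := dist_triangle (f (γ 0)) (f (γ t)) (f (γ s))
    change dist (f (γ 0)) (f (γ s)) ≤ K * (s * dist x y)
    nlinarith
  have h1 : dist (f (γ 0)) (f (γ 1)) ≤ K * (1 * dist x y) := hsub ⟨zero_le_one, le_rfl⟩
  simpa [hγ] using h1

/-! ### Nodal interpolation -/

namespace RefElement

variable {p : ℕ} (R : RefElement p)

/-- The element of the reference space with given values at the nodes. -/
noncomputable def interpPoly (g : E3 → ℝ) : MvPolynomial (Fin 3) ℝ :=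
  ∑ x ∈ R.nodes, g x • R.basis x

theorem basis_mem {x : E3} (hx : x ∈ R.nodes) : R.basis x ∈ R.space := by
  unfold space
  rw [← R.span_basis]
  exact Submodule.subset_span ⟨x, hx, rfl⟩

theorem interpPoly_mem (g : E3 → ℝ) : R.interpPoly g ∈ R.space :=
  Submodule.sum_mem _ fun _ hx => Submodule.smul_mem _ _ (R.basis_mem hx)

theorem polyEval_interpPoly (g : E3 → ℝ) (y : E3) :
    polyEval (R.interpPoly g) y = ∑ x ∈ R.nodes, g x * polyEval (R.basis x) y := by
  simp only [interpPoly, polyEval_sum, polyEval_smul]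

theorem polyEval_interpPoly_node (g : E3 → ℝ) {y : E3} (hy : y ∈ R.nodes) :
    polyEval (R.interpPoly g) y = g y := by
  rw [polyEval_interpPoly, Finset.sum_eq_single_of_mem y hy]
  · rw [R.nodal y hy y hy, if_pos rfl, mul_one]
  · intro x hx hxy
    rw [R.nodal x hx y hy, if_neg hxy, mul_zero]

theorem exists_coeff {q : MvPolynomial (Fin 3) ℝ} (hq : q ∈ R.space) :
    ∃ a : E3 → ℝ, q = R.interpPoly a := by
  unfold space at hq
  rw [← R.span_basis] at hq
  induction hq using Submodule.span_induction with
  | mem q h =>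
    classical
    obtain ⟨x, hx, rfl⟩ := h
    refine ⟨fun y => if y = x then 1 else 0, ?_⟩
    rw [interpPoly, Finset.sum_eq_single_of_mem x hx]
    · simp
    · intro y _ hy
      simp [hy]
  | zero => exact ⟨0, by simp [interpPoly]⟩
  | add q r _ _ h h' =>
    obtain ⟨a, rfl⟩ := h
    obtain ⟨b, rfl⟩ := h'
    exact ⟨a + b, by simp [interpPoly, add_smul, Finset.sum_add_distrib]⟩
  | smul c q _ h =>
    obtain ⟨a, rfl⟩ := h
    exact ⟨c • a, by simp [interpPoly, mul_smul, Finset.smul_sum]⟩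

theorem interpPoly_congr {g g' : E3 → ℝ} (h : ∀ x ∈ R.nodes, g x = g' x) :
    R.interpPoly g = R.interpPoly g' :=
  Finset.sum_congr rfl fun x hx => by rw [h x hx]

theorem interpPoly_polyEval {q : MvPolynomial (Fin 3) ℝ} (hq : q ∈ R.space) :
    R.interpPoly (polyEval q) = q := by
  obtain ⟨a, rfl⟩ := R.exists_coeff hq
  exact R.interpPoly_congr fun x hx => R.polyEval_interpPoly_node a hx

/-- The contrapositive of conformity: a basis function that does not vanish at `y` has its node in
the smallest face containing `y`. -/
theorem bary_eq_zero_of_basis_ne_zero {x y : E3} (hx : x ∈ R.nodes) (hy : y ∈ refTet)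
    (h : polyEval (R.basis x) y ≠ 0) {k : Fin 4} (hk : bary k y = 0) : bary k x = 0 := by
  by_contra hne
  exact h (R.conforming k x hx (fun hx' => hne (mem_refFace.1 hx').2) y (mem_refFace.2 ⟨hy, hk⟩))

theorem sum_nodes_permAff (π : Equiv.Perm (Fin 4)) (f : E3 → ℝ) :
    ∑ x ∈ R.nodes, f (permAff π x) = ∑ x ∈ R.nodes, f x := by
  classical
  have h := R.nodes_symm (permAff π) (permAff_image_refTet π)
  rw [← Finset.coe_image, Finset.coe_inj] at h
  conv_rhs => rw [← h]
  rw [Finset.sum_image fun a _ b _ hab => permAff_injective π hab]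

end RefElement

namespace TetMesh

variable {Ω : Set E3} (T : TetMesh Ω) {p : ℕ} (R : RefElement p)

theorem elt_symm_mem {i : Fin T.n} {y : E3} (hy : y ∈ T.elt i) : (T.φ i).symm y ∈ refTet :=
  T.mem_elt_iff.1 hy

theorem bary_node_eq_zero {i : Fin T.n} {x y : E3} (hx : x ∈ R.nodes) (hy : y ∈ T.elt i)
    (h : polyEval (R.basis x) ((T.φ i).symm y) ≠ 0) (k : Fin 4)
    (hk : bary k ((T.φ i).symm y) = 0) : bary k ((T.φ i).symm (T.φ i x)) = 0 := by
  rw [AffineEquiv.symm_apply_apply]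
  exact R.bary_eq_zero_of_basis_ne_zero hx (T.elt_symm_mem hy) h hk

theorem node_mem_elt (i : Fin T.n) {x : E3} (hx : x ∈ R.nodes) : T.φ i x ∈ T.elt i :=
  ⟨x, R.nodes_subset hx, rfl⟩

/-- The two parametrizations differ by a vertex permutation, and symmetry transports nodes and basis
functions along it. A node whose basis function does not vanish at `y` lies in the smallest face
containing `y`, hence in both elements, so both interpolants use the same value of `g` there. -/
theorem interpPoly_eq_of_mem {i j : Fin T.n} {y : E3} (hi : y ∈ T.elt i) (hj : y ∈ T.elt j)
    (g : E3 → ℝ) :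
    polyEval (R.interpPoly fun x => g (T.φ i x)) ((T.φ i).symm y) =
      polyEval (R.interpPoly fun x => g (T.φ j x)) ((T.φ j).symm y) := by
  obtain ⟨π, hπ⟩ := T.exists_permAff i j
  have h1 : T.φ j (permAff π ((T.φ i).symm y)) = y := by
    rw [hπ _ (T.elt_symm_mem hi) (by simpa using hj)]
    simp
  have h2 : (T.φ j).symm y = permAff π ((T.φ i).symm y) := by
    have := congrArg (T.φ j).symm h1
    simpa using this.symm
  rw [R.polyEval_interpPoly, R.polyEval_interpPoly, h2,
    ← R.sum_nodes_permAff π fun x => g (T.φ j x) * polyEval (R.basis x)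
      (permAff π ((T.φ i).symm y))]
  refine Finset.sum_congr rfl fun x hx => ?_
  rw [← R.basis_symm _ (permAff_image_refTet π) x hx _ (T.elt_symm_mem hi)]
  by_cases h : polyEval (R.basis x) ((T.φ i).symm y) = 0
  · rw [h, mul_zero, mul_zero]
  · rw [hπ x (R.nodes_subset hx)]
    exact T.mem_elt_of_support hi hj (T.node_mem_elt R i hx) (T.bary_node_eq_zero R hx hi h)

open Classical in
/-- The piecewise nodal interpolant of `g`, extended by zero. -/
noncomputable def interp (g : E3 → ℝ) : E3 → ℝ := fun y =>
  if h : ∃ i, y ∈ T.elt i then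
    polyEval (R.interpPoly fun x => g (T.φ h.choose x)) ((T.φ h.choose).symm y)
  else 0

theorem interp_eq {i : Fin T.n} {y : E3} (hy : y ∈ T.elt i) (g : E3 → ℝ) :
    T.interp R g y = polyEval (R.interpPoly fun x => g (T.φ i x)) ((T.φ i).symm y) := by
  have h : ∃ i, y ∈ T.elt i := ⟨i, hy⟩
  rw [interp, dif_pos h]
  exact T.interpPoly_eq_of_mem R h.choose_spec hy g

/-- The nodes that contribute at a boundary point lie in the smallest face containing it, hence on
the boundary, where `g` vanishes. -/
theorem interp_eq_zero (hΩ : IsOpen Ω) (hL : HasLipschitzBoundary Ω) {g : E3 → ℝ}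
    (hg : ∀ x ∈ frontier Ω, g x = 0) {y : E3} (hy : y ∉ Ω) : T.interp R g y = 0 := by
  by_cases h : ∃ i, y ∈ T.elt i
  · obtain ⟨i, hi⟩ := h
    have hyf : y ∈ frontier Ω := by
      rw [hΩ.frontier_eq]
      exact ⟨T.elt_subset_closure i hi, hy⟩
    rw [T.interp_eq R hi, R.polyEval_interpPoly]
    refine Finset.sum_eq_zero fun x hx => ?_
    by_cases h : polyEval (R.basis x) ((T.φ i).symm y) = 0
    · rw [h, mul_zero]
    · rw [hg, zero_mul]
      exact T.mem_frontier_of_support hΩ hL hyf hi (T.node_mem_elt R i hx)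
        (T.bary_node_eq_zero R hx hi h)
  · rw [interp, dif_neg h]

theorem contDiff_polyEval_symm (φ : E3 ≃ᵃ[ℝ] E3) (q : MvPolynomial (Fin 3) ℝ) :
    ContDiff ℝ ∞ fun y => polyEval q (φ.symm y) := by
  have h : (fun y => φ.symm y) =
      fun y => LinearMap.toContinuousLinearMap (φ.symm.linear : E3 →ₗ[ℝ] E3) y + φ.symm 0 :=
    funext (affineEquiv_eq φ.symm)
  refine (contDiff_polyEval q).comp ?_
  change ContDiff ℝ ∞ fun y => φ.symm y
  rw [h]
  fun_prop

/-- The pieces are the compact elements, with polynomials on them, and the complement of `Ω`, where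
the interpolant is zero. -/
theorem exists_lipschitzWith_interp (hΩ : IsOpen Ω) (hL : HasLipschitzBoundary Ω) {g : E3 → ℝ}
    (hg : ∀ x ∈ frontier Ω, g x = 0) : ∃ K, LipschitzWith K (T.interp R g) := by
  have h1 : ∀ i, ∃ K, LipschitzOnWith K (T.interp R g) (T.elt i) := by
    intro i
    have hq := (contDiff_polyEval_symm (T.φ i) (R.interpPoly fun x => g (T.φ i x))).of_le
      (m := 1) (by simp)
    obtain ⟨K, hK⟩ := hq.locallyLipschitz.locallyLipschitzOn.exists_lipschitzOnWith_of_compact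
      (isCompact_elt (T.φ i))
    exact ⟨K, fun x hx y hy => by
      rw [T.interp_eq R hx, T.interp_eq R hy]
      exact hK hx hy⟩
  choose K hK using h1
  refine ⟨∑ i, K i, lipschitzWith_of_closed_cover (ι := Option (Fin T.n))
    (S := fun o => o.elim Ωᶜ T.elt) ?_ ?_ ?_⟩
  · rintro (_ | i)
    exacts [hΩ.isClosed_compl, (isCompact_elt (T.φ i)).isClosed]
  · rw [eq_univ_iff_forall]
    intro x
    by_cases hx : x ∈ Ω
    · obtain ⟨i, hi⟩ := T.exists_mem_elt (subset_closure hx)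
      exact mem_iUnion.2 ⟨some i, hi⟩
    · exact mem_iUnion.2 ⟨none, hx⟩
  · rintro (_ | i)
    · intro x hx y hy
      rw [T.interp_eq_zero R hΩ hL hg hx, T.interp_eq_zero R hΩ hL hg hy, edist_self]
      exact zero_le
    · exact (hK i).weaken (Finset.single_le_sum (fun _ _ => zero_le) (Finset.mem_univ i))

theorem memUh_interp (hΩ : IsOpen Ω) (hΩb : Bornology.IsBounded Ω) (hL : HasLipschitzBoundary Ω)
    {g : E3 → ℝ} (hg : ∀ x ∈ frontier Ω, g x = 0) : T.MemUh R (T.interp R g) := by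
  obtain ⟨K, hK⟩ := T.exists_lipschitzWith_interp R hΩ hL hg
  refine ⟨memH10_of_lipschitzWith hΩ hΩb hK fun x hx => T.interp_eq_zero R hΩ hL hg hx,
    fun i => ⟨_, R.interpPoly_mem fun x => g (T.φ i x), fun x hx => ?_⟩⟩
  rw [T.interp_eq R ⟨x, hx, rfl⟩, AffineEquiv.symm_apply_apply]

end TetMesh

end MassLump

namespace MassLump

open scoped ENNReal
open Filter Topology

/-! ### Continuous representatives -/

theorem setIntegral_mul_sq_le {U : Set E3} {f g : E3 → ℝ} (hf : MemLp f 2 (volume.restrict U))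
    (hg : MemLp g 2 (volume.restrict U)) :
    (∫ x in U, f x * g x) ^ 2 ≤ (∫ x in U, f x ^ 2) * ∫ x in U, g x ^ 2 := by
  have h1 : ∀ t : ℝ, 0 ≤ (∫ x in U, g x ^ 2) * (t * t) + (2 * ∫ x in U, f x * g x) * t +
      ∫ x in U, f x ^ 2 := by
    intro t
    have e : ∫ x in U, (f x + t * g x) ^ 2 = (∫ x in U, g x ^ 2) * (t * t) +
        (2 * ∫ x in U, f x * g x) * t + ∫ x in U, f x ^ 2 := by
      have e1 : ∀ x, (f x + t * g x) ^ 2 =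
          (t * t) * g x ^ 2 + (2 * t) * (f x * g x) + f x ^ 2 := fun x => by ring
      have i1 := hg.integrable_sq.const_mul (t * t)
      have i2 := (integrable_mul_of_memLp hf hg).const_mul (2 * t)
      have i3 : Integrable (fun x => t * t * g x ^ 2 + 2 * t * (f x * g x))
          (volume.restrict U) := i1.add i2
      simp_rw [e1]
      rw [integral_add i3 hf.integrable_sq, integral_add i1 i2, integral_const_mul,
        integral_const_mul]
      ring
    rw [← e]
    exact setIntegral_sq_nonneg U fun x => f x + t * g x
  have h2 := discrim_le_zero h1
  rw [discrim] at h2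
  nlinarith

theorem abs_setIntegral_mul_le {U : Set E3} {f g : E3 → ℝ} (hf : MemLp f 2 (volume.restrict U))
    (hg : MemLp g 2 (volume.restrict U)) :
    |∫ x in U, f x * g x| ≤ √(∫ x in U, f x ^ 2) * √(∫ x in U, g x ^ 2) := by
  rw [← Real.sqrt_mul (setIntegral_sq_nonneg _ _)]
  exact Real.abs_le_sqrt (setIntegral_mul_sq_le hf hg)

/-- Extension by zero of a function in `H₀¹`. -/
theorem MemH10.isWeakGrad_indicator {Ω : Set E3} (hΩ : IsOpen Ω) (hΩb : Bornology.IsBounded Ω)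
    {u : E3 → ℝ} (hu : MemH10 Ω u) :
    IsWeakGrad univ (Ω.indicator u) fun i => Ω.indicator (weakDeriv Ω (Pi.single i 1) u) := by
  have hG := hu.1.isWeakGrad
  have hm : ∀ {f : E3 → ℝ}, MemLp f 2 (volume.restrict Ω) →
      MemLp (Ω.indicator f) 2 (volume.restrict univ) := fun hf => by
    rw [Measure.restrict_univ]
    exact (memLp_indicator_iff_restrict hΩ.measurableSet).2 hf
  refine ⟨hm hG.1, fun i => isWeakDeriv_single_iff.2 ⟨hm (hG.2 i).1, fun φ hφ => ?_⟩⟩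
  set g := weakDeriv Ω (Pi.single i 1) u with hg
  have hgi : IsWeakDeriv Ω (Pi.single i 1) u g := hG.2 i
  have e : ∀ f k : E3 → ℝ, ∫ x in univ, Ω.indicator f x * k x = ∫ x in Ω, f x * k x := by
    intro f k
    rw [Measure.restrict_univ, ← integral_indicator hΩ.measurableSet]
    refine integral_congr_ae (Eventually.of_forall fun x => ?_)
    by_cases hx : x ∈ Ω <;> simp [hx]
  rw [e, e, eq_neg_iff_add_eq_zero, ← abs_nonpos_iff]
  have hφ1 : MemLp φ 2 (volume.restrict Ω) := hφ.memLp _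
  have hφ2 : MemLp (partialDeriv i φ) 2 (volume.restrict Ω) := (hφ.partialDeriv i).memLp _
  set A := √(∫ x in Ω, partialDeriv i φ x ^ 2)
  set B := √(∫ x in Ω, φ x ^ 2)
  refine le_of_forall_pos_le_add fun ε hε => ?_
  obtain ⟨ψ, hψ, hlt⟩ := hu.2 (ε / (A + B + 1)) (by positivity)
  have hd := hG.sub (hψ.isWeakGrad hΩb)
  have hsq := hd.sobolevNorm_sq hΩ
  have hS0 := sobolevNorm_nonneg Ω 1 (u - ψ)
  have hsum0 : 0 ≤ ∑ j, ∫ x in Ω, (weakDeriv Ω (Pi.single j 1) u - partialDeriv j ψ) x ^ 2 :=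
    Finset.sum_nonneg fun j _ => setIntegral_sq_nonneg _ _
  have b1 : √(∫ x in Ω, (u - ψ) x ^ 2) ≤ sobolevNorm Ω 1 (u - ψ) :=
    Real.sqrt_le_iff.2 ⟨hS0, by linarith⟩
  have b2 : √(∫ x in Ω, (g - partialDeriv i ψ) x ^ 2) ≤ sobolevNorm Ω 1 (u - ψ) := by
    refine Real.sqrt_le_iff.2 ⟨hS0, ?_⟩
    have := Finset.single_le_sum (f := fun j => ∫ x in Ω,
      (weakDeriv Ω (Pi.single j 1) u - partialDeriv j ψ) x ^ 2)
      (fun j _ => setIntegral_sq_nonneg _ _) (Finset.mem_univ i)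
    have h0 := setIntegral_sq_nonneg Ω (u - ψ)
    simp only [Pi.sub_apply] at *
    linarith
  have c1 := abs_setIntegral_mul_le hd.1 hφ2
  have c2 := abs_setIntegral_mul_le (hd.2 i).1 hφ1
  -- The function `φ` need not vanish on the boundary of `Ω`, but the approximation `ψ` of `u` has
  -- compact support in `Ω`, so here integration by parts is exact.
  have hparts := (isWeakDeriv_single_iff.1 (isWeakDeriv_of_contDiff hΩb hφ.1 i)).2 ψ hψ
  have hsplit : (∫ x in Ω, u x * partialDeriv i φ x) + ∫ x in Ω, g x * φ x =
      (∫ x in Ω, (u - ψ) x * partialDeriv i φ x) +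
        ∫ x in Ω, (g - partialDeriv i ψ) x * φ x := by
    simp only [Pi.sub_apply, sub_mul]
    rw [integral_sub (integrable_mul_of_memLp hG.1 hφ2)
      (integrable_mul_of_memLp (hψ.memLp _) hφ2),
      integral_sub (integrable_mul_of_memLp hgi.1 hφ1)
      (integrable_mul_of_memLp ((hψ.partialDeriv i).memLp _) hφ1)]
    simp only [mul_comm (φ _)] at hparts
    simp only [mul_comm (partialDeriv i φ _)] at hparts ⊢
    linarith
  rw [hsplit, zero_add]
  have hlt' : sobolevNorm Ω 1 (u - ψ) * (A + B + 1) ≤ ε := by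
    rw [lt_div_iff₀ (by positivity)] at hlt
    exact hlt.le
  have hA0 : 0 ≤ A := Real.sqrt_nonneg _
  have hB0 : 0 ≤ B := Real.sqrt_nonneg _
  have d1 := mul_le_mul_of_nonneg_right b1 hA0
  have d2 := mul_le_mul_of_nonneg_right b2 hB0
  refine (abs_add_le _ _).trans ?_
  nlinarith

theorem volume_eq_ofReal_pow {U : Set E3} (h0 : volume U ≠ 0) (htop : volume U ≠ ⊤) :
    ∃ s : ℝ, 0 < s ∧ volume U = ENNReal.ofReal (s ^ 6) := by
  have h : 0 < (volume U).toReal := ENNReal.toReal_pos h0 htop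
  refine ⟨(volume U).toReal ^ (1 / 6 : ℝ), by positivity, ?_⟩
  rw [← Real.rpow_natCast, ← Real.rpow_mul h.le]
  norm_num
  exact (ENNReal.ofReal_toReal htop).symm

/-- The gradient of a function in `H²` has small energy on small sets. -/
theorem TetMesh.exists_growth {Ω : Set E3} (T : TetMesh Ω) (hΩ : IsOpen Ω)
    (hL : HasLipschitzBoundary Ω) {u : E3 → ℝ} (hu : MemH Ω 2 u) :
    ∃ M : ℝ, 0 ≤ M ∧ ∀ θ > 0, ∀ B : Set E3, MeasurableSet B → volume B ≤ ENNReal.ofReal (θ ^ 3) →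
      ∑ i, ∫⁻ z in B, ‖Ω.indicator (weakDeriv Ω (Pi.single i 1) u) z‖ₑ ^ 2 ≤
        ENNReal.ofReal (M ^ 2 * θ ^ 2) := by
  have hv : ∀ e, ∃ s : ℝ, 0 < s ∧ volume (interior (T.elt e)) = ENNReal.ofReal (s ^ 6) := fun e =>
    volume_eq_ofReal_pow (volume_interior_elt_ne_zero (T.φ e))
      (isBounded_interior_elt (T.φ e)).measure_lt_top.ne
  choose s hs0 hs using hv
  set D : Fin T.n → ℝ := fun e => Metric.diam (T.elt e) with hD
  set X : Fin T.n → Fin 3 → ℝ≥0∞ := fun e i =>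
    (∫⁻ z in interior (T.elt e), ‖weakDeriv Ω (Pi.single i 1) u z‖ₑ ^ 2) +
      ENNReal.ofReal (D e ^ 2) * ∑ j, ∫⁻ z in interior (T.elt e),
        ‖weakDeriv Ω (Pi.single i 1 + Pi.single j 1) u z‖ₑ ^ 2 with hX
  have hF : ∀ e i, IsWeakGrad (interior (T.elt e)) (weakDeriv Ω (Pi.single i 1) u)
      fun j => weakDeriv Ω (Pi.single i 1 + Pi.single j 1) u := fun e i =>
    (hu.isFam.mono hΩ (T.interior_elt_subset hΩ hL e) le_rfl).isWeakGrad (α := Pi.single i 1)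
      (by simp)
  have hXfin : ∀ e i, X e i ≠ ⊤ := by
    intro e i
    refine ENNReal.add_ne_top.2 ⟨?_, ENNReal.mul_ne_top ENNReal.ofReal_ne_top
      (ENNReal.sum_ne_top.2 fun j _ => ?_)⟩
    · rw [lintegral_enorm_sq (hF e i).1]; exact ENNReal.ofReal_ne_top
    · rw [lintegral_enorm_sq ((hF e i).2 j).1]; exact ENNReal.ofReal_ne_top
  -- This bound depends on the mesh and on `u`. That is harmless, since only the existence of a
  -- continuous representative is drawn from it.
  set Y : ℝ≥0∞ := ∑ i, ∑ e, ENNReal.ofReal (2 ^ 19 / s e ^ 4) * X e i with hY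
  have hYfin : Y ≠ ⊤ := ENNReal.sum_ne_top.2 fun i _ => ENNReal.sum_ne_top.2 fun e _ =>
    ENNReal.mul_ne_top ENNReal.ofReal_ne_top (hXfin e i)
  refine ⟨√Y.toReal, Real.sqrt_nonneg _, fun θ hθ B hB hBv => ?_⟩
  rw [Real.sq_sqrt ENNReal.toReal_nonneg, ENNReal.ofReal_mul ENNReal.toReal_nonneg,
    ENNReal.ofReal_toReal hYfin, hY, Finset.sum_mul]
  refine Finset.sum_le_sum fun i _ => ?_
  have e1 : ∫⁻ z in B, ‖Ω.indicator (weakDeriv Ω (Pi.single i 1) u) z‖ₑ ^ 2 =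
      ∫⁻ z in B ∩ Ω, ‖weakDeriv Ω (Pi.single i 1) u z‖ₑ ^ 2 := by
    have := setLIntegral_indicator_sub hΩ.measurableSet B (weakDeriv Ω (Pi.single i 1) u) 0
    simpa using this
  rw [e1, T.setLIntegral_inter_eq_sum hΩ hL hB, Finset.sum_mul]
  refine Finset.sum_le_sum fun e _ => ?_
  have h1 := (hF e i).setLIntegral_sq_le isOpen_interior (convex_elt (T.φ e)).interior
    (isBounded_interior_elt (T.φ e)) (hB.inter isOpen_interior.measurableSet)
    inter_subset_right (hs0 e) hθ
    (fun y hy z hz => T.dist_le_diam (interior_subset hz) (interior_subset hy)) (hs e)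
    ((measure_mono inter_subset_left).trans hBv)
  refine h1.trans (le_of_eq ?_)
  rw [mul_right_comm, ← ENNReal.ofReal_mul (by have := hs0 e; positivity)]
  congr 2
  ring

/-- A function on `ℝ³` with almost everywhere Hölder-type oscillation has a continuous
representative. -/
theorem exists_continuous_of_ae_holder {f : E3 → ℝ} {N : ℝ} (hN : 0 ≤ N) {D : Set E3}
    (hD : ∀ᵐ x, x ∈ D) (h : ∀ x ∈ D, ∀ y ∈ D, |f x - f y| ≤ N * √(dist x y)) :
    ∃ g : E3 → ℝ, Continuous g ∧ g =ᵐ[volume] f := by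
  have hd : Dense D := Measure.dense_of_ae hD
  have hu : UniformContinuous fun x : D => f x := by
    rw [Metric.uniformContinuous_iff]
    intro ε hε
    refine ⟨(ε / (N + 1)) ^ 2, by positivity, fun x y hxy => ?_⟩
    have h1 := h x x.2 y y.2
    have h2 : √(dist (x : E3) y) < ε / (N + 1) := (Real.sqrt_lt' (by positivity)).2 hxy
    rw [Real.dist_eq]
    rw [lt_div_iff₀ (by positivity)] at h2
    nlinarith [Real.sqrt_nonneg (dist (x : E3) y)]
  have he : IsUniformInducing ((↑) : D → E3) := isUniformInducing_val D
  have hdr : DenseRange ((↑) : D → E3) := hd.denseRange_val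
  refine ⟨(he.isDenseInducing hdr).extend fun x : D => f x,
    (uniformContinuous_uniformly_extend he hdr hu).continuous, hD.mono fun x hx => ?_⟩
  exact uniformly_extend_of_ind he hdr hu ⟨x, hx⟩

theorem volume_closedBall_eq (x : E3) {r : ℝ} (hr : 0 ≤ r) :
    volume (Metric.closedBall x r) =
      ENNReal.ofReal (r ^ 3) * volume (Metric.closedBall (0 : E3) 1) := by
  have := Measure.addHaar_closedBall' (volume : Measure E3) x hr
  simpa using this

/-- A function in `H² ∩ H₀¹` has a representative that is continuous on `ℝ³` and vanishes on the
boundary. -/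
theorem TetMesh.exists_continuous_rep {Ω : Set E3} (T : TetMesh Ω) (hΩ : IsOpen Ω)
    (hΩb : Bornology.IsBounded Ω) (hL : HasLipschitzBoundary Ω) {u : E3 → ℝ} (hu : MemH Ω 2 u)
    (hu0 : MemH10 Ω u) : ∃ g : E3 → ℝ, Continuous g ∧ g =ᵐ[volume.restrict Ω] u ∧
      ∀ x ∈ frontier Ω, g x = 0 := by
  obtain ⟨M, hM, hgr⟩ := T.exists_growth hΩ hL hu
  have hG := hu0.isWeakGrad_indicator hΩ hΩb
  have hloc : LocallyIntegrable (Ω.indicator u) := locallyIntegrable_indicator hΩ.measurableSet hu.1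
  obtain ⟨c, hc0, hc⟩ := volume_eq_ofReal_pow (U := Metric.closedBall (0 : E3) 1)
    (Metric.measure_closedBall_pos volume _ one_pos).ne' measure_closedBall_lt_top.ne
  have hosc : ∀ x ∈ {x | Tendsto (fun n => moll n (Ω.indicator u) x) atTop (𝓝 (Ω.indicator u x))},
      ∀ y ∈ {x | Tendsto (fun n => moll n (Ω.indicator u) x) atTop (𝓝 (Ω.indicator u x))},
      |Ω.indicator u x - Ω.indicator u y| ≤ 8 * M / c * √(dist x y) := by
    intro x hx y hy
    rcases eq_or_ne x y with rfl | hxy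
    · simp
    set r := dist x y with hr
    have hr0 : 0 < r := dist_pos.2 hxy
    have hrs : √r ^ 2 = r := Real.sq_sqrt hr0.le
    have hrp : 0 < √r := Real.sqrt_pos.2 hr0
    -- On the ball of radius `r = dist x y` about `x`, the diameter bound is `2 * r` and the sixth
    -- root of the volume is `√r * c`; the quotient is of order `√r`.
    have h1 := hG.abs_sub_le_of_growth isOpen_univ (isCompact_closedBall x r) (subset_univ _)
      (convex_closedBall x r) (s := √r * c) (d := 2 * r) (by positivity) hM
      (fun y hy z hz => by
        rw [← dist_eq_norm]
        have a1 := Metric.mem_closedBall.1 hy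
        have a2 := Metric.mem_closedBall.1 hz
        have := dist_triangle_right z y x
        linarith)
      (by
        rw [volume_closedBall_eq x hr0.le, hc, ← ENNReal.ofReal_mul (by positivity), mul_pow,
          show √r ^ 6 = (√r ^ 2) ^ 3 by ring, hrs])
      (fun θ hθ B _ hB hBv => hgr θ hθ B hB hBv)
      (Metric.mem_closedBall_self hr0.le) (y := y) (by rw [Metric.mem_closedBall, dist_comm])
      (by rw [indicator_univ]; exact hx) (by rw [indicator_univ]; exact hy)
    refine h1.trans (le_of_eq ?_)
    rw [div_mul_eq_mul_div, div_eq_div_iff (by positivity) (by positivity)]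
    linear_combination -8 * M * c * hrs
  obtain ⟨g, hgc, hg⟩ := exists_continuous_of_ae_holder (by positivity) (ae_tendsto_moll hloc) hosc
  have hext : EqOn g (fun _ => 0) (closure Ω)ᶜ := by
    refine Measure.eqOn_open_of_ae_eq (μ := volume) ?_ isClosed_closure.isOpen_compl
      hgc.continuousOn continuousOn_const
    filter_upwards [ae_restrict_of_ae hg, ae_restrict_mem isClosed_closure.isOpen_compl.measurableSet]
      with x hx hx'
    rw [hx, indicator_of_notMem fun h => hx' (subset_closure h)]
  refine ⟨g, hgc, ?_, fun x hx => ?_⟩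
  · filter_upwards [ae_restrict_of_ae hg, ae_restrict_mem hΩ.measurableSet] with x hx hx'
    rw [hx, indicator_of_mem hx']
  -- The function `g` vanishes on the exterior of `Ω`, and the Lipschitz condition makes every
  -- boundary point a limit of exterior points.
  · have hcl : x ∈ closure (closure Ω)ᶜ := by
      rw [Metric.mem_closure_iff]
      intro ε hε
      obtain ⟨y, hy, hy'⟩ := exists_notMem_closure hΩ hL hx hε
      exact ⟨y, hy', by rwa [dist_comm]⟩
    exact closure_minimal hext (isClosed_eq hgc continuous_const) hcl

end MassLump

namespace MassLump

open scoped ENNReal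
open Filter Topology

/-! ### Polynomials and affine maps -/

/-- The components of an affine map as polynomials. -/
noncomputable def affinePoly (φ : E3 ≃ᵃ[ℝ] E3) (i : Fin 3) : MvPolynomial (Fin 3) ℝ :=
  MvPolynomial.C (φ 0 i) +
    ∑ j, MvPolynomial.C (φ.linear (EuclideanSpace.single j 1) i) * MvPolynomial.X j

/-- The composition of a polynomial with an affine map. -/
noncomputable def compAffine (φ : E3 ≃ᵃ[ℝ] E3) (q : MvPolynomial (Fin 3) ℝ) :
    MvPolynomial (Fin 3) ℝ := MvPolynomial.aeval (affinePoly φ) q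

theorem polyEval_affinePoly (φ : E3 ≃ᵃ[ℝ] E3) (i : Fin 3) (x : E3) :
    polyEval (affinePoly φ i) x = φ x i := by
  have hx : x = ∑ j, x j • EuclideanSpace.single j (1 : ℝ) := by
    ext j
    fin_cases j <;> simp [Fin.sum_univ_three]
  have h : φ.linear x = ∑ j, x j • φ.linear (EuclideanSpace.single j 1) := by
    conv_lhs => rw [hx]
    simp only [map_sum, map_smul]
  rw [affineEquiv_eq φ x, h]
  simp [affinePoly, polyEval, add_comm, mul_comm]

theorem polyEval_compAffine (φ : E3 ≃ᵃ[ℝ] E3) (q : MvPolynomial (Fin 3) ℝ) (x : E3) :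
    polyEval (compAffine φ q) x = polyEval q (φ x) := by
  unfold compAffine
  induction q using MvPolynomial.induction_on with
  | C a => simp [polyEval]
  | add p q hp hq => rw [map_add, polyEval_add, polyEval_add, Pi.add_apply, Pi.add_apply, hp, hq]
  | mul_X q i hq =>
    rw [map_mul, polyEval_mul, polyEval_mul, hq, MvPolynomial.aeval_X, polyEval_affinePoly]
    simp [polyEval]

theorem totalDegree_affinePoly_le (φ : E3 ≃ᵃ[ℝ] E3) (i : Fin 3) :
    (affinePoly φ i).totalDegree ≤ 1 := by
  unfold affinePoly
  refine (MvPolynomial.totalDegree_add _ _).trans (max_le (by simp) ?_)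
  refine MvPolynomial.totalDegree_finsetSum_le fun j _ => ?_
  refine (MvPolynomial.totalDegree_mul _ _).trans ?_
  simp

theorem compAffine_mem_Poly (φ : E3 ≃ᵃ[ℝ] E3) {k : ℕ} {q : MvPolynomial (Fin 3) ℝ}
    (hq : q ∈ Poly k) : compAffine φ q ∈ Poly k := by
  rw [MvPolynomial.mem_restrictTotalDegree] at hq ⊢
  unfold compAffine
  rw [q.as_sum, map_sum]
  refine MvPolynomial.totalDegree_finsetSum_le fun s hs => ?_
  have h1 := MvPolynomial.le_totalDegree hs
  rw [Finsupp.sum_fintype _ _ (by simp)] at h1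
  rw [MvPolynomial.aeval_monomial, Finsupp.prod_fintype _ _ (by simp)]
  refine (MvPolynomial.totalDegree_mul _ _).trans ?_
  rw [MvPolynomial.algebraMap_eq, MvPolynomial.totalDegree_C, zero_add]
  refine (MvPolynomial.totalDegree_finsetProd _ _).trans ((Finset.sum_le_sum fun i _ => ?_).trans
    (h1.trans hq))
  refine (MvPolynomial.totalDegree_pow _ _).trans ?_
  calc s i * (affinePoly φ i).totalDegree ≤ s i * 1 :=
        Nat.mul_le_mul_left _ (totalDegree_affinePoly_le φ i)
    _ = s i := mul_one _

theorem Poly_mono {k l : ℕ} (h : k ≤ l) : Poly k ≤ Poly l := fun q hq => by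
  rw [MvPolynomial.mem_restrictTotalDegree] at hq ⊢
  exact hq.trans h

theorem C_mem_Poly (a : ℝ) (k : ℕ) : MvPolynomial.C a ∈ Poly k := by
  rw [MvPolynomial.mem_restrictTotalDegree, MvPolynomial.totalDegree_C]
  exact Nat.zero_le _

/-! ### Bounds on the reference element -/

namespace RefElement

variable {p : ℕ} (R : RefElement p)

theorem Poly_le_space : Poly p ≤ R.space := le_sup_left

theorem exists_basis_bound : ∃ B : ℝ, 0 < B ∧ ∀ x ∈ R.nodes, ∀ y ∈ refTet,
    |polyEval (R.basis x) y| ≤ B ∧ ‖fderiv ℝ (polyEval (R.basis x)) y‖ ≤ B := by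
  have h1 : ∀ x, ∃ C, ∀ y ∈ refTet, ‖polyEval (R.basis x) y‖ ≤ C := fun x =>
    isCompact_refTet.exists_bound_of_continuousOn (continuous_polyEval _).continuousOn
  have h2 : ∀ x, ∃ C, ∀ y ∈ refTet, ‖fderiv ℝ (polyEval (R.basis x)) y‖ ≤ C := fun x =>
    isCompact_refTet.exists_bound_of_continuousOn
      ((contDiff_polyEval _).continuous_fderiv (by simp)).continuousOn
  choose C hC using h1
  choose D hD using h2
  have hle : ∀ x ∈ R.nodes, |C x| + |D x| ≤ 1 + ∑ x ∈ R.nodes, (|C x| + |D x|) := fun x hx => by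
    have := Finset.single_le_sum (f := fun x => |C x| + |D x|) (fun _ _ => by positivity) hx
    linarith
  refine ⟨1 + ∑ x ∈ R.nodes, (|C x| + |D x|), by positivity, fun x hx y hy => ⟨?_, ?_⟩⟩
  · refine (hC x y hy).trans (le_trans ?_ (hle x hx))
    linarith [le_abs_self (C x), abs_nonneg (D x)]
  · refine (hD x y hy).trans (le_trans ?_ (hle x hx))
    linarith [le_abs_self (D x), abs_nonneg (C x)]

theorem eq_zero_of_integral_sq_eq_zero {q : MvPolynomial (Fin 3) ℝ}
    (h : ∫ y in refTet, polyEval q y ^ 2 = 0) {y : E3} (hy : y ∈ refTet) : polyEval q y = 0 := by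
  have hc := continuous_polyEval q
  have hi : IntegrableOn (fun y => polyEval q y ^ 2) refTet :=
    (hc.pow 2).continuousOn.integrableOn_compact isCompact_refTet
  have h1 := (integral_eq_zero_iff_of_nonneg (fun y => sq_nonneg (polyEval q y)) hi).1 h
  have h2 : (fun y => polyEval q y ^ 2) =ᵐ[volume.restrict (interior refTet)] fun _ => 0 :=
    ae_mono (Measure.restrict_mono interior_subset le_rfl) h1
  have h3 := Measure.eqOn_open_of_ae_eq h2 isOpen_interior (hc.pow 2).continuousOn
    continuousOn_const
  have h4 : closure (interior refTet) ⊆ {y | polyEval q y ^ 2 = 0} :=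
    closure_minimal h3 (isClosed_eq (hc.pow 2) continuous_const)
  have h5 : y ∈ closure (interior refTet) := by
    have := closure_interior_elt (AffineEquiv.refl ℝ E3)
    simp only [AffineEquiv.coe_refl, image_id] at this
    rwa [this]
  exact pow_eq_zero_iff two_ne_zero |>.1 (h4 h5)

/-- Equivalence of norms in finite dimension: as a quadratic form in the nodal values, `J` is
positive definite, because a polynomial vanishing on the tetrahedron vanishes at the nodes. Hence it
is bounded below on the unit sphere. -/
theorem exists_sup_le : ∃ C : ℝ, 0 < C ∧ ∀ q ∈ R.space, ∀ y ∈ refTet,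
    polyEval q y ^ 2 ≤ C * ∫ y in refTet, polyEval q y ^ 2 := by
  classical
  obtain ⟨B, hB0, hB⟩ := R.exists_basis_bound
  set P : (R.nodes → ℝ) → E3 → ℝ := fun a y => ∑ x, a x * polyEval (R.basis x) y with hP
  have hPq : ∀ a, ∃ q, P a = polyEval q := fun a =>
    ⟨∑ x, a x • R.basis x, funext fun y => by simp only [hP, polyEval_sum, polyEval_smul]⟩
  have hPc : ∀ a, Continuous (P a) := fun a => by
    obtain ⟨q, hq⟩ := hPq a
    rw [hq]; exact continuous_polyEval q
  have hint : ∀ {f : E3 → ℝ}, Continuous f → Integrable f (volume.restrict refTet) := fun hf =>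
    hf.continuousOn.integrableOn_compact isCompact_refTet
  set J : (R.nodes → ℝ) → ℝ := fun a => ∫ y in refTet, P a y ^ 2 with hJ
  have hJc : Continuous J := by
    have e : J = fun a => ∑ x : R.nodes, ∑ z : R.nodes, a x * a z *
        ∫ y in refTet, polyEval (R.basis x) y * polyEval (R.basis z) y := by
      funext a
      have e1 : ∀ y, P a y ^ 2 = ∑ x : R.nodes, ∑ z : R.nodes, a x * a z *
          (polyEval (R.basis x) y * polyEval (R.basis z) y) := by
        intro y
        rw [sq, hP]
        simp only
        rw [Finset.sum_mul_sum]
        exact Finset.sum_congr rfl fun x _ => Finset.sum_congr rfl fun z _ => by ring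
      simp only [hJ, e1]
      have hxz : ∀ x z : R.nodes, Integrable (fun y => a x * a z *
          (polyEval (R.basis x) y * polyEval (R.basis z) y)) (volume.restrict refTet) := fun x z =>
        (hint ((continuous_polyEval _).mul (continuous_polyEval _))).const_mul _
      rw [integral_finsetSum _ fun x _ => integrable_finsetSum _ fun z _ => hxz x z]
      refine Finset.sum_congr rfl fun x _ => ?_
      rw [integral_finsetSum _ fun z _ => hxz x z]
      exact Finset.sum_congr rfl fun z _ => integral_const_mul _ _
    rw [e]
    fun_prop
  have hJhom : ∀ (t : ℝ) a, J (t • a) = t ^ 2 * J a := by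
    intro t a
    have e1 : ∀ y, P (t • a) y = t * P a y := fun y => by
      simp only [hP, Finset.mul_sum, Pi.smul_apply, smul_eq_mul, mul_assoc]
    simp only [hJ, e1, mul_pow, integral_const_mul]
  have hpos : ∀ a : R.nodes → ℝ, a ≠ 0 → 0 < J a := by
    intro a ha
    refine lt_of_le_of_ne (setIntegral_sq_nonneg _ _) fun h0 => ha (funext fun z => ?_)
    obtain ⟨q, hq⟩ := hPq a
    have h1 : ∫ y in refTet, polyEval q y ^ 2 = 0 := by rw [← hq]; exact h0.symm
    have h2 := eq_zero_of_integral_sq_eq_zero h1 (R.nodes_subset z.2)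
    rw [← hq] at h2
    simp only [hP] at h2
    rw [Finset.sum_eq_single_of_mem z (Finset.mem_univ z)] at h2
    · rwa [R.nodal z z.2 z z.2, if_pos rfl, mul_one] at h2
    · intro x _ hx
      rw [R.nodal x x.2 z z.2, if_neg fun h => hx (Subtype.ext h), mul_zero]
  obtain ⟨m, hm0, hm⟩ : ∃ m > 0, ∀ a, m * ‖a‖ ^ 2 ≤ J a := by
    have hsph : ∃ m > 0, ∀ a ∈ Metric.sphere (0 : R.nodes → ℝ) 1, m ≤ J a := by
      rcases (Metric.sphere (0 : R.nodes → ℝ) 1).eq_empty_or_nonempty with h | h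
      · exact ⟨1, one_pos, fun a ha => by rw [h] at ha; exact absurd ha (notMem_empty _)⟩
      · obtain ⟨a, ha, hmin⟩ := (isCompact_sphere _ _).exists_isMinOn h hJc.continuousOn
        refine ⟨J a, hpos a ?_, fun b hb => hmin hb⟩
        rintro rfl
        simp at ha
    obtain ⟨m, hm0, hm⟩ := hsph
    refine ⟨m, hm0, fun a => ?_⟩
    rcases eq_or_ne a 0 with rfl | ha
    · simpa using setIntegral_sq_nonneg _ _
    have hn : 0 < ‖a‖ := norm_pos_iff.2 ha
    have h1 := hm (‖a‖⁻¹ • a) (by simp [norm_smul, hn.ne'])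
    rw [hJhom, inv_pow, ← div_eq_inv_mul, le_div_iff₀ (by positivity)] at h1
    exact h1
  set N : ℝ := (R.nodes.card : ℝ) * B + 1 with hN
  refine ⟨N ^ 2 / m, by positivity, fun q hq y hy => ?_⟩
  obtain ⟨a, rfl⟩ := R.exists_coeff hq
  set b : R.nodes → ℝ := fun x => a x with hb
  have e : ∀ y, polyEval (R.interpPoly a) y = P b y := by
    intro y
    rw [R.polyEval_interpPoly, ← Finset.sum_coe_sort]
  simp only [e]
  have h1 : |P b y| ≤ N * ‖b‖ := by
    calc |P b y| ≤ ∑ x, |b x * polyEval (R.basis x) y| := Finset.abs_sum_le_sum_abs _ _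
      _ ≤ ∑ x : R.nodes, ‖b‖ * B := by
          refine Finset.sum_le_sum fun x _ => ?_
          rw [abs_mul]
          exact mul_le_mul (norm_le_pi_norm b x) (hB x x.2 y hy).1 (abs_nonneg _) (norm_nonneg _)
      _ = R.nodes.card * B * ‖b‖ := by
          rw [Finset.sum_const, Finset.card_univ, Fintype.card_coe, nsmul_eq_mul]; ring
      _ ≤ N * ‖b‖ := by
          rw [hN]
          nlinarith [norm_nonneg b]
  have h2 := hm b
  rw [← sq_abs, div_mul_eq_mul_div, le_div_iff₀ hm0]
  calc |P b y| ^ 2 * m ≤ (N * ‖b‖) ^ 2 * m := by gcongr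
    _ = N ^ 2 * (m * ‖b‖ ^ 2) := by ring
    _ ≤ N ^ 2 * J b := by gcongr

end RefElement

end MassLump

namespace MassLump

open scoped ENNReal
open Filter Topology

/-! ### Local interpolation -/

theorem levelEnergy_le_sum (U : Set E3) (F : (Fin 3 → ℕ) → E3 → ℝ) {k m : ℕ} (hk : k ≤ m) :
    levelEnergy U F k ≤ ∑ α ∈ multiIndices m, ∫ x in U, F α x ^ 2 := by
  refine Finset.sum_le_sum_of_subset_of_nonneg (fun α hα => ?_)
    fun _ _ _ => setIntegral_sq_nonneg _ _
  rw [mem_levelIndices] at hα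
  rw [mem_multiIndices]
  omega

theorem sum_multiIndices_nonneg (U : Set E3) (F : (Fin 3 → ℕ) → E3 → ℝ) (m : ℕ) :
    0 ≤ ∑ α ∈ multiIndices m, ∫ x in U, F α x ^ 2 :=
  Finset.sum_nonneg fun _ _ => setIntegral_sq_nonneg _ _

theorem sq_sub_le_on_elt (φ : E3 ≃ᵃ[ℝ] E3) {g h : E3 → ℝ} (hg : ContinuousOn g (φ '' refTet))
    (hh : Continuous h) {S : ℝ} (hS : ∀ x ∈ interior (φ '' refTet), (g x - h x) ^ 2 ≤ S) {x : E3}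
    (hx : x ∈ φ '' refTet) : (g x - h x) ^ 2 ≤ S := by
  rw [← closure_interior_elt φ] at hx hg
  exact le_on_closure (f := fun x => (g x - h x) ^ 2) (g := fun _ => S) hS
    ((hg.sub hh.continuousOn).pow 2) continuousOn_const hx

theorem abs_partialDeriv_comp_symm_le (φ : E3 ≃ᵃ[ℝ] E3) {z : E3} {r : ℝ} (hr : 0 < r)
    (hball : Metric.closedBall z r ⊆ φ '' refTet) {b : MvPolynomial (Fin 3) ℝ} {B : ℝ} {y : E3}
    (hB : ‖fderiv ℝ (polyEval b) (φ.symm y)‖ ≤ B) (i : Fin 3) :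
    |partialDeriv i (fun y => polyEval b (φ.symm y)) y| ≤ B / r := by
  have h1 : HasFDerivAt φ.symm
      (LinearMap.toContinuousLinearMap (φ.symm.linear : E3 →ₗ[ℝ] E3)) y := by
    have e : (φ.symm : E3 → E3) =
        fun y => LinearMap.toContinuousLinearMap (φ.symm.linear : E3 →ₗ[ℝ] E3) y + φ.symm 0 :=
      funext (affineEquiv_eq φ.symm)
    rw [e]
    exact (ContinuousLinearMap.hasFDerivAt _).add_const _
  have h2 : HasFDerivAt (polyEval b) (fderiv ℝ (polyEval b) (φ.symm y)) (φ.symm y) :=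
    ((contDiff_polyEval b).differentiable (by simp) _).hasFDerivAt
  have h3 := (h2.comp y h1).fderiv
  have h4 := norm_linear_symm_le φ hr hball (EuclideanSpace.single i 1)
  rw [PiLp.norm_single, norm_one] at h4
  change |fderiv ℝ (polyEval b ∘ φ.symm) y (EuclideanSpace.single i 1)| ≤ _
  rw [h3]
  have h5 := (fderiv ℝ (polyEval b) (φ.symm y)).le_opNorm
    (φ.linear.symm (EuclideanSpace.single i 1))
  refine h5.trans ?_
  rw [div_eq_mul_one_div]
  exact mul_le_mul hB h4 (norm_nonneg _) ((norm_nonneg _).trans hB)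

namespace RefElement

variable {p : ℕ} (R : RefElement p)

/-- The local nodal interpolant on the element `φ '' refTet`. -/
noncomputable def localInterp (φ : E3 ≃ᵃ[ℝ] E3) (g : E3 → ℝ) (y : E3) : ℝ :=
  polyEval (R.interpPoly fun x => g (φ x)) (φ.symm y)

theorem contDiff_localInterp (φ : E3 ≃ᵃ[ℝ] E3) (g : E3 → ℝ) : ContDiff ℝ ∞ (R.localInterp φ g) :=
  TetMesh.contDiff_polyEval_symm φ _

theorem localInterp_eq_sum (φ : E3 ≃ᵃ[ℝ] E3) (g : E3 → ℝ) :
    R.localInterp φ g =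
      fun y => ∑ x ∈ R.nodes, g (φ x) * polyEval (R.basis x) (φ.symm y) :=
  funext fun _ => R.polyEval_interpPoly _ _

theorem localInterp_polyEval (φ : E3 ≃ᵃ[ℝ] E3) {q : MvPolynomial (Fin 3) ℝ} (hq : q ∈ Poly p) :
    R.localInterp φ (polyEval q) = polyEval q := by
  funext y
  have h : (fun x => polyEval q (φ x)) = polyEval (compAffine φ q) :=
    funext fun x => (polyEval_compAffine φ q x).symm
  rw [localInterp, h, R.interpPoly_polyEval (R.Poly_le_space (compAffine_mem_Poly φ hq)),
    polyEval_compAffine, AffineEquiv.apply_symm_apply]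

theorem localInterp_eq_add (φ : E3 ≃ᵃ[ℝ] E3) (g : E3 → ℝ) {q : MvPolynomial (Fin 3) ℝ}
    (hq : q ∈ Poly p) :
    R.localInterp φ g = R.localInterp φ (g - polyEval q) + polyEval q := by
  funext y
  have h := congrFun (R.localInterp_polyEval φ hq) y
  simp only [localInterp_eq_sum, Pi.add_apply, Pi.sub_apply, sub_mul, Finset.sum_sub_distrib]
    at h ⊢
  linarith

theorem abs_partialDeriv_localInterp_le {B : ℝ}
    (hB : ∀ x ∈ R.nodes, ∀ y ∈ refTet, ‖fderiv ℝ (polyEval (R.basis x)) y‖ ≤ B)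
    (φ : E3 ≃ᵃ[ℝ] E3) {z : E3} {r : ℝ} (hr : 0 < r)
    (hball : Metric.closedBall z r ⊆ φ '' refTet) {f : E3 → ℝ} {S : ℝ}
    (hf : ∀ x ∈ φ '' refTet, |f x| ≤ S) {y : E3} (hy : y ∈ φ '' refTet) (i : Fin 3) :
    |partialDeriv i (R.localInterp φ f) y| ≤ R.nodes.card * (S * (B / r)) := by
  have hy' : φ.symm y ∈ refTet := by
    obtain ⟨x, hx, rfl⟩ := hy
    simpa using hx
  have hS : 0 ≤ S := (abs_nonneg _).trans (hf y hy)
  have hd : ∀ x, DifferentiableAt ℝ (fun y => polyEval (R.basis x) (φ.symm y)) y := fun x =>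
    (TetMesh.contDiff_polyEval_symm φ _).differentiable (by simp) y
  have e : partialDeriv i (R.localInterp φ f) y = ∑ x ∈ R.nodes, f (φ x) *
      partialDeriv i (fun y => polyEval (R.basis x) (φ.symm y)) y := by
    rw [localInterp_eq_sum, partialDeriv, fderiv_fun_sum fun x _ => (hd x).const_mul _]
    simp only [_root_.sum_apply, fderiv_const_mul (hd _), _root_.smul_apply,
      smul_eq_mul]
    rfl
  rw [e]
  refine (Finset.abs_sum_le_sum_abs _ _).trans ?_
  rw [← nsmul_eq_mul]
  refine Finset.sum_le_card_nsmul _ _ _ fun x hx => ?_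
  rw [abs_mul]
  exact mul_le_mul (hf _ ⟨x, R.nodes_subset hx, rfl⟩)
    (abs_partialDeriv_comp_symm_le φ hr hball (hB x hx _ hy') i) (abs_nonneg _) hS

/-- Interpolation error in the energy seminorm on one element. -/
theorem exists_interp_bound (σ : ℝ) : ∃ C : ℝ, 0 < C ∧ ∀ (φ : E3 ≃ᵃ[ℝ] E3) (d r : ℝ) (z : E3),
    0 < d → 0 < r → Metric.closedBall z r ⊆ φ '' refTet → d ≤ σ * (2 * r) →
    (∀ y ∈ φ '' refTet, ∀ z ∈ φ '' refTet, ‖z - y‖ ≤ d) →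
    ∀ m, 2 ≤ m → m ≤ p + 1 → ∀ F : (Fin 3 → ℕ) → E3 → ℝ, IsFam (interior (φ '' refTet)) m F →
    ∀ g : E3 → ℝ, ContinuousOn g (φ '' refTet) →
    g =ᵐ[volume.restrict (interior (φ '' refTet))] F 0 →
    ∑ i, ∫ x in interior (φ '' refTet),
      (F (Pi.single i 1) x - partialDeriv i (R.localInterp φ g) x) ^ 2 ≤
        C * d ^ (2 * (m - 1)) *
          ∑ α ∈ multiIndices m, ∫ x in interior (φ '' refTet), F α x ^ 2 := by
  obtain ⟨B, hB0, hB⟩ := R.exists_basis_bound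
  set N : ℝ := (R.nodes.card : ℝ) with hN
  -- The factor `3` counts the partial derivatives. The first summand comes from approximation by a
  -- polynomial `q`, the second from the interpolant of `g - q`.
  refine ⟨3 * (2 * 2 ^ (20 * p) + 2 * ((N * (B * (2 * σ))) ^ 2 * 2 ^ (30 + 20 * (p + 1)))),
    by positivity, ?_⟩
  intro φ d r z hd0 hr hball hdr hd m hm2 hmp F hF g hg hgF
  set U := interior (φ '' refTet) with hU
  have hUb : Bornology.IsBounded U := isBounded_interior_elt φ
  have hV0 : 0 < volume.real U := by rw [volume_real_interior_elt]; exact volume_real_elt_pos φ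
  obtain ⟨q, hq, hq1, hq2, -⟩ := exists_poly_approx_sup (U := U) isOpen_interior
    (convex_elt φ).interior hUb (volume_interior_elt_ne_zero φ)
    (fun y hy z hz => hd y (interior_subset hy) z (interior_subset hz)) hm2 hF
    (hg.mono interior_subset) hgF (by omega : 1 ≤ m) le_rfl
  set E := ∑ α ∈ multiIndices m, ∫ x in U, F α x ^ 2 with hE
  have hLE : levelEnergy U F m ≤ E := levelEnergy_le_sum U F le_rfl
  have hL0 := levelEnergy_nonneg U F m
  have hE0 : 0 ≤ E := hL0.trans hLE
  set S2 := 2 ^ (30 + 20 * m) / volume.real U * (d ^ (2 * m) * levelEnergy U F m) with hS2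
  have hS20 : 0 ≤ S2 := by positivity
  have hsup : ∀ x ∈ φ '' refTet, |(g - polyEval q) x| ≤ √S2 := fun x hx =>
    Real.abs_le_sqrt (sq_sub_le_on_elt φ hg (continuous_polyEval q) (hq2 hm2) hx)
  have hqp : q ∈ Poly p := Poly_mono (by omega) hq
  have hterm : ∀ i, ∫ x in U, (F (Pi.single i 1) x - partialDeriv i (R.localInterp φ g) x) ^ 2 ≤
      (2 * 2 ^ (20 * p) + 2 * ((N * (B * (2 * σ))) ^ 2 * 2 ^ (30 + 20 * (p + 1)))) *
        d ^ (2 * (m - 1)) * E := by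
    intro i
    -- Interpolation reproduces `q`, so the interpolant of `g` is that of `g - q` plus `q`.
    have hsplit : partialDeriv i (R.localInterp φ g) =
        partialDeriv i (R.localInterp φ (g - polyEval q)) + partialDeriv i (polyEval q) := by
      funext x
      rw [R.localInterp_eq_add φ g hqp, partialDeriv, fderiv_add
        ((R.contDiff_localInterp φ _).differentiable (by simp) x)
        ((contDiff_polyEval q).differentiable (by simp) x)]
      rfl
    set f1 := F (Pi.single i 1) - multiDeriv (Pi.single i 1) (polyEval q) with hf1
    set f2 := partialDeriv i (R.localInterp φ (g - polyEval q)) with hf2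
    have m1 : MemLp f1 2 (volume.restrict U) :=
      (hF.1 _ (by simp; omega)).sub
        ((contDiff_multiDeriv (contDiff_polyEval q) _).continuous.memLp_restrict_of_isBounded hUb)
    have m2 : MemLp (-f2) 2 (volume.restrict U) :=
      ((contDiff_partialDeriv (R.contDiff_localInterp φ _) i).continuous.memLp_restrict_of_isBounded
        hUb).neg
    have e : ∀ x, F (Pi.single i 1) x - partialDeriv i (R.localInterp φ g) x =
        f1 x + (-f2) x := by
      intro x
      rw [hsplit, hf1, multiDeriv_single (contDiff_polyEval q)]
      simp only [Pi.add_apply, Pi.sub_apply, Pi.neg_apply]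
      ring
    have h1 : ∫ x in U, f1 x ^ 2 ≤ 2 ^ (20 * p) * d ^ (2 * (m - 1)) * E := by
      have := hq1 (Pi.single i 1) (by simp; omega)
      rw [show ∑ j, (Pi.single i 1 : Fin 3 → ℕ) j = 1 by simp] at this
      refine this.trans ?_
      rw [mul_pow, ← pow_mul, ← pow_mul]
      have : (2 : ℝ) ^ (20 * (m - 1)) ≤ 2 ^ (20 * p) :=
        pow_le_pow_right₀ (by norm_num) (by omega)
      gcongr
    have h2 : ∫ x in U, (-f2) x ^ 2 ≤
        (N * (B * (2 * σ))) ^ 2 * 2 ^ (30 + 20 * (p + 1)) * d ^ (2 * (m - 1)) * E := by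
      have hb : ∀ x ∈ U, ‖(-f2) x ^ 2‖ ≤ (N * (√S2 * (B / r))) ^ 2 := by
        intro x hx
        rw [Real.norm_of_nonneg (sq_nonneg _), Pi.neg_apply, neg_sq, ← sq_abs]
        exact pow_le_pow_left₀ (abs_nonneg _) (R.abs_partialDeriv_localInterp_le
          (fun x hx y hy => (hB x hx y hy).2) φ hr hball hsup (interior_subset hx) i) 2
      have h3 := norm_setIntegral_le_of_norm_le_const (μ := volume) (s := U) hUb.measure_lt_top hb
      refine (le_abs_self _).trans (h3.trans ?_)
      -- Shape regularity replaces the radius of the inscribed ball by the diameter.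
      have hrd : B / r ≤ B * (2 * σ) / d := by
        rw [div_le_div_iff₀ hr hd0]
        nlinarith
      calc (N * (√S2 * (B / r))) ^ 2 * volume.real U
          = N ^ 2 * (√S2 ^ 2 * (B / r) ^ 2) * volume.real U := by ring
        _ ≤ N ^ 2 * (√S2 ^ 2 * (B * (2 * σ) / d) ^ 2) * volume.real U := by gcongr
        _ = (N * (B * (2 * σ))) ^ 2 * 2 ^ (30 + 20 * m) * d ^ (2 * (m - 1)) *
            levelEnergy U F m := by
            rw [Real.sq_sqrt hS20, hS2, show 2 * m = 2 * (m - 1) + 2 by omega, pow_add d]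
            field_simp
        _ ≤ _ := by
            have : (2 : ℝ) ^ (30 + 20 * m) ≤ 2 ^ (30 + 20 * (p + 1)) :=
              pow_le_pow_right₀ (by norm_num) (by omega)
            gcongr
    simp_rw [e]
    refine (setIntegral_add_sq_le m1 m2).trans ?_
    linarith
  refine (Finset.sum_le_sum fun i _ => hterm i).trans (le_of_eq ?_)
  rw [Finset.sum_const, Finset.card_univ, Fintype.card_fin, nsmul_eq_mul]
  push_cast
  ring

end RefElement

end MassLump

namespace MassLump

open scoped ENNReal
open Filter Topology

/-! ### Local quadrature -/

namespace RefElement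

variable {p : ℕ} (R : RefElement p)

/-- The quadrature error for the product `f * w` on the element `φ '' refTet`. -/
noncomputable def quadErr (φ : E3 ≃ᵃ[ℝ] E3) (f w : E3 → ℝ) : ℝ :=
  (∫ x in interior (φ '' refTet), f x * w x) -
    volume.real (φ '' refTet) / volume.real refTet *
      ∑ x ∈ R.nodes, R.weight x * (f (φ x) * w (φ x))

theorem integrableOn_interior_elt (φ : E3 ≃ᵃ[ℝ] E3) {f : E3 → ℝ}
    (hf : ContinuousOn f (φ '' refTet)) : IntegrableOn f (interior (φ '' refTet)) :=
  (hf.integrableOn_compact (isCompact_elt φ)).mono_set interior_subset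

theorem quadErr_eq_zero {φ : E3 ≃ᵃ[ℝ] E3} {f w : E3 → ℝ} {q : MvPolynomial (Fin 3) ℝ}
    (hq : ∀ x ∈ refTet, f (φ x) * w (φ x) = polyEval q x)
    (hex : ∫ x in refTet, polyEval q x = ∑ x ∈ R.nodes, R.weight x * polyEval q x) :
    R.quadErr φ f w = 0 := by
  have h1 : ∫ x in interior (φ '' refTet), f x * w x = volume.real (φ '' refTet) /
      volume.real refTet * ∫ x in refTet, polyEval q x := by
    rw [setIntegral_congr_set (interior_ae_eq_elt φ), setIntegral_elt]
    congr 1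
    exact setIntegral_congr_fun isCompact_refTet.measurableSet hq
  rw [quadErr, h1, hex, sub_eq_zero]
  congr 1
  exact Finset.sum_congr rfl fun x hx => by rw [hq x (R.nodes_subset hx)]

theorem quadErr_polyEval (hR : R.ExactQuadrature) (φ : E3 ≃ᵃ[ℝ] E3) {q s : MvPolynomial (Fin 3) ℝ}
    (hq : q ∈ Poly (p - 2)) (hs : s ∈ R.space) {w : E3 → ℝ}
    (hw : ∀ x ∈ refTet, w (φ x) = polyEval s x) : R.quadErr φ (polyEval q) w = 0 := by
  refine R.quadErr_eq_zero (q := compAffine φ q * s) (fun x hx => ?_)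
    (hR _ (compAffine_mem_Poly φ hq) _ hs)
  rw [hw x hx, polyEval_mul, polyEval_compAffine]

/-- The factors of the exactness condition change roles: the constant is the element of `P_{p-2}`,
and `q` belongs to `P_p ⊆ Ũ`. Hence degree `p` is allowed against constants, but only `p - 2`
against general discrete functions. -/
theorem quadErr_const (hR : R.ExactQuadrature) (φ : E3 ≃ᵃ[ℝ] E3) {q : MvPolynomial (Fin 3) ℝ}
    (hq : q ∈ Poly p) (c : ℝ) : R.quadErr φ (polyEval q) (fun _ => c) = 0 := by
  refine R.quadErr_eq_zero (q := MvPolynomial.C c * compAffine φ q) (fun x _ => ?_)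
    (hR _ (C_mem_Poly _ _) _ (R.Poly_le_space (compAffine_mem_Poly φ hq)))
  rw [polyEval_mul, polyEval_compAffine, polyEval_C, mul_comm]

theorem quadErr_sub_left (φ : E3 ≃ᵃ[ℝ] E3) {f g w : E3 → ℝ} (hf : ContinuousOn f (φ '' refTet))
    (hg : ContinuousOn g (φ '' refTet)) (hw : ContinuousOn w (φ '' refTet)) :
    R.quadErr φ (f - g) w = R.quadErr φ f w - R.quadErr φ g w := by
  simp only [quadErr, Pi.sub_apply, sub_mul, mul_sub, Finset.sum_sub_distrib]
  rw [integral_sub (f := fun x => f x * w x) (g := fun x => g x * w x)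
    (integrableOn_interior_elt φ (hf.mul hw)) (integrableOn_interior_elt φ (hg.mul hw))]
  ring

theorem quadErr_sub_right (φ : E3 ≃ᵃ[ℝ] E3) {f w z : E3 → ℝ} (hf : ContinuousOn f (φ '' refTet))
    (hw : ContinuousOn w (φ '' refTet)) (hz : ContinuousOn z (φ '' refTet)) :
    R.quadErr φ f (w - z) = R.quadErr φ f w - R.quadErr φ f z := by
  simp only [quadErr, Pi.sub_apply, mul_sub, Finset.sum_sub_distrib]
  rw [integral_sub (f := fun x => f x * w x) (g := fun x => f x * z x)
    (integrableOn_interior_elt φ (hf.mul hw)) (integrableOn_interior_elt φ (hf.mul hz))]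
  ring

/-- The stability constant of the quadrature rule. -/
noncomputable def quadConst : ℝ := 1 + (∑ x ∈ R.nodes, |R.weight x|) / volume.real refTet

theorem quadConst_pos : 0 < R.quadConst := by
  have := volume_real_refTet_pos
  have h : 0 ≤ ∑ x ∈ R.nodes, |R.weight x| := Finset.sum_nonneg fun _ _ => abs_nonneg _
  unfold quadConst
  positivity

theorem quadErr_sq_le (φ : E3 ≃ᵃ[ℝ] E3) {f w : E3 → ℝ} {A B : ℝ}
    (hf : ∀ x ∈ φ '' refTet, f x ^ 2 ≤ A) (hw : ∀ x ∈ φ '' refTet, w x ^ 2 ≤ B) :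
    R.quadErr φ f w ^ 2 ≤ (volume.real (φ '' refTet) * R.quadConst) ^ 2 * (A * B) := by
  obtain ⟨y, hy⟩ := interior_elt_nonempty φ
  have hA : 0 ≤ A := (sq_nonneg _).trans (hf y (interior_subset hy))
  have hB : 0 ≤ B := (sq_nonneg _).trans (hw y (interior_subset hy))
  have hV := volume_real_elt_pos φ
  have hV' := volume_real_refTet_pos
  have hfw : ∀ x ∈ φ '' refTet, |f x * w x| ≤ √(A * B) := fun x hx => by
    refine Real.abs_le_sqrt ?_
    rw [mul_pow]
    exact mul_le_mul (hf x hx) (hw x hx) (sq_nonneg _) hA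
  have h1 : |∫ x in interior (φ '' refTet), f x * w x| ≤
      √(A * B) * volume.real (φ '' refTet) := by
    rw [← volume_real_interior_elt]
    exact norm_setIntegral_le_of_norm_le_const (μ := volume) (f := fun x => f x * w x)
      (isBounded_interior_elt φ).measure_lt_top fun x hx => hfw x (interior_subset hx)
  have h2 : |∑ x ∈ R.nodes, R.weight x * (f (φ x) * w (φ x))| ≤
      (∑ x ∈ R.nodes, |R.weight x|) * √(A * B) := by
    refine (Finset.abs_sum_le_sum_abs _ _).trans ?_
    rw [Finset.sum_mul]
    refine Finset.sum_le_sum fun x hx => ?_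
    rw [abs_mul]
    exact mul_le_mul_of_nonneg_left (hfw _ ⟨x, R.nodes_subset hx, rfl⟩) (abs_nonneg _)
  have h3 : |R.quadErr φ f w| ≤ volume.real (φ '' refTet) * R.quadConst * √(A * B) := by
    refine (abs_sub _ _).trans ?_
    rw [abs_mul, abs_of_pos (div_pos hV hV')]
    have h4 := mul_le_mul_of_nonneg_left h2 (div_pos hV hV').le
    calc _ ≤ √(A * B) * volume.real (φ '' refTet) + volume.real (φ '' refTet) /
          volume.real refTet * ((∑ x ∈ R.nodes, |R.weight x|) * √(A * B)) := add_le_add h1 h4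
      _ = _ := by unfold quadConst; ring
  calc R.quadErr φ f w ^ 2 = |R.quadErr φ f w| ^ 2 := (sq_abs _).symm
    _ ≤ (volume.real (φ '' refTet) * R.quadConst * √(A * B)) ^ 2 :=
        pow_le_pow_left₀ (abs_nonneg _) h3 2
    _ = _ := by rw [mul_pow, Real.sq_sqrt (mul_nonneg hA hB)]

/-- The supremum of a function of the discrete space on an element is controlled by its
`L²`-norm. -/
theorem exists_elt_sup_le : ∃ C : ℝ, 0 < C ∧ ∀ (φ : E3 ≃ᵃ[ℝ] E3) (w : E3 → ℝ),
    ∀ s ∈ R.space, (∀ x ∈ refTet, w (φ x) = polyEval s x) → ∀ y ∈ φ '' refTet,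
      w y ^ 2 ≤ C / volume.real (φ '' refTet) * ∫ x in interior (φ '' refTet), w x ^ 2 := by
  obtain ⟨C, hC0, hC⟩ := R.exists_sup_le
  have hV' := volume_real_refTet_pos
  refine ⟨C * volume.real refTet, by positivity, ?_⟩
  rintro φ w s hs hw _ ⟨x, hx, rfl⟩
  have hV := volume_real_elt_pos φ
  rw [setIntegral_congr_set (interior_ae_eq_elt φ), setIntegral_elt φ fun x => w x ^ 2, hw x hx,
    setIntegral_congr_fun (g := fun x => polyEval s x ^ 2) isCompact_refTet.measurableSet
      fun x hx => by simp only [hw x hx]]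
  refine (hC s hs x hx).trans (le_of_eq ?_)
  field_simp

/-- Collects the two parts of the quadrature error, with `a = d ^ (2 * m)` and `b = d ^ 2`; `E` is
the energy of `v`, and `W`, `S` are those of `w` and its gradient. -/
theorem quad_const_le {K L a b E W S : ℝ} (hK : 0 ≤ K) (hL : 0 ≤ L) (ha : 0 ≤ a) (hb : 0 ≤ b)
    (hE : 0 ≤ E) (hW : 0 ≤ W) (hS : 0 ≤ S) :
    2 * (K * a * E * W) + 2 * (K * L * 2 ^ 18 * (a * (1 + b)) * E * S) ≤
      (2 * K + 2 * K * L * 2 ^ 18) * a * (1 + b) * E * (W + S) := by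
  have h1 : 0 ≤ K * a * E := by positivity
  have h2 : 0 ≤ K * L * (a * (1 + b)) * E := by positivity
  have h3 := mul_nonneg h1 hS
  have h4 := mul_nonneg h1 (mul_nonneg hb (add_nonneg hW hS))
  have h5 := mul_nonneg h2 hW
  nlinarith

/-- Quadrature error on one element. -/
theorem exists_quad_bound (hp : 2 ≤ p) (hR : R.ExactQuadrature) : ∃ C : ℝ, 0 < C ∧
    ∀ (φ : E3 ≃ᵃ[ℝ] E3) (d : ℝ),
    (∀ y ∈ φ '' refTet, ∀ z ∈ φ '' refTet, ‖z - y‖ ≤ d) →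
    ∀ m, 2 ≤ m → m ≤ p → ∀ F : (Fin 3 → ℕ) → E3 → ℝ, IsFam (interior (φ '' refTet)) m F →
    ∀ g : E3 → ℝ, ContinuousOn g (φ '' refTet) →
    g =ᵐ[volume.restrict (interior (φ '' refTet))] F 0 →
    ∀ w : E3 → ℝ, ∀ s ∈ R.space, (∀ x ∈ refTet, w (φ x) = polyEval s x) →
    ∀ G : Fin 3 → E3 → ℝ, IsWeakGrad (interior (φ '' refTet)) w G →
    R.quadErr φ g w ^ 2 ≤ C * d ^ (2 * m) * (1 + d ^ 2) *
      (∑ α ∈ multiIndices m, ∫ x in interior (φ '' refTet), F α x ^ 2) *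
      ((∫ x in interior (φ '' refTet), w x ^ 2) +
        ∑ i, ∫ x in interior (φ '' refTet), G i x ^ 2) := by
  obtain ⟨C₁, hC₁, hsup⟩ := R.exists_elt_sup_le
  set κ := R.quadConst with hκ
  have hκ0 : 0 < κ := R.quadConst_pos
  set M : ℝ := 2 ^ (30 + 20 * p) with hM
  have hM0 : 0 < M := by positivity
  refine ⟨2 * (κ ^ 2 * M) + 2 * (κ ^ 2 * M) * C₁ * 2 ^ 18, by positivity, ?_⟩
  intro φ d hd m hm2 hmp F hF g hg hgF w s hs hw G hG
  set U := interior (φ '' refTet) with hU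
  set V := volume.real (φ '' refTet) with hV
  have hVU : volume.real U = V := volume_real_interior_elt φ
  have hUb : Bornology.IsBounded U := isBounded_interior_elt φ
  have hfin : IsFiniteMeasure (volume.restrict U) := ⟨by simpa using hUb.measure_lt_top⟩
  have hV0 : 0 < V := volume_real_elt_pos φ
  have hd0 : 0 ≤ d := by
    obtain ⟨y, hy⟩ := interior_elt_nonempty φ
    exact (norm_nonneg _).trans (hd y (interior_subset hy) y (interior_subset hy))
  have hdU : ∀ y ∈ U, ∀ z ∈ U, ‖z - y‖ ≤ d :=
    fun y hy z hz => hd y (interior_subset hy) z (interior_subset hz)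
  have hU0 := volume_interior_elt_ne_zero φ
  have hUc : Convex ℝ U := (convex_elt φ).interior
  -- The degree of `q` is at most `m - 1 ≤ p`, for use against the mean of `w`; that of `q'` below
  -- is at most `m - 2 ≤ p - 2`, for use against `w` minus its mean.
  obtain ⟨q, hq, -, hq1, -⟩ := exists_poly_approx_sup isOpen_interior hUc hUb hU0 hdU hm2 hF
    (hg.mono interior_subset) hgF (by omega : 1 ≤ m) le_rfl
  obtain ⟨q', hq', -, -, hq1'⟩ := exists_poly_approx_sup isOpen_interior hUc hUb hU0 hdU hm2 hF
    (hg.mono interior_subset) hgF (by omega : 1 ≤ m - 1) (by omega)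
  rw [show m - 1 + 1 = m by omega, show m - 1 - 1 = m - 2 by omega] at *
  have hqp : q ∈ Poly p := Poly_mono (by omega) hq
  have hqp' : q' ∈ Poly (p - 2) := Poly_mono (by omega) hq'
  set c := (∫ x in U, w x) / V with hc
  have hwc : ContinuousOn w (φ '' refTet) := by
    refine (TetMesh.contDiff_polyEval_symm φ s).continuous.continuousOn.congr ?_
    rintro _ ⟨x, hx, rfl⟩
    simp only [hw x hx, AffineEquiv.symm_apply_apply]
  have hqc : ∀ q, ContinuousOn (polyEval q) (φ '' refTet) := fun q =>
    (continuous_polyEval q).continuousOn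
  have hcc : ContinuousOn (fun _ : E3 => c) (φ '' refTet) := continuousOn_const
  have hw' : ∀ x ∈ refTet, (w - fun _ => c : E3 → ℝ) (φ x) = polyEval (s - MvPolynomial.C c) x := by
    intro x hx
    rw [Pi.sub_apply, hw x hx, polyEval_sub, Pi.sub_apply, polyEval_C]
  have hs' : s - MvPolynomial.C c ∈ R.space :=
    Submodule.sub_mem _ hs (R.Poly_le_space (C_mem_Poly _ _))
  -- Subtracting `q` and `q'` changes nothing, as the rule is exact for `q c` and for `q' (w - c)`.
  have hsplit : R.quadErr φ g w = R.quadErr φ (g - polyEval q) (fun _ => c) +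
      R.quadErr φ (g - polyEval q') (w - fun _ => c) := by
    rw [R.quadErr_sub_left φ hg (hqc q) hcc, R.quadErr_const hR φ hqp,
      R.quadErr_sub_left φ hg (hqc q') (hwc.sub hcc), R.quadErr_polyEval hR φ hqp' hs' hw',
      R.quadErr_sub_right φ hg hwc hcc]
    ring
  set E := ∑ α ∈ multiIndices m, ∫ x in U, F α x ^ 2 with hE
  have hL1 : levelEnergy U F m ≤ E := levelEnergy_le_sum U F le_rfl
  have hL2 : levelEnergy U F (m - 1) ≤ E := levelEnergy_le_sum U F (by omega)
  have hL10 := levelEnergy_nonneg U F m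
  have hL20 := levelEnergy_nonneg U F (m - 1)
  have hE0 : 0 ≤ E := hL10.trans hL1
  set W := ∫ x in U, w x ^ 2 with hW
  have hW0 : 0 ≤ W := setIntegral_sq_nonneg _ _
  set S := ∑ i, ∫ x in U, G i x ^ 2 with hS
  have hS0 : 0 ≤ S := Finset.sum_nonneg fun _ _ => setIntegral_sq_nonneg _ _
  have hc2 : c ^ 2 ≤ W / V := by
    have h1 := setIntegral_mul_sq_le (U := U) (memLp_const 1) hG.1
    simp only [one_mul, one_pow, setIntegral_const, smul_eq_mul, mul_one] at h1
    rw [hc, div_pow, div_le_div_iff₀ (by positivity) hV0]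
    rw [hVU] at h1
    nlinarith
  have hmean : ∫ x in U, (w - fun _ => c : E3 → ℝ) x = 0 := by
    simp only [Pi.sub_apply]
    rw [integral_sub (hG.1.integrable one_le_two) (integrable_const c), setIntegral_const, hVU,
      smul_eq_mul, hc, mul_div_cancel₀ _ hV0.ne', sub_self]
  have hGc : IsWeakGrad U (w - fun _ => c) G := by
    have := hG.sub (⟨memLp_const c, fun i => isWeakDeriv_of_contDiff hUb contDiff_const i⟩ :
      IsWeakGrad U (fun _ => c) fun i => partialDeriv i fun _ => c)
    have e : ∀ i, partialDeriv i (fun _ : E3 => c) = 0 := fun i => by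
      funext x
      simp [partialDeriv]
    simpa only [e, sub_zero] using this
  have hP := hGc.poincare_real isOpen_interior hUc hUb hdU hmean
  have hA : ∀ x ∈ φ '' refTet, (g - polyEval q) x ^ 2 ≤ M / V * (d ^ (2 * m) * E) := fun x hx => by
    refine (sq_sub_le_on_elt φ hg (continuous_polyEval q) (hq1 hm2) hx).trans ?_
    rw [hVU]
    have : (2 : ℝ) ^ (30 + 20 * m) ≤ M := pow_le_pow_right₀ (by norm_num) (by omega)
    gcongr
  have hA' : ∀ x ∈ φ '' refTet, (g - polyEval q') x ^ 2 ≤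
      M / V * (d ^ (2 * (m - 1)) * E + d ^ (2 * m) * E) := fun x hx => by
    refine (sq_sub_le_on_elt φ hg (continuous_polyEval q') hq1' hx).trans ?_
    rw [hVU]
    have : (2 : ℝ) ^ (30 + 20 * (m - 1)) ≤ M := pow_le_pow_right₀ (by norm_num) (by omega)
    gcongr
  -- The Poincaré inequality for `w - c` supplies the factor `d ^ 2` that the bound for `g - q'`
  -- lacks.
  have hB : ∀ x ∈ φ '' refTet, (w - fun _ => c : E3 → ℝ) x ^ 2 ≤ C₁ / V * (2 ^ 18 * d ^ 2 * S) :=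
    fun x hx => (hsup φ _ _ hs' hw' x hx).trans (by gcongr)
  have e1 := R.quadErr_sq_le φ hA (w := fun _ => c) (B := W / V) fun _ _ => hc2
  have e2 := R.quadErr_sq_le φ hA' hB
  have f1 : (V * κ) ^ 2 * (M / V * (d ^ (2 * m) * E) * (W / V)) =
      κ ^ 2 * M * d ^ (2 * m) * E * W := by
    field_simp
  have f2 : (V * κ) ^ 2 * (M / V * (d ^ (2 * (m - 1)) * E + d ^ (2 * m) * E) *
      (C₁ / V * (2 ^ 18 * d ^ 2 * S))) =
      κ ^ 2 * M * C₁ * 2 ^ 18 * (d ^ (2 * m) * (1 + d ^ 2)) * E * S := by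
    rw [show d ^ (2 * m) = d ^ (2 * (m - 1)) * d ^ 2 by rw [← pow_add]; congr 1; omega]
    field_simp
  rw [f1] at e1
  rw [f2] at e2
  have e3 : R.quadErr φ g w ^ 2 ≤ 2 * (κ ^ 2 * M * d ^ (2 * m) * E * W) +
      2 * (κ ^ 2 * M * C₁ * 2 ^ 18 * (d ^ (2 * m) * (1 + d ^ 2)) * E * S) := by
    rw [hsplit]
    refine add_sq_le.trans ?_
    rw [mul_add]
    exact add_le_add (mul_le_mul_of_nonneg_left e1 zero_le_two)
      (mul_le_mul_of_nonneg_left e2 zero_le_two)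
  refine e3.trans ?_
  exact quad_const_le (by positivity) (by positivity) (by positivity) (sq_nonneg d) hE0 hW0 hS0

end RefElement

end MassLump

namespace MassLump

open scoped ENNReal
open Filter Topology

/-! ### The Poincaré inequality in `H₀¹` -/

/-- The Sobolev inequality for functions supported in a bounded set, with both exponents equal to
`2`. -/
theorem exists_poincare_testFun {Ω : Set E3} (hΩb : Bornology.IsBounded Ω) :
    ∃ C : ℝ, 0 ≤ C ∧ ∀ φ, IsTestFun Ω φ →
      ∫ x in Ω, φ x ^ 2 ≤ C * ∑ i, ∫ x in Ω, partialDeriv i φ x ^ 2 := by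
  set K := eLpNormLESNormFDerivOfLeConst ℝ (volume : Measure E3) Ω 2 2 with hK
  refine ⟨(K : ℝ) ^ 2, by positivity, fun φ hφ => ?_⟩
  have h1 := eLpNorm_le_eLpNorm_fderiv_of_le (μ := (volume : Measure E3)) (u := φ) (s := Ω)
    (p := 2) (q := 2) (hφ.1.of_le (by simp)) ((subset_tsupport φ).trans hφ.2.2) (by norm_num)
    (by simp; norm_num) (by simp) hΩb
  have e : ∀ f : E3 → ℝ, IsTestFun Ω f →
      ∫⁻ x, ‖f x‖ₑ ^ 2 = ENNReal.ofReal (∫ x in Ω, f x ^ 2) := by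
    intro f hf
    rw [← lintegral_enorm_sq (hf.memLp _), setLIntegral_eq_of_support_subset]
    intro x hx
    by_contra hxΩ
    exact hx (by simp [hf.eq_zero hxΩ])
  have hsq : ∀ {F : Type} [NormedAddCommGroup F] (f : E3 → F),
      eLpNorm f 2 volume ^ 2 = ∫⁻ x, ‖f x‖ₑ ^ 2 := by
    intro F _ f
    rw [← ENNReal.rpow_natCast, eLpNorm_eq_lintegral_rpow_enorm_toReal
      two_ne_zero ENNReal.ofNat_ne_top, ← ENNReal.rpow_mul]
    norm_num
  have h2 : eLpNorm φ 2 volume ^ 2 ≤ (K * eLpNorm (fderiv ℝ φ) 2 volume) ^ 2 := by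
    gcongr
    simpa using h1
  rw [mul_pow, hsq, hsq, e φ hφ] at h2
  have h3 : ∫⁻ x, ‖fderiv ℝ φ x‖ₑ ^ 2 ≤
      ENNReal.ofReal (∑ i, ∫ x in Ω, partialDeriv i φ x ^ 2) := by
    rw [ENNReal.ofReal_sum_of_nonneg fun i _ => setIntegral_sq_nonneg _ _]
    simp_rw [fun i => (e _ (hφ.partialDeriv i)).symm]
    rw [← lintegral_finsetSum _ fun i _ =>
      ((contDiff_partialDeriv hφ.1 i).continuous.measurable.enorm.pow_const 2)]
    exact lintegral_mono fun x => enorm_fderiv_sq_le φ x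
  have h4 := h2.trans (mul_le_mul_right h3 _)
  have e2 : (K : ℝ≥0∞) ^ 2 = ENNReal.ofReal ((K : ℝ) ^ 2) := by
    rw [ENNReal.ofReal_pow (NNReal.coe_nonneg K), ENNReal.ofReal_coe_nnreal]
  rw [e2, ← ENNReal.ofReal_mul (by positivity)] at h4
  refine (ENNReal.ofReal_le_ofReal_iff ?_).1 h4
  exact mul_nonneg (by positivity) (Finset.sum_nonneg fun i _ => setIntegral_sq_nonneg _ _)

/-- The inequality for test functions passes to their closure: two uses of the triangle inequality
produce the factor `4`, and the approximation error `ε` tends to `0`. -/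
theorem exists_poincare_memH10 {Ω : Set E3} (hΩ : IsOpen Ω) (hΩb : Bornology.IsBounded Ω) :
    ∃ C : ℝ, 0 < C ∧ ∀ (u : E3 → ℝ) (G : Fin 3 → E3 → ℝ), MemH10 Ω u → IsWeakGrad Ω u G →
      sobolevNorm Ω 1 u ^ 2 ≤ C * ∑ i, ∫ x in Ω, G i x ^ 2 := by
  obtain ⟨P, hP0, hP⟩ := exists_poincare_testFun hΩb
  refine ⟨4 * (1 + P), by positivity, fun u G hu hG => ?_⟩
  set S := ∑ i, ∫ x in Ω, G i x ^ 2 with hS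
  have hlim : ∀ ε > 0, sobolevNorm Ω 1 u ^ 2 ≤ 4 * (1 + P) * S + (2 + 4 * (1 + P)) * ε ^ 2 := by
    intro ε hε
    obtain ⟨φ, hφ, hlt⟩ := hu.2 ε hε
    have hφG := hφ.isWeakGrad hΩb
    have hd := hG.sub hφG
    have h1 := hd.sobolevNorm_add_sq_le hΩ hφG
    rw [sub_add_cancel] at h1
    have h2 := hφG.sobolevNorm_sq hΩ
    have h3 := hP φ hφ
    have h4 : ∑ i, ∫ x in Ω, partialDeriv i φ x ^ 2 ≤
        2 * S + 2 * sobolevNorm Ω 1 (u - φ) ^ 2 := by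
      rw [hd.sobolevNorm_sq hΩ, hS, mul_add, Finset.mul_sum, Finset.mul_sum]
      have : ∀ i, ∫ x in Ω, partialDeriv i φ x ^ 2 ≤ 2 * (∫ x in Ω, G i x ^ 2) +
          2 * ∫ x in Ω, (G i - partialDeriv i φ) x ^ 2 := by
        intro i
        have h := setIntegral_add_sq_le (hG.2 i).1 (hd.2 i).1.neg
        have e : ∀ x, G i x + (-(G i - partialDeriv i φ)) x = partialDeriv i φ x := fun x => by
          simp
        simp only [e] at h
        simpa only [Pi.neg_apply, neg_sq] using h
      have h5 := Finset.sum_le_sum fun i (_ : i ∈ (Finset.univ : Finset (Fin 3))) => this i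
      rw [Finset.sum_add_distrib] at h5
      have h6 := setIntegral_sq_nonneg Ω (u - φ)
      linarith
    have h0 := sobolevNorm_nonneg Ω 1 (u - φ)
    have h5 : sobolevNorm Ω 1 (u - φ) ^ 2 ≤ ε ^ 2 := by gcongr
    have h6 : (1 + P) * ∑ i, ∫ x in Ω, partialDeriv i φ x ^ 2 ≤
        (1 + P) * (2 * S + 2 * ε ^ 2) := by
      gcongr
      linarith
    nlinarith
  have ht : Tendsto (fun ε : ℝ => 4 * (1 + P) * S + (2 + 4 * (1 + P)) * ε ^ 2) (𝓝[>] 0)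
      (𝓝 (4 * (1 + P) * S + (2 + 4 * (1 + P)) * 0 ^ 2)) :=
    (Continuous.tendsto (by fun_prop) 0).mono_left nhdsWithin_le_nhds
  have := ge_of_tendsto ht (eventually_mem_nhdsWithin.mono fun ε hε => hlim ε hε)
  simpa using this

end MassLump

namespace MassLump

open scoped ENNReal
open Filter Topology

/-! ### Global estimates -/

theorem sq_sum_le_of_sq_le {ι : Type*} (s : Finset ι) {a b c : ι → ℝ} {K : ℝ} (hK : 0 ≤ K)
    (hb : ∀ i ∈ s, 0 ≤ b i) (hc : ∀ i ∈ s, 0 ≤ c i)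
    (h : ∀ i ∈ s, a i ^ 2 ≤ K * b i * c i) :
    (∑ i ∈ s, a i) ^ 2 ≤ K * (∑ i ∈ s, b i) * ∑ i ∈ s, c i := by
  rw [Finset.mul_sum s b K]
  exact Finset.sum_sq_le_sum_mul_sum_of_sq_le_mul s (fun i hi => mul_nonneg hK (hb i hi)) hc h

/-- Lowers the local order `d ^ m` to the common rate `h ^ s`; surplus powers of `d` are absorbed by
the bound `D` for the diameter of the domain. -/
theorem pow_le_pow_mul_pow {d h D : ℝ} (hd : 0 ≤ d) (hdh : d ≤ h) (hdD : d ≤ D) (hD : 1 ≤ D)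
    {s m k : ℕ} (hsm : s ≤ m) (hmk : m ≤ k) : d ^ m ≤ h ^ s * D ^ k := by
  obtain ⟨t, rfl⟩ := Nat.exists_eq_add_of_le hsm
  rw [pow_add]
  have h1 : d ^ s ≤ h ^ s := pow_le_pow_left₀ hd hdh s
  have h2 : d ^ t ≤ D ^ k :=
    (pow_le_pow_left₀ hd hdD t).trans (pow_le_pow_right₀ hD (by omega))
  exact mul_le_mul h1 h2 (by positivity) (pow_nonneg (hd.trans hdh) s)

theorem MemH.sobolevNorm_sq {Ω : Set E3} {m : ℕ} {v : E3 → ℝ} (h : MemH Ω m v) :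
    sobolevNorm Ω m v ^ 2 = ∑ α ∈ multiIndices m, ∫ x in Ω, weakDeriv Ω α v x ^ 2 := by
  unfold sobolevNorm
  rw [Real.sq_sqrt (Finset.sum_nonneg fun _ _ => sq_nonneg _)]
  exact Finset.sum_congr rfl fun α hα => l2Norm_sq (h.isWeakDeriv (mem_multiIndices.1 hα)).1

theorem MemH.mono {Ω : Set E3} {k m : ℕ} (hk : k ≤ m) {v : E3 → ℝ} (h : MemH Ω m v) :
    MemH Ω k v := ⟨h.1, fun α hα => h.2 α (hα.trans hk)⟩

theorem IsWeakGrad.mono {U Ω : Set E3} (hΩ : IsOpen Ω) (hUΩ : U ⊆ Ω) {u : E3 → ℝ}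
    {G : Fin 3 → E3 → ℝ} (h : IsWeakGrad Ω u G) : IsWeakGrad U u G :=
  ⟨h.1.mono_measure (Measure.restrict_mono hUΩ le_rfl),
    fun i => (h.2 i).mono hΩ.measurableSet hUΩ⟩

namespace TetMesh

variable {Ω : Set E3} {p : ℕ} (R : RefElement p)

theorem sum_sobolev_eq (T : TetMesh Ω) (hΩ : IsOpen Ω) (hL : HasLipschitzBoundary Ω) {m : ℕ}
    {v : E3 → ℝ} (h : MemH Ω m v) :
    ∑ e, ∑ α ∈ multiIndices m, ∫ x in interior (T.elt e), weakDeriv Ω α v x ^ 2 =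
      sobolevNorm Ω m v ^ 2 := by
  rw [h.sobolevNorm_sq, Finset.sum_comm]
  exact Finset.sum_congr rfl fun α hα => (T.setIntegral_eq_sum hΩ hL
    (h.isWeakDeriv (mem_multiIndices.1 hα)).1.integrable_sq).symm

theorem weakDeriv_zero_ae_eq (hΩ : IsOpen Ω) {u : E3 → ℝ} (hu : MemLp u 2 (volume.restrict Ω)) :
    weakDeriv Ω 0 u =ᵐ[volume.restrict Ω] u := weakDeriv_ae_eq hΩ (isWeakDeriv_zero hu)

/-- The quadrature error for `v` against a function of the discrete space. -/
theorem exists_quad_error_le (hΩ : IsOpen Ω) (hΩb : Bornology.IsBounded Ω)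
    (hL : HasLipschitzBoundary Ω) (hp : 2 ≤ p) (hR : R.ExactQuadrature) : ∃ C : ℝ, 0 < C ∧
    ∀ (T : TetMesh Ω) (m s : ℕ), 2 ≤ m → m ≤ p → s ≤ m → ∀ v w : E3 → ℝ, MemH Ω m v →
      ContinuousOn v (closure Ω) → T.MemUh R w →
      ((∫ x in Ω, v x * w x) - T.quad R v w) ^ 2 ≤
        C * (T.size ^ s) ^ 2 * sobolevNorm Ω m v ^ 2 * sobolevNorm Ω 1 w ^ 2 := by
  obtain ⟨C, hC0, hC⟩ := R.exists_quad_bound hp hR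
  set D := max 1 (Metric.diam (closure Ω)) with hD
  have hD1 : 1 ≤ D := le_max_left _ _
  refine ⟨C * (D ^ p) ^ 2 * (1 + D ^ 2), by positivity, ?_⟩
  intro T m s hm2 hmp hsm v w hv hvc hw
  have hwG := hw.1.1.isWeakGrad
  have hsplit : (∫ x in Ω, v x * w x) - T.quad R v w = ∑ e, R.quadErr (T.φ e) v w := by
    rw [T.setIntegral_eq_sum hΩ hL (integrable_mul_of_memLp hv.1 hw.1.1.1), quad,
      ← Finset.sum_sub_distrib]
    rfl
  have hN : ∑ e, ((∫ x in interior (T.elt e), w x ^ 2) +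
      ∑ i, ∫ x in interior (T.elt e), weakDeriv Ω (Pi.single i 1) w x ^ 2) =
      sobolevNorm Ω 1 w ^ 2 := by
    rw [hwG.sobolevNorm_sq hΩ, Finset.sum_add_distrib, Finset.sum_comm,
      ← T.setIntegral_eq_sum hΩ hL hwG.1.integrable_sq]
    congr 1
    exact Finset.sum_congr rfl fun i _ =>
      (T.setIntegral_eq_sum hΩ hL (hwG.2 i).1.integrable_sq).symm
  rw [hsplit, ← T.sum_sobolev_eq hΩ hL hv, ← hN]
  refine sq_sum_le_of_sq_le _ (by positivity) (fun e _ => sum_multiIndices_nonneg _ _ _)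
    (fun e _ => add_nonneg (setIntegral_sq_nonneg _ _)
      (Finset.sum_nonneg fun _ _ => setIntegral_sq_nonneg _ _)) fun e _ => ?_
  obtain ⟨q, hq, hqw⟩ := hw.2 e
  have hsub := T.interior_elt_subset hΩ hL e
  set d := Metric.diam (T.elt e) with hd
  have hd0 : 0 < d := T.diam_pos e
  have hdD : d ≤ D := (T.diam_le_diam hΩb e).trans (le_max_right _ _)
  have h1 := hC (T.φ e) d (fun y hy z hz => T.dist_le_diam hz hy) m hm2 hmp
    (fun α => weakDeriv Ω α v) (hv.isFam.mono hΩ hsub le_rfl) v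
    (hvc.mono (T.elt_subset_closure e))
    (Filter.EventuallyEq.symm
      (ae_mono (Measure.restrict_mono hsub le_rfl) (weakDeriv_zero_ae_eq hΩ hv.1)))
    w q hq hqw _ (hwG.mono hΩ hsub)
  refine h1.trans ?_
  have h2 : d ^ m ≤ T.size ^ s * D ^ p :=
    pow_le_pow_mul_pow hd0.le (T.diam_le_size hΩb e) hdD hD1 hsm hmp
  have hE0 := sum_multiIndices_nonneg (interior (T.elt e)) (fun α => weakDeriv Ω α v) m
  have hN0 : 0 ≤ (∫ x in interior (T.elt e), w x ^ 2) +
      ∑ i, ∫ x in interior (T.elt e), weakDeriv Ω (Pi.single i 1) w x ^ 2 :=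
    add_nonneg (setIntegral_sq_nonneg _ _) (Finset.sum_nonneg fun _ _ => setIntegral_sq_nonneg _ _)
  have h3 : C * d ^ (2 * m) * (1 + d ^ 2) ≤ C * (D ^ p) ^ 2 * (1 + D ^ 2) * (T.size ^ s) ^ 2 := by
    calc C * d ^ (2 * m) * (1 + d ^ 2) = C * (d ^ m) ^ 2 * (1 + d ^ 2) := by
          rw [← pow_mul, mul_comm m]
      _ ≤ C * (T.size ^ s * D ^ p) ^ 2 * (1 + D ^ 2) := by gcongr
      _ = _ := by ring
  exact mul_le_mul_of_nonneg_right (mul_le_mul_of_nonneg_right h3 hE0) hN0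

/-- The interpolation error in the energy seminorm. -/
theorem exists_interp_error_le (hΩ : IsOpen Ω) (hΩb : Bornology.IsBounded Ω)
    (hL : HasLipschitzBoundary Ω) (σ : ℝ) : ∃ C : ℝ, 0 < C ∧
    ∀ T : TetMesh Ω, T.ShapeRegular σ → ∀ m s : ℕ, 2 ≤ m → m ≤ p + 1 → s ≤ m - 1 →
      ∀ u g : E3 → ℝ, MemH Ω m u → Continuous g → g =ᵐ[volume.restrict Ω] u →
      ∀ G : Fin 3 → E3 → ℝ, IsWeakGrad Ω (T.interp R g) G →
      ∑ i, ∫ x in Ω, (weakDeriv Ω (Pi.single i 1) u - G i) x ^ 2 ≤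
        C * (T.size ^ s) ^ 2 * sobolevNorm Ω m u ^ 2 := by
  obtain ⟨C, hC0, hC⟩ := R.exists_interp_bound σ
  set D := max 1 (Metric.diam (closure Ω)) with hD
  have hD1 : 1 ≤ D := le_max_left _ _
  refine ⟨C * (D ^ p) ^ 2, by positivity, ?_⟩
  intro T hT m s hm2 hmp hsm u g hu hg hgu G hG
  have hu1 := (hu.mono (by omega : 1 ≤ m)).isWeakGrad
  rw [← T.sum_sobolev_eq hΩ hL hu, Finset.mul_sum]
  simp_rw [fun i => T.setIntegral_eq_sum hΩ hL ((hu1.sub hG).2 i).1.integrable_sq]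
  rw [Finset.sum_comm]
  refine Finset.sum_le_sum fun e _ => ?_
  have hsub := T.interior_elt_subset hΩ hL e
  have hUb := isBounded_interior_elt (T.φ e)
  set d := Metric.diam (T.elt e) with hd
  have hd0 : 0 < d := T.diam_pos e
  have hdD : d ≤ D := (T.diam_le_diam hΩb e).trans (le_max_right _ _)
  obtain ⟨z, r, hr, hball, hdr⟩ := hT e
  have hmono : ∀ {f k : E3 → ℝ}, f =ᵐ[volume.restrict Ω] k →
      f =ᵐ[volume.restrict (interior (T.elt e))] k := fun h =>
    ae_mono (Measure.restrict_mono hsub le_rfl) h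
  have h1 := hC (T.φ e) d r z hd0 hr hball hdr (fun y hy z hz => T.dist_le_diam hz hy) m hm2 hmp
    (fun α => weakDeriv Ω α u) (hu.isFam.mono hΩ hsub le_rfl) g hg.continuousOn
    ((hmono hgu).trans (hmono (weakDeriv_zero_ae_eq hΩ hu.1)).symm)
  -- Inside an element the interpolant coincides with a smooth local interpolant, so uniqueness of
  -- weak derivatives identifies its gradient.
  have h2 : ∀ i, G i =ᵐ[volume.restrict (interior (T.elt e))]
      partialDeriv i (R.localInterp (T.φ e) g) := by
    intro i
    refine ((hG.mono hΩ hsub).2 i).unique isOpen_interior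
      ((isWeakDeriv_of_contDiff hUb (R.contDiff_localInterp (T.φ e) g) i).congr ?_ (ae_eq_refl _))
    filter_upwards [ae_restrict_mem isOpen_interior.measurableSet] with x hx
    exact (T.interp_eq R (interior_subset hx) g).symm
  have h3 : ∀ i, ∫ x in interior (T.elt e), (weakDeriv Ω (Pi.single i 1) u - G i) x ^ 2 =
      ∫ x in interior (T.elt e), (weakDeriv Ω (Pi.single i 1) u x -
        partialDeriv i (R.localInterp (T.φ e) g) x) ^ 2 := fun i =>
    integral_congr_ae ((h2 i).mono fun x hx => by simp only [Pi.sub_apply, hx])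
  simp_rw [h3]
  refine h1.trans (mul_le_mul_of_nonneg_right ?_ (sum_multiIndices_nonneg _ _ _))
  have h4 : d ^ (m - 1) ≤ T.size ^ s * D ^ p :=
    pow_le_pow_mul_pow hd0.le (T.diam_le_size hΩb e) hdD hD1 hsm (by omega)
  calc C * d ^ (2 * (m - 1)) = C * (d ^ (m - 1)) ^ 2 := by rw [← pow_mul, mul_comm (m - 1)]
    _ ≤ C * (T.size ^ s * D ^ p) ^ 2 := by gcongr
    _ = _ := by ring

theorem MemUh.sub {T : TetMesh Ω} {R : RefElement p} (hΩ : IsOpen Ω)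
    (hΩb : Bornology.IsBounded Ω) {w z : E3 → ℝ} (hw : T.MemUh R w) (hz : T.MemUh R z) :
    T.MemUh R (w - z) := by
  refine ⟨hw.1.sub hΩ hΩb hz.1, fun i => ?_⟩
  obtain ⟨q, hq, hqw⟩ := hw.2 i
  obtain ⟨q', hq', hqz⟩ := hz.2 i
  refine ⟨q - q', Submodule.sub_mem _ hq hq', fun x hx => ?_⟩
  rw [Pi.sub_apply, hqw x hx, hqz x hx, polyEval_sub, Pi.sub_apply]

end TetMesh

/-! ### The elliptic form -/

section ellForm

variable {Ω : Set E3} {c : E3 → ℝ} {c₀ c₁ : ℝ}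

theorem memLp_coeff_mul (hΩ : IsOpen Ω) (hc : AEStronglyMeasurable c (volume.restrict Ω))
    (hc₀ : 0 < c₀) (hcb : ∀ x ∈ Ω, c₀ ≤ c x ∧ c x ≤ c₁) {f : E3 → ℝ}
    (hf : MemLp f 2 (volume.restrict Ω)) : MemLp (fun x => c x * f x) 2 (volume.restrict Ω) := by
  refine MemLp.of_le_mul (c := c₁) hf (hc.mul hf.aestronglyMeasurable) ?_
  filter_upwards [ae_restrict_mem hΩ.measurableSet] with x hx
  obtain ⟨h1, h2⟩ := hcb x hx
  rw [norm_mul, Real.norm_of_nonneg (hc₀.le.trans h1)]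
  exact mul_le_mul_of_nonneg_right h2 (norm_nonneg _)

theorem ellForm_eq (hΩ : IsOpen Ω) (hc : AEStronglyMeasurable c (volume.restrict Ω))
    (hc₀ : 0 < c₀) (hcb : ∀ x ∈ Ω, c₀ ≤ c x ∧ c x ≤ c₁) {u w : E3 → ℝ} {H G : Fin 3 → E3 → ℝ}
    (hu : IsWeakGrad Ω u H) (hw : IsWeakGrad Ω w G) :
    ellForm Ω c u w = ∑ i, ∫ x in Ω, (c x * H i x) * G i x := by
  rw [← integral_finsetSum _ fun i _ =>
    integrable_mul_of_memLp (memLp_coeff_mul hΩ hc hc₀ hcb (hu.2 i).1) (hw.2 i).1]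
  refine integral_congr_ae ?_
  have h1 : ∀ᵐ x ∂volume.restrict Ω, ∀ i, weakDeriv Ω (Pi.single i 1) u x = H i x :=
    ae_all_iff.2 fun i => weakDeriv_ae_eq hΩ (hu.2 i)
  have h2 : ∀ᵐ x ∂volume.restrict Ω, ∀ i, weakDeriv Ω (Pi.single i 1) w x = G i x :=
    ae_all_iff.2 fun i => weakDeriv_ae_eq hΩ (hw.2 i)
  filter_upwards [h1, h2] with x hx hx'
  rw [Finset.mul_sum]
  exact Finset.sum_congr rfl fun i _ => by rw [hx, hx', mul_assoc]

theorem coercive (hΩ : IsOpen Ω) (hc : AEStronglyMeasurable c (volume.restrict Ω))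
    (hc₀ : 0 < c₀) (hcb : ∀ x ∈ Ω, c₀ ≤ c x ∧ c x ≤ c₁) {f : E3 → ℝ}
    (hf : MemLp f 2 (volume.restrict Ω)) :
    c₀ * ∫ x in Ω, f x ^ 2 ≤ ∫ x in Ω, (c x * f x) * f x := by
  rw [← integral_const_mul]
  refine setIntegral_mono_on (hf.integrable_sq.const_mul _)
    (integrable_mul_of_memLp (memLp_coeff_mul hΩ hc hc₀ hcb hf) hf) hΩ.measurableSet fun x hx => ?_
  rw [mul_assoc, ← sq]
  exact mul_le_mul_of_nonneg_right (hcb x hx).1 (sq_nonneg _)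

theorem setIntegral_coeff_mul_sq_le (hΩ : IsOpen Ω)
    (hc : AEStronglyMeasurable c (volume.restrict Ω))
    (hc₀ : 0 < c₀) (hcb : ∀ x ∈ Ω, c₀ ≤ c x ∧ c x ≤ c₁) {f : E3 → ℝ}
    (hf : MemLp f 2 (volume.restrict Ω)) :
    ∫ x in Ω, (c x * f x) ^ 2 ≤ c₁ ^ 2 * ∫ x in Ω, f x ^ 2 := by
  rw [← integral_const_mul]
  refine setIntegral_mono_on (memLp_coeff_mul hΩ hc hc₀ hcb hf).integrable_sq
    (hf.integrable_sq.const_mul _) hΩ.measurableSet fun x hx => ?_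
  obtain ⟨h1, h2⟩ := hcb x hx
  rw [mul_pow]
  have : 0 ≤ c x := hc₀.le.trans h1
  gcongr

/-- Strang's estimate for the difference of the discrete solution and a function of the discrete
space, in terms of the consistency error `Y`. -/
theorem strang (hΩ : IsOpen Ω) (hc : AEStronglyMeasurable c (volume.restrict Ω))
    (hc₀ : 0 < c₀) (hcb : ∀ x ∈ Ω, c₀ ≤ c x ∧ c x ≤ c₁) {u χ z : E3 → ℝ} {H K L : Fin 3 → E3 → ℝ}
    (hu : IsWeakGrad Ω u H) (hχ : IsWeakGrad Ω χ K) (hz : IsWeakGrad Ω z L) {Y : ℝ}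
    (hY : ellForm Ω c u (χ - z) - ellForm Ω c z (χ - z) = Y) {B : ℝ} (hB : 0 ≤ B)
    (hYB : Y ^ 2 ≤ B * ∑ i, ∫ x in Ω, (K i - L i) x ^ 2) :
    c₀ ^ 2 * ∑ i, ∫ x in Ω, (K i - L i) x ^ 2 ≤
      2 * (c₁ ^ 2 * (∑ i, ∫ x in Ω, (H i - K i) x ^ 2) + B) := by
  set S := ∑ i, ∫ x in Ω, (K i - L i) x ^ 2 with hS
  set A := ∑ i, ∫ x in Ω, (H i - K i) x ^ 2 with hA
  have hS0 : 0 ≤ S := Finset.sum_nonneg fun _ _ => setIntegral_sq_nonneg _ _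
  have hA0 : 0 ≤ A := Finset.sum_nonneg fun _ _ => setIntegral_sq_nonneg _ _
  have hG := hχ.sub hz
  have hHK := hu.sub hχ
  rw [ellForm_eq hΩ hc hc₀ hcb hu hG, ellForm_eq hΩ hc hc₀ hcb hz hG] at hY
  set X := ∑ i, ∫ x in Ω, (c x * (H i - K i) x) * (K i - L i) x with hX
  have hcS : c₀ * S ≤ ∑ i, ∫ x in Ω, (c x * (K i - L i) x) * (K i - L i) x := by
    rw [hS, Finset.mul_sum]
    exact Finset.sum_le_sum fun i _ => coercive hΩ hc hc₀ hcb (hG.2 i).1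
  -- With `e = χ - z`, this is `a(e, e) = (a(u, e) - a(z, e)) - a(u - χ, e)`.
  have hid : ∑ i, ∫ x in Ω, (c x * (K i - L i) x) * (K i - L i) x = Y - X := by
    rw [← hY, hX, ← Finset.sum_sub_distrib, ← Finset.sum_sub_distrib]
    refine Finset.sum_congr rfl fun i _ => ?_
    have i1 : Integrable (fun x => (c x * H i x) * (K i - L i) x) (volume.restrict Ω) :=
      integrable_mul_of_memLp (memLp_coeff_mul hΩ hc hc₀ hcb (hu.2 i).1) (hG.2 i).1
    have i2 : Integrable (fun x => (c x * L i x) * (K i - L i) x) (volume.restrict Ω) :=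
      integrable_mul_of_memLp (memLp_coeff_mul hΩ hc hc₀ hcb (hz.2 i).1) (hG.2 i).1
    have i3 : Integrable (fun x => (c x * (H i - K i) x) * (K i - L i) x) (volume.restrict Ω) :=
      integrable_mul_of_memLp (memLp_coeff_mul hΩ hc hc₀ hcb (hHK.2 i).1) (hG.2 i).1
    have i4 : Integrable (fun x => (c x * H i x) * (K i - L i) x -
        (c x * L i x) * (K i - L i) x) (volume.restrict Ω) := i1.sub i2
    rw [← integral_sub i1 i2, ← integral_sub i4 i3]
    refine integral_congr_ae (ae_of_all _ fun x => ?_)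
    simp only [Pi.sub_apply]
    ring
  have hX2 : X ^ 2 ≤ c₁ ^ 2 * A * S := by
    refine sq_sum_le_of_sq_le _ (sq_nonneg _) (fun _ _ => setIntegral_sq_nonneg _ _)
      (fun _ _ => setIntegral_sq_nonneg _ _) fun i _ => ?_
    refine (setIntegral_mul_sq_le (memLp_coeff_mul hΩ hc hc₀ hcb (hHK.2 i).1) (hG.2 i).1).trans ?_
    exact mul_le_mul_of_nonneg_right (setIntegral_coeff_mul_sq_le hΩ hc hc₀ hcb (hHK.2 i).1)
      (setIntegral_sq_nonneg _ _)
  rw [hid] at hcS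
  -- Both `X ^ 2` and `Y ^ 2` carry a factor `S`, so the squared coercivity estimate can be divided
  -- by `S`.
  rcases hS0.eq_or_lt with h0 | hpos
  · rw [← h0, mul_zero]
    positivity
  · have h1 : (c₀ * S) ^ 2 ≤ 2 * (c₁ ^ 2 * A + B) * S := by
      calc (c₀ * S) ^ 2 ≤ (Y - X) ^ 2 := pow_le_pow_left₀ (by positivity) hcS 2
        _ ≤ 2 * (Y ^ 2 + X ^ 2) := by nlinarith [sq_nonneg (Y + X)]
        _ ≤ _ := by linarith
    have h2 : (c₀ ^ 2 * S) * S ≤ 2 * (c₁ ^ 2 * A + B) * S := by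
      calc _ = (c₀ * S) ^ 2 := by ring
        _ ≤ _ := h1
    exact le_of_mul_le_mul_right h2 hpos

end ellForm

end MassLump
/-- `H¹`-convergence of the mass-lumped finite element method. The constant `C` depends on the
domain, the coefficient, the reference element with its quadrature rule, and the shape-regularity
parameter `σ` only. The right-hand side `v ∈ H^{k_v}(Ω)`, `k_v ≥ 2`, which is evaluated at nodes, is
given by its (unique) representative that is continuous on `closure Ω`. -/
theorem mainTheorem4 (Ω : Set MassLump.E3) (hΩ : IsOpen Ω) (hΩb : Bornology.IsBounded Ω)
    (hΩL : MassLump.HasLipschitzBoundary Ω)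
    (c : MassLump.E3 → ℝ) (hc : AEStronglyMeasurable c (volume.restrict Ω))
    (c₀ c₁ : ℝ) (hc₀ : 0 < c₀) (hcb : ∀ x ∈ Ω, c₀ ≤ c x ∧ c x ≤ c₁)
    (p : ℕ) (hp : 2 ≤ p) (R : MassLump.RefElement p)
    (hRpos : R.PositiveWeights) (hRex : R.ExactQuadrature) (σ : ℝ) :
    ∃ C : ℝ, 0 < C ∧ ∀ T : MassLump.TetMesh Ω, T.ShapeRegular σ →
      ∀ ku kv : ℕ, 2 ≤ ku → 2 ≤ kv → ∀ u v uh : MassLump.E3 → ℝ,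
        MassLump.MemH Ω ku u → MassLump.MemH Ω kv v → ContinuousOn v (closure Ω) →
        MassLump.IsWeakSolution Ω c v u → T.IsDiscreteSolution R c v uh →
        MassLump.sobolevNorm Ω 1 (u - uh) ≤
          C * T.size ^ (min p (min (ku - 1) kv)) *
            (MassLump.sobolevNorm Ω (min (p + 1) ku) u +
              MassLump.sobolevNorm Ω (min p kv) v) := by
  obtain ⟨P, hP0, hP⟩ := MassLump.exists_poincare_memH10 hΩ hΩb
  obtain ⟨Q, hQ0, hQ⟩ := MassLump.TetMesh.exists_quad_error_le R hΩ hΩb hΩL hp hRex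
  obtain ⟨I, hI0, hI⟩ := MassLump.TetMesh.exists_interp_error_le R hΩ hΩb hΩL σ
  -- `K₁` gathers the interpolation error, which enters directly and through Strang's estimate; `K₂`
  -- gathers the quadrature error.
  set K₁ := P * (2 * I + 2 * (2 * (c₁ ^ 2 * I) / c₀ ^ 2)) with hK₁
  set K₂ := P * (2 * (2 * (Q * P) / c₀ ^ 2)) with hK₂
  have hK₁0 : 0 < K₁ := by positivity
  have hK₂0 : 0 < K₂ := by positivity
  refine ⟨√(K₁ + K₂), by positivity, ?_⟩
  intro T hT ku kv hku hkv u v uh hu hv hvc hsol hdisc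
  set s := min p (min (ku - 1) kv) with hs
  set U := MassLump.sobolevNorm Ω (min (p + 1) ku) u with hU
  set V := MassLump.sobolevNorm Ω (min p kv) v with hV
  have hU0 : 0 ≤ U := MassLump.sobolevNorm_nonneg _ _ _
  have hV0 : 0 ≤ V := MassLump.sobolevNorm_nonneg _ _ _
  have hh0 : 0 ≤ T.size ^ s := pow_nonneg T.size_nonneg s
  obtain ⟨g, hgc, hgu, hgf⟩ := T.exists_continuous_rep hΩ hΩb hΩL (hu.mono hku) hsol.1
  have hχ := T.memUh_interp R hΩ hΩb hΩL hgf
  set χ := T.interp R g with hχdef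
  have he : T.MemUh R (χ - uh) := MassLump.TetMesh.MemUh.sub hΩ hΩb hχ hdisc.1
  have hGu := hsol.1.1.isWeakGrad
  have hGχ := hχ.1.1.isWeakGrad
  have hGh := hdisc.1.1.1.isWeakGrad
  set H := fun i => MassLump.weakDeriv Ω (Pi.single i 1) u with hH
  set K := fun i => MassLump.weakDeriv Ω (Pi.single i 1) χ with hK
  set L := fun i => MassLump.weakDeriv Ω (Pi.single i 1) uh with hL
  -- The rate `s` is at most `min (p + 1) ku - 1`, the local order of the interpolation error, and
  -- at most `min p kv`, that of the quadrature error.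
  have hA := hI T hT (min (p + 1) ku) s (by omega) (by omega) (by omega) u g
    (hu.mono (min_le_right _ _)) hgc hgu K hGχ
  have hq := hQ T (min p kv) s (by omega) (by omega) (by omega) v (χ - uh)
    (hv.mono (min_le_right _ _)) hvc he
  have hpe := hP _ _ he.1 (hGχ.sub hGh)
  set S := ∑ i, ∫ x in Ω, (K i - L i) x ^ 2 with hS
  set A := ∑ i, ∫ x in Ω, (H i - K i) x ^ 2 with hAdef
  have hS0 : 0 ≤ S := Finset.sum_nonneg fun _ _ => MassLump.setIntegral_sq_nonneg _ _
  -- Both equations are tested with `χ - uh`, which lies in `U_h` and hence in `H₀¹(Ω)`; the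
  -- consistency error is then exactly the quadrature error.
  have hstrang := MassLump.strang hΩ hc hc₀ hcb hGu hGχ hGh
    (Y := (∫ x in Ω, v x * (χ - uh) x) - T.quad R v (χ - uh))
    (by rw [hsol.2 _ he.1, hdisc.2 _ he]) (B := Q * (T.size ^ s) ^ 2 * V ^ 2 * P)
    (by positivity)
    (hq.trans (by
      rw [mul_assoc (_ * V ^ 2)]
      exact mul_le_mul_of_nonneg_left hpe (by positivity)))
  have huh := hP _ _ (hsol.1.sub hΩ hΩb hdisc.1.1) (hGu.sub hGh)
  have htri : ∑ i, ∫ x in Ω, (H i - L i) x ^ 2 ≤ 2 * A + 2 * S := by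
    rw [hAdef, hS, Finset.mul_sum, Finset.mul_sum, ← Finset.sum_add_distrib]
    refine Finset.sum_le_sum fun i _ => ?_
    have := MassLump.setIntegral_add_sq_le ((hGu.sub hGχ).2 i).1 ((hGχ.sub hGh).2 i).1
    refine le_trans (le_of_eq ?_) this
    refine integral_congr_ae (ae_of_all _ fun x => ?_)
    simp only [Pi.sub_apply]
    ring
  have hS2 : S ≤ 2 * (c₁ ^ 2 * (I * (T.size ^ s) ^ 2 * U ^ 2) +
      Q * (T.size ^ s) ^ 2 * V ^ 2 * P) / c₀ ^ 2 := by
    rw [le_div_iff₀ (by positivity), mul_comm]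
    refine hstrang.trans ?_
    gcongr
  refine le_of_sq_le_sq ?_ (by positivity)
  calc MassLump.sobolevNorm Ω 1 (u - uh) ^ 2 ≤ P * (2 * A + 2 * S) :=
        huh.trans (mul_le_mul_of_nonneg_left htri hP0.le)
    _ ≤ P * (2 * (I * (T.size ^ s) ^ 2 * U ^ 2) + 2 * (2 * (c₁ ^ 2 * (I * (T.size ^ s) ^ 2 * U ^ 2) +
          Q * (T.size ^ s) ^ 2 * V ^ 2 * P) / c₀ ^ 2)) := by gcongr
    _ = (T.size ^ s) ^ 2 * (K₁ * U ^ 2 + K₂ * V ^ 2) := by rw [hK₁, hK₂]; ring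
    _ ≤ (T.size ^ s) ^ 2 * ((K₁ + K₂) * (U + V) ^ 2) := by
        refine mul_le_mul_of_nonneg_left ?_ (sq_nonneg _)
        have h1 : 0 ≤ U * V := mul_nonneg hU0 hV0
        nlinarith [mul_nonneg hK₁0.le h1, mul_nonneg hK₂0.le h1, mul_nonneg hK₁0.le (sq_nonneg V),
          mul_nonneg hK₂0.le (sq_nonneg U)]
    _ = (√(K₁ + K₂) * T.size ^ s * (U + V)) ^ 2 := by
        rw [mul_pow, mul_pow, Real.sq_sqrt (by positivity)]
        ring
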